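/- Let $p,q\ge 1$, let $x_1,\dots,x_s$ be distinct points of $\mathbb{P}^1=\mathbb{CP}^1$, $D=x_1+\dots+x_s$, and let $\mathcal K$ be the canonical bundle of $\mathbb{P}^1$. A parabolic bundle $\mathcal E_\bullet$ of rank $n$ on $\mathbb P^1\setminus\{x_1,\dots,x_s\}$ is a holomorphic vector bundle $\mathcal E$ of rank $n$ on $\mathbb{P}^1$ with, at each $x_j$, a decreasing left-continuous filtration $(\mathcal E_{x_j,c})_{c\in\mathbb R}$ of the fibre $\mathcal E_{x_j}$ by subspaces, with $\mathcal E_{x_j,0}=\mathcal E_{x_j}$ and $\mathcal E_{x_j,1}=0$. Its type at $x_j$ is the nondecreasing $n$-tuple of the jumps $c\in[0,1)$ of the filtration, each repeated $\dim(\mathcal E_{x_j,c}/\bigcup_{b>c}\mathcal E_{x_j,b})$ times, and its parabolic degree $\deg(\mathcal E_\bullet)$ is $\deg\mathcal E$ plus the sum of all these weights over all $x_j$. Subbundles carry the induced filtrations. $\mathrm{Hom}(\mathcal E_\bullet,\mathcal F_\bullet)$ denotes the sheaf of homomorphisms $\mathcal E\to\mathcal F$ that at each $x_j$ map $\mathcal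 E_{x_j,c}$ into $\bigcup_{b>c}\mathcal F_{x_j,b}$ for all $c$. A parabolic $\mathrm{SU}(p,q)$ Higgs bundle $(\mathcal U_\bullet\oplus\mathcal V_\bullet,\gamma\oplus\delta)$ consists of parabolic bundles $\mathcal U_\bullet,\mathcal V_\bullet$ of ranks $p,q$ such that $\det(\mathcal U_\bullet)\otimes\det(\mathcal V_\bullet)$ is the trivial line bundle with trivial parabolic structure, and of sections $\gamma\in H^0(\mathcal K(D)\otimes\mathrm{Hom}(\mathcal U_\bullet,\mathcal V_\bullet))$, $\delta\in H^0(\mathcal K(D)\otimes\mathrm{Hom}(\mathcal V_\bullet,\mathcal U_\bullet))$. It is semistable if $\deg(\mathcal U'_\bullet\oplus\mathcal V'_\bullet)\le 0$ for all holomorphic subbundles $\mathcal U'\subset\mathcal U$, $\mathcal V'\subset\mathcal V$ with $\mathcal U'\oplus\mathcal V'$ invariant under $\gamma\oplus\delta$. It has type $(\alpha,\beta)$ if $\mathcal U_\bullet$ and $\mathcal V_\bullet$ have types $\alpha^j=(\alpha^j_1\le\dots\le\alpha^j_p)$ and $\beta^j=(\beta^j_1\le\dots\le\beta^j_q)$ at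 $x_j$ for all $j$. An $\mathrm{SU}(p,q)$-multiweight is a pair $(\alpha,\beta)$ with $0\le\alpha^j_1\le\dots\le\alpha^j_p<1$, $0\le\beta^j_1\le\dots\le\beta^j_q<1$ and $\sum_i\alpha^j_i+\sum_i\beta^j_i\in\mathbb N$ for all $j\in\{1,\dots,s\}$. **Proposition.** Let $(\alpha,\beta)$ be an $\mathrm{SU}(p,q)$-multiweight such that 1. $\alpha^j_p<\beta^j_1$ for all $j\in\{1,\dots,s\}$, 2. $\varepsilon:=\sum_{j=1}^s(\beta^j_q-\alpha^j_1)<2$. Let $(\mathcal U_\bullet\oplus\mathcal V_\bullet,\gamma\oplus\delta)$ be a semistable parabolic $\mathrm{SU}(p,q)$ Higgs bundle of type $(\alpha,\beta)$. If $\deg(\mathcal U_\bullet)-\deg(\mathcal V_\bullet)<2-\varepsilon$, then $\delta$ vanishes identically. -/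

import Mathlib

open Bundle Filter Module
open scoped Manifold ContDiff Topology OnePoint

/-! ### The Riemann sphere as a complex manifold -/

namespace RiemannSphere

/-- The inversion `z ↦ 1 / z` of the Riemann sphere `ℂ ∪ {∞}`. -/
noncomputable def inv (x : OnePoint ℂ) : OnePoint ℂ :=
  x.elim ((0 : ℂ) : OnePoint ℂ) (fun z => if z = 0 then (∞ : OnePoint ℂ) else ((z⁻¹ : ℂ) : OnePoint ℂ))

@[simp] theorem inv_infty : inv (∞ : OnePoint ℂ) = ((0 : ℂ) : OnePoint ℂ) := rfl

@[simp] theorem inv_zero : inv ((0 : ℂ) : OnePoint ℂ) = (∞ : OnePoint ℂ) := by simp [inv]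

theorem inv_coe {z : ℂ} (hz : z ≠ 0) : inv (z : OnePoint ℂ) = ((z⁻¹ : ℂ) : OnePoint ℂ) := by
  simp [inv, hz]

theorem inv_inv (x : OnePoint ℂ) : inv (inv x) = x := by
  induction x using OnePoint.rec with
  | infty => simp
  | coe z =>
    by_cases hz : z = 0
    · subst hz; simp
    · rw [inv_coe hz, inv_coe (inv_ne_zero hz), _root_.inv_inv]

theorem continuous_inv : Continuous inv := by
  rw [continuous_iff_continuousAt]
  intro x
  induction x using OnePoint.rec with
  | infty =>
    rw [OnePoint.continuousAt_infty', inv_infty, coclosedCompact_eq_cocompact]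
    have h : Tendsto (fun z : ℂ => ((z⁻¹ : ℂ) : OnePoint ℂ)) (cocompact ℂ)
        (𝓝 ((0 : ℂ) : OnePoint ℂ)) :=
      (OnePoint.continuous_coe.tendsto 0).comp (tendsto_inv₀_cobounded.mono_left
        Metric.cobounded_eq_cocompact.ge)
    refine h.congr' ?_
    have h0 : ∀ᶠ z : ℂ in cocompact ℂ, z ≠ 0 :=
      (isCompact_singleton (x := (0 : ℂ))).compl_mem_cocompact
    filter_upwards [h0] with z hz
    exact (inv_coe hz).symm
  | coe z =>
    rw [OnePoint.continuousAt_coe]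
    by_cases hz : z = 0
    · subst hz
      have h : Tendsto (inv ∘ ((↑) : ℂ → OnePoint ℂ)) (𝓝[≠] 0) (𝓝 (∞ : OnePoint ℂ)) := by
        have h1 : Tendsto (fun z : ℂ => ((z⁻¹ : ℂ) : OnePoint ℂ)) (𝓝[≠] 0)
            (𝓝 (∞ : OnePoint ℂ)) := by
          refine OnePoint.tendsto_coe_infty.comp ?_
          rw [coclosedCompact_eq_cocompact, ← Metric.cobounded_eq_cocompact]
          exact tendsto_inv₀_nhdsNE_zero
        refine h1.congr' ?_
        filter_upwards [self_mem_nhdsWithin] with z hz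
        exact (inv_coe hz).symm
      rw [continuousAt_iff_punctured_nhds]
      simpa using h
    · have h : ContinuousAt (fun z : ℂ => ((z⁻¹ : ℂ) : OnePoint ℂ)) z :=
        OnePoint.continuous_coe.continuousAt.comp (continuousAt_inv₀ hz)
      refine h.congr ?_
      filter_upwards [isOpen_ne.mem_nhds hz] with w hw
      exact (inv_coe hw).symm

/-- The inversion as a homeomorphism. -/
noncomputable def invHomeo : OnePoint ℂ ≃ₜ OnePoint ℂ where
  toFun := inv
  invFun := inv
  left_inv := inv_inv
  right_inv := inv_inv
  continuous_toFun := continuous_inv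
  continuous_invFun := continuous_inv

/-- The affine coordinate `z` on `ℂ ⊆ ℂ ∪ {∞}`. -/
noncomputable def affineChart : OpenPartialHomeomorph (OnePoint ℂ) ℂ :=
  (OnePoint.isOpenEmbedding_coe.toOpenPartialHomeomorph ((↑) : ℂ → OnePoint ℂ)).symm

/-- The coordinate `1 / z` on `(ℂ ∪ {∞}) \ {0}`. -/
noncomputable def inftyChart : OpenPartialHomeomorph (OnePoint ℂ) ℂ :=
  invHomeo.toOpenPartialHomeomorph.trans affineChart

theorem affineChart_source : affineChart.source = Set.range ((↑) : ℂ → OnePoint ℂ) := by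
  simp [affineChart]

theorem affineChart_symm_apply (z : ℂ) : affineChart.symm z = (z : OnePoint ℂ) := rfl

theorem affineChart_coe (z : ℂ) : affineChart (z : OnePoint ℂ) = z :=
  affineChart.right_inv (x := z) (by simp [affineChart])

theorem inftyChart_source : inftyChart.source = {((0 : ℂ) : OnePoint ℂ)}ᶜ := by
  ext x
  simp only [inftyChart, OpenPartialHomeomorph.trans_source, affineChart_source]
  induction x using OnePoint.rec with
  | infty => simp [invHomeo]
  | coe z =>
    by_cases hz : z = 0
    · subst hz; simp [invHomeo]
    · simp [invHomeo, hz, inv_coe hz]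

/-- The Riemann sphere with its two standard charts: `z` around the finite points and `1 / z`
around `∞`. -/
noncomputable instance : ChartedSpace ℂ (OnePoint ℂ) where
  atlas := {affineChart, inftyChart}
  chartAt x := x.elim inftyChart (fun _ => affineChart)
  mem_chart_source x := by
    induction x using OnePoint.rec with
    | infty => simp [inftyChart_source]
    | coe z => simp [affineChart_source]
  chart_mem_atlas x := by
    induction x using OnePoint.rec with
    | infty => simp
    | coe z => simp

theorem contDiffOn_aux {f : ℂ → ℂ} {s : Set ℂ} (h : ∀ z ∈ s, z ≠ 0 ∧ f z = z⁻¹) :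
    ContDiffOn ℂ ω f s :=
  ContDiffOn.congr (f := fun z => z⁻¹)
    (fun z hz => (contDiffAt_inv ℂ (h z hz).1).contDiffWithinAt) (fun z hz => (h z hz).2)

instance : IsManifold 𝓘(ℂ) ω (OnePoint ℂ) := by
  refine isManifold_of_contDiffOn _ _ _ ?_
  have key : ∀ e : OpenPartialHomeomorph (OnePoint ℂ) ℂ,
      ContDiffOn ℂ ω (e.symm.trans e : ℂ → ℂ) (e.symm.trans e).source := fun e =>
    contDiffOn_id.congr fun z hz => by
      simp only [OpenPartialHomeomorph.trans_source, Set.mem_inter_iff,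
        OpenPartialHomeomorph.symm_source] at hz
      simp [e.right_inv hz.1]
  rintro e e' (rfl | rfl) (rfl | rfl)
  · simpa using key affineChart
  · simp only [modelWithCornersSelf_coe, modelWithCornersSelf_coe_symm, Function.comp_id,
      Function.id_comp, Set.range_id, Set.inter_univ, Set.preimage_id]
    refine contDiffOn_aux fun z hz => ?_
    simp only [OpenPartialHomeomorph.trans_source, Set.mem_inter_iff, Set.mem_preimage,
      affineChart_symm_apply, inftyChart_source] at hz
    have hz0 : z ≠ 0 := by simpa using hz.2
    refine ⟨hz0, ?_⟩
    simp [inftyChart, affineChart_symm_apply, invHomeo, inv_coe hz0, affineChart_coe]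
  · simp only [modelWithCornersSelf_coe, modelWithCornersSelf_coe_symm, Function.comp_id,
      Function.id_comp, Set.range_id, Set.inter_univ, Set.preimage_id]
    refine contDiffOn_aux fun z hz => ?_
    have hs : inftyChart.symm z = inv (z : OnePoint ℂ) := by
      simp [inftyChart, affineChart_symm_apply, invHomeo]
    simp only [OpenPartialHomeomorph.trans_source, Set.mem_inter_iff, Set.mem_preimage,
      hs, affineChart_source] at hz
    have hz0 : z ≠ 0 := by
      rintro rfl
      simpa using hz.2
    refine ⟨hz0, ?_⟩
    simp [hs, inv_coe hz0, affineChart_coe]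
  · simpa using key inftyChart

end RiemannSphere

/-- The complex-valued function `f` on the Riemann sphere is meromorphic at `a`, of order `m`
there (in a local coordinate). -/
def HasOrderAt (f : OnePoint ℂ → ℂ) (a : OnePoint ℂ) (m : ℤ) : Prop :=
  MeromorphicAt (f ∘ (chartAt ℂ a).symm) (chartAt ℂ a a) ∧
    meromorphicOrderAt (f ∘ (chartAt ℂ a).symm) (chartAt ℂ a a) = m

/-! ### Holomorphic vector bundles -/

/-- Holomorphic vector bundles of rank `n` over the Riemann sphere. -/
structure HolVectorBundle (n : ℕ) where
  /-- The fibres. -/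
  Fib : OnePoint ℂ → Type
  [addCommGroup : ∀ x, AddCommGroup (Fib x)]
  [module : ∀ x, Module ℂ (Fib x)]
  [topFib : ∀ x, TopologicalSpace (Fib x)]
  [topTotal : TopologicalSpace (TotalSpace (Fin n → ℂ) Fib)]
  [fiberBundle : FiberBundle (Fin n → ℂ) Fib]
  [vectorBundle : VectorBundle ℂ (Fin n → ℂ) Fib]
  [holomorphic : ContMDiffVectorBundle ω (Fin n → ℂ) Fib 𝓘(ℂ)]

attribute [instance] HolVectorBundle.addCommGroup HolVectorBundle.module
  HolVectorBundle.topFib HolVectorBundle.topTotal HolVectorBundle.fiberBundle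
  HolVectorBundle.vectorBundle HolVectorBundle.holomorphic

/-- The vector field `X` is holomorphic near `a`. -/
def HolVectorFieldAt (X : ∀ x : OnePoint ℂ, TangentSpace 𝓘(ℂ) x) (a : OnePoint ℂ) : Prop :=
  ContMDiffAt 𝓘(ℂ) 𝓘(ℂ).tangent ω
    (fun x => (⟨x, X x⟩ : TangentBundle 𝓘(ℂ) (OnePoint ℂ))) a

namespace HolVectorBundle

variable {n : ℕ} (E : HolVectorBundle n)

/-- The section `s` of `E` is holomorphic near `a`. -/
def HolAt (s : ∀ x, E.Fib x) (a : OnePoint ℂ) : Prop :=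
  ContMDiffAt 𝓘(ℂ) (𝓘(ℂ).prod 𝓘(ℂ, Fin n → ℂ)) ω (fun x => TotalSpace.mk' (Fin n → ℂ) x (s x)) a

/-- `s 0, …, s (r - 1)` is a holomorphic frame, near `a`, of the family of subspaces `N x` of the
fibres of `E`. -/
def IsFrameAt (N : ∀ x, Submodule ℂ (E.Fib x)) {r : ℕ} (s : Fin r → ∀ x, E.Fib x)
    (a : OnePoint ℂ) : Prop :=
  (∀ i, E.HolAt (s i) a) ∧
    ∀ᶠ x in 𝓝 a, LinearIndependent ℂ (fun i => s i x) ∧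
      Submodule.span ℂ (Set.range fun i => s i x) = N x

/-- The subspaces `N x` of the fibres form a holomorphic subbundle of rank `r`. -/
def IsSubbundle (N : ∀ x, Submodule ℂ (E.Fib x)) (r : ℕ) : Prop :=
  ∀ a, ∃ s : Fin r → ∀ x, E.Fib x, E.IsFrameAt N s a

/-- `E` as a subbundle of itself. -/
def full : ∀ x, Submodule ℂ (E.Fib x) := fun _ => ⊤

/-- The rank `r` subbundle `N` has degree `d`: the dual of its determinant line bundle has a
nonzero meromorphic section `w` whose divisor `m` has degree `-d`. (A section of the dual of
`Λʳ N` assigns to `x` an alternating `r`-form on `N x`; we write it as the restriction of an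
alternating form on the fibre of `E`, only its values on `N x` are used.) -/
def HasDegree (N : ∀ x, Submodule ℂ (E.Fib x)) (r : ℕ) (d : ℤ) : Prop :=
  ∃ (w : ∀ x, E.Fib x [⋀^Fin r]→ₗ[ℂ] ℂ) (m : OnePoint ℂ →₀ ℤ),
    (∀ (a : OnePoint ℂ) (s : Fin r → ∀ x, E.Fib x), E.IsFrameAt N s a →
      HasOrderAt (fun x => w x (fun i => s i x)) a (m a)) ∧
    d = -(m.sum fun _ k => k)

/-- The degree of the rank `r` subbundle `N`. -/
noncomputable def degree (N : ∀ x, Submodule ℂ (E.Fib x)) (r : ℕ) : ℤ :=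
  Classical.epsilon (E.HasDegree N r)

end HolVectorBundle

/-! ### Parabolic structures -/

/-- A parabolic structure at a point, as a weighted flag in the fibre `M`: `fil c` is the space of
values at the point of the germs of weight at least `c`. -/
structure ParabolicStructure (M : Type*) [AddCommGroup M] [Module ℂ M] where
  /-- The decreasing filtration. -/
  fil : ℝ → Submodule ℂ M
  antitone : Antitone fil
  left_cont : ∀ c, ∃ e > 0, fil (c - e) = fil c
  fil_zero : fil 0 = ⊤
  fil_one : fil 1 = ⊥

namespace ParabolicStructure

variable {M : Type*} [AddCommGroup M] [Module ℂ M] (P : ParabolicStructure M)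

/-- The part of the filtration of weights greater than `c` (a directed union). -/
def filGT (c : ℝ) : Submodule ℂ M := ⨆ b : Set.Ioi c, P.fil b

/-- The multiplicity of the weight `c`, i.e. the dimension of the jump of the filtration at `c`. -/
noncomputable def mult (c : ℝ) : ℕ := finrank ℂ (P.fil c) - finrank ℂ (P.filGT c)

/-- The sum of the weights, counted with multiplicity. -/
noncomputable def weight : ℝ := ∑ᶠ c : ℝ, (P.mult c : ℝ) * c

/-- The parabolic type: the weights in increasing order, repeated according to multiplicity. -/
def HasType {n : ℕ} (α : Fin n → ℝ) : Prop :=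
  Monotone α ∧ ∀ c, P.mult c = (Finset.univ.filter fun i => α i = c).card

/-- The structure induced on a subspace. -/
def induced (N : Submodule ℂ M) : ParabolicStructure N where
  fil c := (P.fil c).comap N.subtype
  antitone _ _ h := Submodule.comap_mono (P.antitone h)
  left_cont c := by
    obtain ⟨e, he, h⟩ := P.left_cont c
    exact ⟨e, he, by rw [h]⟩
  fil_zero := by rw [P.fil_zero, Submodule.comap_top]
  fil_one := by rw [P.fil_one, Submodule.comap_bot, Submodule.ker_subtype]

end ParabolicStructure

/-- Parabolic bundles of rank `n` over the Riemann sphere punctured at the points `x j`. -/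
structure ParabolicBundle {s : ℕ} (x : Fin s → OnePoint ℂ) (n : ℕ) extends HolVectorBundle n where
  /-- The parabolic structure at the `j`-th puncture. -/
  par : ∀ j, ParabolicStructure (Fib (x j))

namespace ParabolicBundle

variable {s : ℕ} {x : Fin s → OnePoint ℂ} {m n : ℕ}

/-- The parabolic degree. -/
noncomputable def parDegree (E : ParabolicBundle x n) : ℝ :=
  E.degree E.full n + ∑ j, (E.par j).weight

/-- The parabolic degree of a rank `r` subbundle `N` with the induced parabolic structure. -/
noncomputable def parDegreeSub (E : ParabolicBundle x n) (N : ∀ y, Submodule ℂ (E.Fib y)) (r : ℕ) :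
    ℝ :=
  E.degree N r + ∑ j, ((E.par j).induced (N (x j))).weight

/-- Holomorphic sections of `K(D) ⊗ Hom(E, F)`, for parabolic bundles `E` and `F` and
(strongly) parabolic homomorphisms. Such a section is a holomorphic one-form
on the complement of the punctures with values in `Hom(E, F)`, i.e. it contracts with a
holomorphic vector field and a holomorphic section of `E` to a holomorphic section of `F`, such that
at a puncture, the contraction with a vector field that vanishes there extends holomorphically
(simple pole) and the value of the extension obeys the condition on the weights.
The value of `toFun` at a puncture is immaterial. -/
structure HiggsHom (E : ParabolicBundle x m) (F : ParabolicBundle x n) where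
  /-- The value of the one-form at a point. -/
  toFun : ∀ y, TangentSpace 𝓘(ℂ) y →ₗ[ℂ] E.Fib y →ₗ[ℂ] F.Fib y
  holomorphic : ∀ a ∉ Set.range x, ∀ X, HolVectorFieldAt X a → ∀ u, E.HolAt u a →
    F.HolAt (fun y => toFun y (X y) (u y)) a
  parabolic : ∀ j, ∀ X, HolVectorFieldAt X (x j) → X (x j) = 0 → ∀ u, E.HolAt u (x j) →
    ∃ v, F.HolAt v (x j) ∧ (∀ᶠ y in 𝓝[≠] x j, v y = toFun y (X y) (u y)) ∧
      ∀ c, u (x j) ∈ (E.par j).fil c → v (x j) ∈ (F.par j).filGT c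

/-- `det U ⊗ det V` is, as a parabolic line bundle, isomorphic to the trivial line bundle with
trivial parabolic structure: at each puncture the sum `k j` of all weights is an
integer, and the dual of `det U ⊗ det V` has a meromorphic section with divisor `∑ k j • x j`,
i.e. `det U ⊗ det V` twisted by that divisor is trivial. -/
def TrivialDet (U : ParabolicBundle x m) (V : ParabolicBundle x n) : Prop :=
  ∃ k : Fin s → ℤ, (∀ j, (k j : ℝ) = (U.par j).weight + (V.par j).weight) ∧
    ∃ w : ∀ y, U.Fib y [⋀^Fin m]→ₗ[ℂ] (V.Fib y [⋀^Fin n]→ₗ[ℂ] ℂ),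
      ∀ (a : OnePoint ℂ) (u : Fin m → ∀ y, U.Fib y) (v : Fin n → ∀ y, V.Fib y),
        U.IsFrameAt U.full u a → V.IsFrameAt V.full v a →
        HasOrderAt (fun y => w y (fun i => u i y) (fun i => v i y)) a
          (∑ j, Finsupp.single (x j) (k j) a)

end ParabolicBundle

/-! ### Parabolic `SU(p,q)` Higgs bundles -/

/-- Parabolic `SU(p,q)` Higgs bundles `(U ⊕ V, γ ⊕ δ)` over the Riemann sphere punctured at the
points `x j`. -/
structure SUHiggsBundle {s : ℕ} (x : Fin s → OnePoint ℂ) (p q : ℕ) where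
  U : ParabolicBundle x p
  V : ParabolicBundle x q
  γ : ParabolicBundle.HiggsHom U V
  δ : ParabolicBundle.HiggsHom V U
  trivialDet : ParabolicBundle.TrivialDet U V

namespace SUHiggsBundle

variable {s : ℕ} {x : Fin s → OnePoint ℂ} {p q : ℕ}

/-- The pair of subbundles `U'` of `U` and `V'` of `V` is invariant under the Higgs field. -/
def Invariant (H : SUHiggsBundle x p q) (U' : ∀ y, Submodule ℂ (H.U.Fib y))
    (V' : ∀ y, Submodule ℂ (H.V.Fib y)) : Prop :=
  ∀ y ∉ Set.range x, ∀ X : TangentSpace 𝓘(ℂ) y,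
    (∀ u ∈ U' y, H.γ.toFun y X u ∈ V' y) ∧ (∀ v ∈ V' y, H.δ.toFun y X v ∈ U' y)

/-- Semistability: invariant subbundles `U' ⊕ V'` have nonpositive parabolic degree. -/
def Semistable (H : SUHiggsBundle x p q) : Prop :=
  ∀ (U' : ∀ y, Submodule ℂ (H.U.Fib y)) (V' : ∀ y, Submodule ℂ (H.V.Fib y)) (r t : ℕ),
    H.U.IsSubbundle U' r → H.V.IsSubbundle V' t → H.Invariant U' V' →
    H.U.parDegreeSub U' r + H.V.parDegreeSub V' t ≤ 0

/-- `H` has parabolic type `(α, β)`. -/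
def HasType (H : SUHiggsBundle x p q) (α : Fin s → Fin p → ℝ) (β : Fin s → Fin q → ℝ) : Prop :=
  ∀ j, (H.U.par j).HasType (α j) ∧ (H.V.par j).HasType (β j)

end SUHiggsBundle

/-- `SU(p,q)`-multiweights. -/
structure IsMultiweight {s p q : ℕ} (α : Fin s → Fin p → ℝ) (β : Fin s → Fin q → ℝ) : Prop where
  monotone_left : ∀ j, Monotone (α j)
  monotone_right : ∀ j, Monotone (β j)
  mem_left : ∀ j i, α j i ∈ Set.Ico (0 : ℝ) 1
  mem_right : ∀ j i, β j i ∈ Set.Ico (0 : ℝ) 1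
  integral : ∀ j, ∃ k : ℕ, ∑ i, α j i + ∑ i, β j i = k

/-! ### Splitting holomorphic functions across a segment -/

section Splitting

open Complex Set MeasureTheory

/-! The first weight condition kills the residues of δ. At a puncture take `c` to be the smallest
weight of `V`: then all of `V` has weight at least `c`, while `U` has no weight greater than `c`, so
a strongly parabolic map vanishes there and δ is a holomorphic section of `K ⊗ Hom(V, U)`
(`exists_extension`).

Let `r` be the generic rank of δ, `N ⊆ V` its kernel and `I ⊆ U` the saturation of its image. The
determinant of the induced map `V/N → K ⊗ I` is holomorphic and not identically zero, and `deg K =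
-2`, so `deg V - deg N ≤ deg I - 2r` (`HiggsHom.degree_le`). Both `0 ⊕ N` and `I ⊕ V` are invariant,
hence by semistability `pardeg N ≤ 0` and `pardeg I + pardeg V ≤ 0`. The `r` weights of `I` at a
puncture are at least the smallest weight of `U`, and the `r` weights of `V` missing from `N` are at
most the largest weight of `V`. Adding everything gives `2 pardeg V ≤ -r (2 - ε)`. The trivial
determinant gives `pardeg U = -pardeg V` (`parDegree_add_eq_zero`), so `pardeg U - pardeg V ≥ r (2 -
ε)`. Since `ε < 2`, the degree hypothesis forces `r = 0`, that is `δ = 0`.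

Most of the work supplies the geometry of the sphere behind these lines. A degree is read off from
the divisor of a meromorphic section of the dual determinant bundle, so such sections must exist
(`exists_meromorphic_section`). Frames are extended over large rectangles by splitting transition
functions with Cauchy integrals, and the two resulting discs are glued by factoring a function on an
annulus as `z ^ n` times an inner and an outer part. Degrees are compared through
`sum_order_eq_zero`: the divisor of a meromorphic function has degree zero. The kernel and the
saturated image become subbundles because the germs of holomorphic functions form a principal ideal
domain, over which δ has a Smith normal form (`exists_normalForm`); the number of nonzero diagonal
entries is locally constant, hence constant. -/

theorem differentiableAt_intervalIntegral_div_sub {φ γ : ℝ → ℂ} {a b : ℝ} (hab : a ≤ b)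
    (hφ : ContinuousOn φ (Icc a b)) (hγ : ContinuousOn γ (Icc a b)) {z : ℂ}
    (hz : ∀ t ∈ Icc a b, γ t ≠ z) :
    DifferentiableAt ℂ (fun w => ∫ t in a..b, φ t / (γ t - w)) z := by
  have hK : IsCompact (γ '' Icc a b) := isCompact_Icc.image_of_continuousOn hγ
  have hzK : z ∈ (γ '' Icc a b)ᶜ := by
    rintro ⟨t, ht, h⟩
    exact hz t ht h
  obtain ⟨e, he, hball⟩ := Metric.isOpen_iff.1 hK.isClosed.isOpen_compl z hzK
  have hlow : ∀ t ∈ Icc a b, ∀ w ∈ Metric.ball z (e / 2), e / 2 ≤ ‖γ t - w‖ := by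
    intro t ht w hw
    by_contra! hlt
    refine hball (a := γ t) ?_ ⟨t, ht, rfl⟩
    rw [Metric.mem_ball, dist_eq_norm] at hw ⊢
    calc ‖γ t - z‖ = ‖(γ t - w) + (w - z)‖ := by ring_nf
      _ ≤ ‖γ t - w‖ + ‖w - z‖ := norm_add_le _ _
      _ < e := by linarith
  have hne : ∀ t ∈ Icc a b, ∀ w ∈ Metric.ball z (e / 2), γ t - w ≠ 0 := fun t ht w hw h => by
    have := hlow t ht w hw
    rw [h, norm_zero] at this
    linarith
  obtain ⟨M, hM⟩ := isCompact_Icc.exists_bound_of_continuousOn hφ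
  have hcont : ∀ w ∈ Metric.ball z (e / 2), ContinuousOn (fun t => φ t / (γ t - w)) (Icc a b) :=
    fun w hw => hφ.div (hγ.sub continuousOn_const) fun t ht => hne t ht w hw
  have hint : ∀ w ∈ Metric.ball z (e / 2),
      IntervalIntegrable (fun t => φ t / (γ t - w)) volume a b := fun w hw =>
    ContinuousOn.intervalIntegrable (by rw [uIcc_of_le hab]; exact hcont w hw)
  have hzb : z ∈ Metric.ball z (e / 2) := Metric.mem_ball_self (by positivity)
  have hmem : ∀ t ∈ uIoc a b, t ∈ Icc a b := fun t ht => by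
    rw [uIoc_of_le hab] at ht
    exact Ioc_subset_Icc_self ht
  have key := intervalIntegral.hasDerivAt_integral_of_dominated_loc_of_deriv_le
    (μ := volume) (a := a) (b := b) (F := fun w t => φ t / (γ t - w))
    (F' := fun w t => φ t / (γ t - w) ^ 2) (x₀ := z) (s := Metric.ball z (e / 2))
    (bound := fun _ => M / (e / 2) ^ 2) (Metric.ball_mem_nhds _ (by positivity)) ?_ (hint z hzb)
    ?_ ?_ intervalIntegrable_const ?_
  · exact key.2.differentiableAt
  · filter_upwards [Metric.ball_mem_nhds z (by positivity : 0 < e / 2)] with w hw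
    exact (hint w hw).aestronglyMeasurable_restrict_uIoc
  · have : ContinuousOn (fun t => φ t / (γ t - z) ^ 2) (Icc a b) :=
      hφ.div ((hγ.sub continuousOn_const).pow 2) fun t ht => pow_ne_zero 2 (hne t ht z hzb)
    have h2 : IntervalIntegrable (fun t => φ t / (γ t - z) ^ 2) volume a b :=
      ContinuousOn.intervalIntegrable (by rwa [uIcc_of_le hab])
    exact h2.aestronglyMeasurable_restrict_uIoc
  · refine Eventually.of_forall fun t ht w hw => ?_
    rw [norm_div, norm_pow]
    have h1 := hM t (hmem t ht)
    have h2 := hlow t (hmem t ht) w hw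
    have : 0 ≤ M := (norm_nonneg _).trans h1
    gcongr
  · refine Eventually.of_forall fun t ht w hw => ?_
    have h := ((hasDerivAt_const w (γ t)).sub (hasDerivAt_id w)).inv (hne t (hmem t ht) w hw)
    have h' := h.const_mul (φ t)
    refine (h'.congr_deriv ?_)
    simp [div_eq_mul_inv]

/-- A quarter turn clockwise from the open first quadrant does not cross the branch cut. This
compares the branches of the logarithm used on two adjacent sides of a rectangle. -/
theorem log_mul_neg_I_of_pos {w : ℂ} (hre : 0 < w.re) (him : 0 < w.im) :
    log (w * -I) = log w - Real.pi / 2 * I := by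
  have hw : w ≠ 0 := fun h => by simp [h] at hre
  have h0 : 0 < arg w := by
    rcases (arg_nonneg_iff.2 him.le).eq_or_lt with h | h
    · have := arg_eq_zero_iff.1 h.symm
      exact absurd this.2 him.ne'
    · exact h
  have := (log_mul_eq_add_log_iff hw (neg_ne_zero.2 I_ne_zero)).2 (by
    rw [arg_neg_I]
    constructor <;> [linarith [Real.pi_pos]; linarith [Real.pi_pos, arg_le_pi w]])
  rw [this, log_neg_I]
  ring

/-- The constant `k` turns the line away from the negative real axis, so that the principal
logarithm provides a primitive; each side of a rectangle gets its own `k`. -/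
theorem hasDerivAt_log_line {k z : ℂ} (d p : ℂ) (t : ℝ)
    (h : (p + t * d - z) * k ∈ slitPlane) (hk : k ≠ 0) :
    HasDerivAt (fun t : ℝ => log ((p + t * d - z) * k)) (d / (p + t * d - z)) t := by
  have h1 : HasDerivAt (fun t : ℝ => (p + t * d - z) * k) (d * k) t := by
    have := (((ofRealCLM.hasDerivAt (x := t)).mul_const d).const_add p).sub_const z
    simpa using this.mul_const k
  have h2 := h1.clog_real h
  refine h2.congr_deriv ?_
  rw [mul_div_mul_right _ _ hk]

theorem integral_inv_line {k z : ℂ} (d p : ℂ) {a b : ℝ} (hab : a ≤ b) (hk : k ≠ 0)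
    (h : ∀ t ∈ Icc a b, (p + t * d - z) * k ∈ slitPlane) :
    d * ∫ t in a..b, 1 / (p + t * d - z) =
      log ((p + b * d - z) * k) - log ((p + a * d - z) * k) := by
  rw [← intervalIntegral.integral_eq_sub_of_hasDerivAt
    (f := fun t : ℝ => log ((p + t * d - z) * k)) (f' := fun t : ℝ => d / (p + t * d - z))
    (fun t ht => hasDerivAt_log_line d p t (h t (by rwa [uIcc_of_le hab] at ht)) hk),
    ← intervalIntegral.integral_const_mul]
  · simp [div_eq_mul_inv]
  · refine ContinuousOn.intervalIntegrable ?_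
    rw [uIcc_of_le hab]
    refine continuousOn_const.div (by fun_prop) fun t ht h0 => ?_
    have := h t ht
    rw [h0, zero_mul] at this
    exact zero_notMem_slitPlane this

/-- The boundary integral of a function on the rectangle `[a, b] × [c, d]`. -/
noncomputable def rectIntegral (f : ℂ → ℂ) (a b c d : ℝ) : ℂ :=
  (∫ x : ℝ in a..b, f (x + c * I)) - (∫ x : ℝ in a..b, f (x + d * I)) +
      I * (∫ y : ℝ in c..d, f (b + y * I)) - I * (∫ y : ℝ in c..d, f (a + y * I))

/-- The logarithms on the bottom, top, right and left sides are rotated by `I`, `-I`, `1` and `-1`.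
At each of the four corners the two branches differ by `π / 2 * I`, and these jumps add up to the
value of the integral. -/
theorem rectIntegral_inv {a b c d : ℝ} {z : ℂ} (ha : a < z.re) (hb : z.re < b) (hc : c < z.im)
    (hd : z.im < d) : rectIntegral (fun ζ => 1 / (ζ - z)) a b c d = 2 * Real.pi * I := by
  have e1 : (∫ x : ℝ in a..b, 1 / ((x : ℂ) + c * I - z)) =
      log ((b + c * I - z) * I) - log ((a + c * I - z) * I) := by
    have := integral_inv_line (k := I) (z := z) 1 (c * I) (ha.trans hb).le I_ne_zero
      (fun t _ => by rw [mem_slitPlane_iff]; left; simp; linarith)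
    simpa [add_comm] using this
  have e2 : (∫ x : ℝ in a..b, 1 / ((x : ℂ) + d * I - z)) =
      log ((b + d * I - z) * -I) - log ((a + d * I - z) * -I) := by
    have := integral_inv_line (k := -I) (z := z) 1 (d * I) (ha.trans hb).le (neg_ne_zero.2 I_ne_zero)
      (fun t _ => by rw [mem_slitPlane_iff]; left; simp; linarith)
    simpa [add_comm] using this
  have e3 : I * (∫ y : ℝ in c..d, 1 / ((b : ℂ) + y * I - z)) =
      log (b + d * I - z) - log (b + c * I - z) := by
    have := integral_inv_line (k := 1) (z := z) I b (hc.trans hd).le one_ne_zero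
      (fun t _ => by rw [mem_slitPlane_iff]; left; simp; linarith)
    simpa using this
  have e4 : I * (∫ y : ℝ in c..d, 1 / ((a : ℂ) + y * I - z)) =
      log ((a + d * I - z) * -1) - log ((a + c * I - z) * -1) := by
    exact integral_inv_line (k := -1) (z := z) I a (hc.trans hd).le (neg_ne_zero.2 one_ne_zero)
      (fun t _ => by rw [mem_slitPlane_iff]; left; simp; linarith)
  rw [rectIntegral, e1, e2, e3, e4]
  have r1 := log_mul_neg_I_of_pos (w := b + d * I - z) (by simp; linarith) (by simp; linarith)
  have r2 := log_mul_neg_I_of_pos (w := (a + d * I - z) * -I) (by simp; linarith)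
    (by simp; linarith)
  have r3 := log_mul_neg_I_of_pos (w := (a + c * I - z) * -1) (by simp; linarith)
    (by simp; linarith)
  have r4 := log_mul_neg_I_of_pos (w := (b + c * I - z) * I) (by simp; linarith)
    (by simp; linarith)
  have s2 : (a + d * I - z) * -I * -I = (a + d * I - z) * -1 := by
    rw [mul_assoc]; simp
  have s3 : (a + c * I - z) * -1 * -I = (a + c * I - z) * I := by ring
  have s4 : (b + c * I - z) * I * -I = b + c * I - z := by
    rw [mul_assoc]; simp
  rw [s2] at r2
  rw [s3] at r3
  rw [s4] at r4
  linear_combination (-1 : ℂ) * r1 - r2 - r3 - r4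

/-- The difference quotient `dslope f z` is holomorphic, so its boundary integral vanishes by
Cauchy's theorem; what remains is `f z` times the integral of `1 / (ζ - z)`. -/
theorem rectIntegral_div_sub {f : ℂ → ℂ} {a b c d : ℝ} {O : Set ℂ} (hO : IsOpen O)
    (hf : DifferentiableOn ℂ f O) (hsub : Icc a b ×ℂ Icc c d ⊆ O) {z : ℂ}
    (ha : a < z.re) (hb : z.re < b) (hc : c < z.im) (hd : z.im < d) :
    rectIntegral (fun ζ => f ζ / (ζ - z)) a b c d = 2 * Real.pi * I * f z := by
  have hab := (ha.trans hb).le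
  have hcd := (hc.trans hd).le
  have hzO : z ∈ O := hsub ⟨⟨ha.le, hb.le⟩, ⟨hc.le, hd.le⟩⟩
  have hds : DifferentiableOn ℂ (dslope f z) O :=
    (differentiableOn_dslope (hO.mem_nhds hzO)).2 hf
  have h0 := integral_boundary_rect_eq_zero_of_differentiableOn (dslope f z) (a + c * I)
    (b + d * I) (hds.mono (by simpa [uIcc_of_le hab, uIcc_of_le hcd] using hsub))
  simp only [add_re, ofReal_re, mul_re, I_re, mul_zero, ofReal_im, I_im, mul_one, sub_self,
    add_zero, add_im, mul_im, zero_add, smul_eq_mul] at h0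
  have hfc : ∀ γ : ℝ → ℂ, Continuous γ → ∀ p q : ℝ, p ≤ q → (∀ t ∈ Icc p q, γ t ∈ O) →
      (∀ t ∈ Icc p q, γ t ≠ z) →
      (∫ t in p..q, f (γ t) / (γ t - z)) =
        (∫ t in p..q, dslope f z (γ t)) + f z * ∫ t in p..q, 1 / (γ t - z) := by
    intro γ hγ p q hpq hmem hne
    rw [← intervalIntegral.integral_const_mul, ← intervalIntegral.integral_add]
    · refine intervalIntegral.integral_congr fun t ht => ?_
      rw [uIcc_of_le hpq] at ht
      have h1 : γ t - z ≠ 0 := sub_ne_zero.2 (hne t ht)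
      simp only [dslope_of_ne _ (hne t ht), slope_def_field]
      field_simp
      ring
    · refine ContinuousOn.intervalIntegrable ?_
      rw [uIcc_of_le hpq]
      exact hds.continuousOn.comp hγ.continuousOn hmem
    · refine ContinuousOn.intervalIntegrable ?_
      rw [uIcc_of_le hpq]
      exact continuousOn_const.mul (continuousOn_const.div (by fun_prop)
        fun t ht => sub_ne_zero.2 (hne t ht))
  have hI := rectIntegral_inv ha hb hc hd
  rw [rectIntegral] at hI ⊢
  rw [hfc (fun x => x + c * I) (by fun_prop) a b hab
      (fun t ht => hsub (by simpa [mem_reProdIm] using ⟨ht, hcd⟩))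
      (fun t ht h => by simp [← h] at hc),
    hfc (fun x => x + d * I) (by fun_prop) a b hab
      (fun t ht => hsub (by simpa [mem_reProdIm] using ⟨ht, hcd⟩))
      (fun t ht h => by simp [← h] at hd),
    hfc (fun y => b + y * I) (by fun_prop) c d hcd
      (fun t ht => hsub (by simpa [mem_reProdIm] using ⟨hab, ht⟩))
      (fun t ht h => by simp [← h] at hb),
    hfc (fun y => a + y * I) (by fun_prop) c d hcd
      (fun t ht => hsub (by simpa [mem_reProdIm] using ⟨hab, ht⟩))
      (fun t ht h => by simp [← h] at ha)]
  linear_combination h0 + f z * hI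

/-- A holomorphic function near a closed rectangle is the sum of a function that extends
holomorphically to the left and one that extends to the right. -/
theorem exists_add_split_rect {f : ℂ → ℂ} {a b c d : ℝ} {O : Set ℂ} (hO : IsOpen O)
    (hf : DifferentiableOn ℂ f O) (hab : a ≤ b) (hcd : c ≤ d)
    (hsub : Icc a b ×ℂ Icc c d ⊆ O) :
    ∃ f₁ f₂ : ℂ → ℂ, DifferentiableOn ℂ f₁ (Iio b ×ℂ Ioo c d) ∧
      DifferentiableOn ℂ f₂ (Ioi a ×ℂ Ioo c d) ∧
      ∀ z ∈ Ioo a b ×ℂ Ioo c d, f z = f₁ z + f₂ z := by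
  have hc1 : ∀ γ : ℝ → ℂ, Continuous γ → ∀ p q : ℝ, (∀ t ∈ Icc p q, γ t ∈ O) →
      ContinuousOn (fun t => f (γ t)) (Icc p q) := fun γ hγ p q h =>
    hf.continuousOn.comp hγ.continuousOn h
  have hbot := hc1 (fun x => x + c * I) (by fun_prop) a b
      (fun t ht => hsub (by simpa [mem_reProdIm] using ⟨ht, hcd⟩))
  have htop := hc1 (fun x => x + d * I) (by fun_prop) a b
      (fun t ht => hsub (by simpa [mem_reProdIm] using ⟨ht, hcd⟩))
  have hright := hc1 (fun y => b + y * I) (by fun_prop) c d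
      (fun t ht => hsub (by simpa [mem_reProdIm] using ⟨hab, ht⟩))
  have hleft := hc1 (fun y => a + y * I) (by fun_prop) c d
      (fun t ht => hsub (by simpa [mem_reProdIm] using ⟨hab, ht⟩))
  -- In Cauchy's formula the bottom, top and right sides give a function holomorphic to the left of
  -- `b` within the strip, and the left side gives one holomorphic to the right of `a`.
  refine ⟨fun z => (2 * Real.pi * I)⁻¹ * ((∫ x : ℝ in a..b, f (x + c * I) / (x + c * I - z)) -
      (∫ x : ℝ in a..b, f (x + d * I) / (x + d * I - z)) +
      I * (∫ y : ℝ in c..d, f (b + y * I) / (b + y * I - z))),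
    fun z => (2 * Real.pi * I)⁻¹ * (-(I * ∫ y : ℝ in c..d, f (a + y * I) / (a + y * I - z))),
    fun z hz => ?_, fun z hz => ?_, fun z hz => ?_⟩
  · rw [mem_reProdIm] at hz
    refine DifferentiableAt.differentiableWithinAt ?_
    refine ((DifferentiableAt.sub ?_ ?_).add (DifferentiableAt.const_mul ?_ _)).const_mul _
    · exact differentiableAt_intervalIntegral_div_sub hab hbot (by fun_prop)
        fun t _ h => by simp [← h] at hz
    · exact differentiableAt_intervalIntegral_div_sub hab htop (by fun_prop)
        fun t _ h => by simp [← h] at hz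
    · exact differentiableAt_intervalIntegral_div_sub hcd hright (by fun_prop)
        fun t _ h => by simp [← h] at hz
  · rw [mem_reProdIm] at hz
    refine DifferentiableAt.differentiableWithinAt ?_
    refine ((DifferentiableAt.const_mul ?_ _).neg).const_mul _
    exact differentiableAt_intervalIntegral_div_sub hcd hleft (by fun_prop)
        fun t _ h => by simp [← h] at hz
  · rw [mem_reProdIm] at hz
    have := rectIntegral_div_sub hO hf hsub hz.1.1 hz.1.2 hz.2.1 hz.2.2
    rw [rectIntegral] at this
    have hpi : (2 * Real.pi * I : ℂ) ≠ 0 := by simp [Real.pi_ne_zero, I_ne_zero]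
    rw [← mul_add, eq_inv_mul_iff_mul_eq₀ hpi, ← this]
    ring

/-- On a convex set `g' / g` has a primitive `h`, and `g * exp (-h)` has derivative zero; its
constant value is absorbed into `h`. -/
theorem exists_exp_eq_of_convex {O : Set ℂ} (hO : IsOpen O) (hconv : Convex ℝ O) {g : ℂ → ℂ}
    (hg : DifferentiableOn ℂ g O) (hg0 : ∀ z ∈ O, g z ≠ 0) :
    ∃ h : ℂ → ℂ, DifferentiableOn ℂ h O ∧ ∀ z ∈ O, g z = exp (h z) := by
  rcases O.eq_empty_or_nonempty with rfl | ⟨z₀, hz₀⟩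
  · exact ⟨0, by simp, by simp⟩
  have hu : DifferentiableOn ℂ (fun z => deriv g z / g z) O := (hg.deriv hO).div hg hg0
  obtain ⟨h, hh⟩ := hconv.exists_forall_hasDerivWithinAt hu
  have hh' : ∀ z ∈ O, HasDerivAt h (deriv g z / g z) z := fun z hz =>
    (hh z hz).hasDerivAt (hO.mem_nhds hz)
  have hd : ∀ z ∈ O, HasDerivAt (fun z => g z * exp (-h z)) 0 z := fun z hz => by
    have h1 := (hg.differentiableAt (hO.mem_nhds hz)).hasDerivAt
    refine (h1.mul (hh' z hz).neg.cexp).congr_deriv ?_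
    have := hg0 z hz
    simp
    field_simp
    ring
  have hconst : ∀ z ∈ O, g z * exp (-h z) = g z₀ * exp (-h z₀) := fun z hz =>
    hO.is_const_of_deriv_eq_zero hconv.isPreconnected
      (fun w hw => (hd w hw).differentiableAt.differentiableWithinAt)
      (fun w hw => (hd w hw).deriv) hz hz₀
  refine ⟨fun z => h z + (log (g z₀) - h z₀), fun z hz =>
    ((hh' z hz).differentiableAt.add_const _).differentiableWithinAt, fun z hz => ?_⟩
  have h1 := hconst z hz
  rw [exp_add, exp_sub, exp_log (hg0 _ hz₀)]
  rw [exp_neg, exp_neg] at h1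
  have := exp_ne_zero (h z)
  have := exp_ne_zero (h z₀)
  field_simp at h1 ⊢
  linear_combination h1

theorem convex_reProdIm {s t : Set ℝ} (hs : Convex ℝ s) (ht : Convex ℝ t) :
    Convex ℝ (s ×ℂ t) :=
  (hs.linear_preimage reLm).inter (ht.linear_preimage imLm)

/-- A nowhere vanishing holomorphic function near a closed rectangle is the product of a function
that extends to the left and one that extends to the right, both nowhere vanishing. -/
theorem exists_mul_split_rect {g : ℂ → ℂ} {a b c d e : ℝ} (he : 0 < e)
    (hg : DifferentiableOn ℂ g (Ioo (a - e) (b + e) ×ℂ Ioo (c - e) (d + e)))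
    (hg0 : ∀ z ∈ Ioo (a - e) (b + e) ×ℂ Ioo (c - e) (d + e), g z ≠ 0) (hab : a ≤ b)
    (hcd : c ≤ d) :
    ∃ g₁ g₂ : ℂ → ℂ, DifferentiableOn ℂ g₁ (Iio b ×ℂ Ioo c d) ∧ (∀ z, g₁ z ≠ 0) ∧
      DifferentiableOn ℂ g₂ (Ioi a ×ℂ Ioo c d) ∧ (∀ z, g₂ z ≠ 0) ∧
      ∀ z ∈ Ioo a b ×ℂ Ioo c d, g z = g₁ z * g₂ z := by
  have hO : IsOpen (Ioo (a - e) (b + e) ×ℂ Ioo (c - e) (d + e)) := isOpen_Ioo.reProdIm isOpen_Ioo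
  have hsub : Icc a b ×ℂ Icc c d ⊆ Ioo (a - e) (b + e) ×ℂ Ioo (c - e) (d + e) :=
    reProdIm_subset_iff.2 (prod_mono (Icc_subset_Ioo (by linarith) (by linarith))
      (Icc_subset_Ioo (by linarith) (by linarith)))
  obtain ⟨h, hh, hgh⟩ := exists_exp_eq_of_convex hO
    (convex_reProdIm (convex_Ioo _ _) (convex_Ioo _ _)) hg hg0
  obtain ⟨f₁, f₂, h₁, h₂, hf⟩ := exists_add_split_rect hO hh hab hcd hsub
  refine ⟨fun z => exp (f₁ z), fun z => exp (f₂ z), h₁.cexp, fun z => exp_ne_zero _, h₂.cexp,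
    fun z => exp_ne_zero _, fun z hz => ?_⟩
  rw [← exp_add, ← hf z hz]
  refine hgh z (hsub ?_)
  rw [mem_reProdIm] at hz ⊢
  exact ⟨Ioo_subset_Icc_self hz.1, Ioo_subset_Icc_self hz.2⟩

end Splitting

/-! ### Global frames over rectangles -/

section Rectangles

open Complex Set

/-- The horizontal splitting transported along the rotation `w ↦ I * w`. -/
theorem exists_mul_split_rect_vertical {g : ℂ → ℂ} {a b c d e : ℝ} (he : 0 < e)
    (hg : DifferentiableOn ℂ g (Ioo (a - e) (b + e) ×ℂ Ioo (c - e) (d + e)))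
    (hg0 : ∀ z ∈ Ioo (a - e) (b + e) ×ℂ Ioo (c - e) (d + e), g z ≠ 0) (hab : a ≤ b)
    (hcd : c ≤ d) :
    ∃ g₁ g₂ : ℂ → ℂ, DifferentiableOn ℂ g₁ (Ioo a b ×ℂ Iio d) ∧ (∀ z, g₁ z ≠ 0) ∧
      DifferentiableOn ℂ g₂ (Ioo a b ×ℂ Ioi c) ∧ (∀ z, g₂ z ≠ 0) ∧
      ∀ z ∈ Ioo a b ×ℂ Ioo c d, g z = g₁ z * g₂ z := by
  have hm : MapsTo (fun w : ℂ => I * w) (Ioo (c - e) (d + e) ×ℂ Ioo (-b - e) (-a + e))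
      (Ioo (a - e) (b + e) ×ℂ Ioo (c - e) (d + e)) := by
    intro w hw
    simp only [mem_reProdIm, mem_Ioo, mul_re, I_re, I_im, mul_im] at hw ⊢
    refine ⟨⟨?_, ?_⟩, ⟨?_, ?_⟩⟩ <;> linarith [hw.1.1, hw.1.2, hw.2.1, hw.2.2]
  obtain ⟨g₁, g₂, h₁, h₁', h₂, h₂', h⟩ := exists_mul_split_rect (g := fun w => g (I * w)) he
    (hg.comp (by fun_prop) hm) (fun w hw => hg0 _ (hm hw)) hcd (neg_le_neg hab)
  refine ⟨fun z => g₁ (-I * z), fun z => g₂ (-I * z),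
    h₁.comp (by fun_prop) ?_, fun _ => h₁' _, h₂.comp (by fun_prop) ?_, fun _ => h₂' _, ?_⟩
  · intro z hz
    simpa [mem_reProdIm, and_comm] using hz
  · intro z hz
    simpa [mem_reProdIm, and_comm] using hz
  · intro z hz
    rw [← h (-I * z) (by simpa [mem_reProdIm, and_comm] using hz)]
    rw [← mul_assoc]
    simp

/-- Induction along an interval: the supremum of the endpoints reachable from `a` is reachable and
can be passed unless it equals `b`. It replaces a subdivision of the interval into small pieces. -/
theorem relation_of_local_of_glue {Q : ℝ → ℝ → Prop}
    (hglue : ∀ a b c, a ≤ b → b ≤ c → Q a b → Q b c → Q a c)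
    (hloc : ∀ t, ∃ e > 0, ∀ a b, t - e < a → a ≤ b → b < t + e → Q a b) {a b : ℝ}
    (hab : a ≤ b) : Q a b := by
  set S := {t | t ∈ Icc a b ∧ Q a t}
  have haS : a ∈ S := by
    obtain ⟨e, he, h⟩ := hloc a
    exact ⟨⟨le_rfl, hab⟩, h a a (by linarith) le_rfl (by linarith)⟩
  have hbdd : BddAbove S := ⟨b, fun t ht => ht.1.2⟩
  obtain ⟨e, he, h⟩ := hloc (sSup S)
  obtain ⟨t, ht, hlt⟩ := exists_lt_of_lt_csSup ⟨a, haS⟩ (show sSup S - e < sSup S by linarith)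
  have hts : t ≤ sSup S := le_csSup hbdd ht
  have htm : t ≤ min b (sSup S + e / 2) := le_min ht.1.2 (by linarith)
  have hQ : Q a (min b (sSup S + e / 2)) :=
    hglue _ _ _ ht.1.1 htm ht.2
      (h _ _ hlt htm ((min_le_right _ _).trans_lt (by linarith)))
  have hmem : min b (sSup S + e / 2) ∈ S := ⟨⟨ht.1.1.trans htm, min_le_left _ _⟩, hQ⟩
  have hle := le_csSup hbdd hmem
  rcases min_choice b (sSup S + e / 2) with h' | h'
  · rwa [h'] at hQ
  · rw [h'] at hle
    linarith

/-- A class of local functions on the plane, given by a condition on germs, that is a torsor under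
the multiplication by nowhere vanishing holomorphic functions: the local frames of a holomorphic
line bundle. -/
structure IsFrameClass (Q : ℂ → (ℂ → ℂ) → Prop) : Prop where
  exists_local : ∀ z, ∃ f, ∀ᶠ w in 𝓝 z, Q w f
  div : ∀ {w f₁ f₂}, Q w f₁ → Q w f₂ → AnalyticAt ℂ (fun z => f₁ z / f₂ z) w ∧ f₁ w / f₂ w ≠ 0
  mul : ∀ {w f g}, Q w f → AnalyticAt ℂ g w → g w ≠ 0 → Q w (fun z => g z * f z)
  congr : ∀ {w f₁ f₂}, Q w f₁ → f₁ =ᶠ[𝓝 w] f₂ → Q w f₂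

namespace IsFrameClass

variable {Q : ℂ → (ℂ → ℂ) → Prop}

/-- The factorization turns `f₁ = g₁ * g₂ * f₂` into `f₁ / g₁ = g₂ * f₂` on the overlap, so the two
corrected frames agree there. -/
theorem glue (hQ : IsFrameClass Q) {O₁ O₂ : Set ℂ} (h₁ : IsOpen O₁) (h₂ : IsOpen O₂)
    {f₁ f₂ g₁ g₂ : ℂ → ℂ} (hf₁ : ∀ z ∈ O₁, Q z f₁) (hf₂ : ∀ z ∈ O₂, Q z f₂)
    (hg₁ : DifferentiableOn ℂ g₁ O₁) (hg₁' : ∀ z, g₁ z ≠ 0)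
    (hg₂ : DifferentiableOn ℂ g₂ O₂) (hg₂' : ∀ z, g₂ z ≠ 0)
    (hg : ∀ z ∈ O₁ ∩ O₂, f₁ z / f₂ z = g₁ z * g₂ z) :
    ∃ f, ∀ z ∈ O₁ ∪ O₂, Q z f := by
  classical
  refine ⟨O₁.piecewise (fun z => (g₁ z)⁻¹ * f₁ z) (fun z => g₂ z * f₂ z), fun z hz => ?_⟩
  by_cases hz₁ : z ∈ O₁
  · refine hQ.congr (hQ.mul (hf₁ z hz₁) ((hg₁.analyticAt (h₁.mem_nhds hz₁)).fun_inv (hg₁' z))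
      (inv_ne_zero (hg₁' z))) ?_
    filter_upwards [h₁.mem_nhds hz₁] with w hw
    simp [hw]
  · have hz₂ : z ∈ O₂ := hz.resolve_left hz₁
    refine hQ.congr (hQ.mul (hf₂ z hz₂) (hg₂.analyticAt (h₂.mem_nhds hz₂)) (hg₂' z)) ?_
    filter_upwards [h₂.mem_nhds hz₂] with w hw
    by_cases hw₁ : w ∈ O₁
    · have hd := (hQ.div (hf₁ w hw₁) (hf₂ w hw)).2
      have h2 : f₂ w ≠ 0 := fun h => hd (by simp [h])
      have h3 := (div_eq_iff h2).1 (hg w ⟨hw₁, hw⟩)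
      simp only [piecewise_eq_of_mem _ _ _ hw₁]
      rw [h3, mul_assoc, inv_mul_cancel_left₀ (hg₁' w)]
    · simp [hw₁]

/-- There is a frame near the closed rectangle `[a, b] × [c, d]`. -/
def GoodRect (Q : ℂ → (ℂ → ℂ) → Prop) (a b c d : ℝ) : Prop :=
  ∃ f, ∃ e > 0, ∀ z ∈ Ioo (a - e) (b + e) ×ℂ Ioo (c - e) (d + e), Q z f

theorem GoodRect.mono {a b c d a' b' c' d' : ℝ} (h : GoodRect Q a b c d) (ha : a ≤ a')
    (hb : b' ≤ b) (hc : c ≤ c') (hd : d' ≤ d) : GoodRect Q a' b' c' d' := by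
  obtain ⟨f, e, he, h⟩ := h
  refine ⟨f, e, he, fun z hz => h z ?_⟩
  simp only [mem_reProdIm, mem_Ioo] at hz ⊢
  refine ⟨⟨?_, ?_⟩, ⟨?_, ?_⟩⟩ <;> linarith [hz.1.1, hz.1.2, hz.2.1, hz.2.2]

theorem glue_horizontal (hQ : IsFrameClass Q) {a b b' c d : ℝ} (hab : a ≤ b) (hbb' : b ≤ b')
    (hcd : c ≤ d) (h₁ : GoodRect Q a b c d) (h₂ : GoodRect Q b b' c d) :
    GoodRect Q a b' c d := by
  obtain ⟨f₁, e₁, he₁, h₁⟩ := h₁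
  obtain ⟨f₂, e₂, he₂, h₂⟩ := h₂
  -- Half of the smaller margin is kept for the glued frame; the other half is the margin that the
  -- splitting lemma needs around its closed rectangle.
  obtain ⟨e, he, hee₁, hee₂⟩ : ∃ e > 0, 2 * e ≤ e₁ ∧ 2 * e ≤ e₂ :=
    ⟨min e₁ e₂ / 2, by positivity, by linarith [min_le_left e₁ e₂], by linarith [min_le_right e₁ e₂]⟩
  have hdiv : ∀ z ∈ Ioo (b - e - e) (b + e + e) ×ℂ Ioo (c - e - e) (d + e + e),
      AnalyticAt ℂ (fun z => f₁ z / f₂ z) z ∧ f₁ z / f₂ z ≠ 0 := fun z hz => by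
    refine hQ.div (h₁ z ?_) (h₂ z ?_) <;>
    · simp only [mem_reProdIm, mem_Ioo] at hz ⊢
      refine ⟨⟨?_, ?_⟩, ⟨?_, ?_⟩⟩ <;> linarith [hz.1.1, hz.1.2, hz.2.1, hz.2.2]
  obtain ⟨g₁, g₂, hg₁, hg₁', hg₂, hg₂', hg⟩ := exists_mul_split_rect he
    (fun z hz => (hdiv z hz).1.differentiableAt.differentiableWithinAt) (fun z hz => (hdiv z hz).2)
    (by linarith) (by linarith)
  obtain ⟨f, hf⟩ := hQ.glue (O₁ := Ioo (a - e) (b + e) ×ℂ Ioo (c - e) (d + e))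
    (O₂ := Ioo (b - e) (b' + e) ×ℂ Ioo (c - e) (d + e)) (isOpen_Ioo.reProdIm isOpen_Ioo)
    (isOpen_Ioo.reProdIm isOpen_Ioo) (f₁ := f₁) (f₂ := f₂) (g₁ := g₁) (g₂ := g₂)
    (fun z hz => h₁ z (by
      simp only [mem_reProdIm, mem_Ioo] at hz ⊢
      refine ⟨⟨?_, ?_⟩, ⟨?_, ?_⟩⟩ <;> linarith [hz.1.1, hz.1.2, hz.2.1, hz.2.2]))
    (fun z hz => h₂ z (by
      simp only [mem_reProdIm, mem_Ioo] at hz ⊢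
      refine ⟨⟨?_, ?_⟩, ⟨?_, ?_⟩⟩ <;> linarith [hz.1.1, hz.1.2, hz.2.1, hz.2.2]))
    (hg₁.mono fun z hz => ⟨hz.1.2, hz.2⟩) hg₁' (hg₂.mono fun z hz => ⟨hz.1.1, hz.2⟩) hg₂'
    (fun z hz => hg z ⟨⟨hz.2.1.1, hz.1.1.2⟩, hz.1.2⟩)
  refine ⟨f, e, he, fun z hz => hf z ?_⟩
  rcases lt_or_ge z.re (b + e) with h | h
  · exact Or.inl ⟨⟨hz.1.1, h⟩, hz.2⟩
  · exact Or.inr ⟨⟨lt_of_lt_of_le (by linarith) h, hz.1.2⟩, hz.2⟩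

theorem glue_vertical (hQ : IsFrameClass Q) {a b c d d' : ℝ} (hab : a ≤ b) (hcd : c ≤ d)
    (hdd' : d ≤ d') (h₁ : GoodRect Q a b c d) (h₂ : GoodRect Q a b d d') :
    GoodRect Q a b c d' := by
  obtain ⟨f₁, e₁, he₁, h₁⟩ := h₁
  obtain ⟨f₂, e₂, he₂, h₂⟩ := h₂
  obtain ⟨e, he, hee₁, hee₂⟩ : ∃ e > 0, 2 * e ≤ e₁ ∧ 2 * e ≤ e₂ :=
    ⟨min e₁ e₂ / 2, by positivity, by linarith [min_le_left e₁ e₂], by linarith [min_le_right e₁ e₂]⟩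
  have hdiv : ∀ z ∈ Ioo (a - e - e) (b + e + e) ×ℂ Ioo (d - e - e) (d + e + e),
      AnalyticAt ℂ (fun z => f₁ z / f₂ z) z ∧ f₁ z / f₂ z ≠ 0 := fun z hz => by
    refine hQ.div (h₁ z ?_) (h₂ z ?_) <;>
    · simp only [mem_reProdIm, mem_Ioo] at hz ⊢
      refine ⟨⟨?_, ?_⟩, ⟨?_, ?_⟩⟩ <;> linarith [hz.1.1, hz.1.2, hz.2.1, hz.2.2]
  obtain ⟨g₁, g₂, hg₁, hg₁', hg₂, hg₂', hg⟩ := exists_mul_split_rect_vertical he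
    (fun z hz => (hdiv z hz).1.differentiableAt.differentiableWithinAt) (fun z hz => (hdiv z hz).2)
    (by linarith) (by linarith)
  obtain ⟨f, hf⟩ := hQ.glue (O₁ := Ioo (a - e) (b + e) ×ℂ Ioo (c - e) (d + e))
    (O₂ := Ioo (a - e) (b + e) ×ℂ Ioo (d - e) (d' + e)) (isOpen_Ioo.reProdIm isOpen_Ioo)
    (isOpen_Ioo.reProdIm isOpen_Ioo) (f₁ := f₁) (f₂ := f₂) (g₁ := g₁) (g₂ := g₂)
    (fun z hz => h₁ z (by
      simp only [mem_reProdIm, mem_Ioo] at hz ⊢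
      refine ⟨⟨?_, ?_⟩, ⟨?_, ?_⟩⟩ <;> linarith [hz.1.1, hz.1.2, hz.2.1, hz.2.2]))
    (fun z hz => h₂ z (by
      simp only [mem_reProdIm, mem_Ioo] at hz ⊢
      refine ⟨⟨?_, ?_⟩, ⟨?_, ?_⟩⟩ <;> linarith [hz.1.1, hz.1.2, hz.2.1, hz.2.2]))
    (hg₁.mono fun z hz => ⟨hz.1, hz.2.2⟩) hg₁' (hg₂.mono fun z hz => ⟨hz.1, hz.2.1⟩) hg₂'
    (fun z hz => hg z ⟨hz.1.1, ⟨hz.2.2.1, hz.1.2.2⟩⟩)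
  refine ⟨f, e, he, fun z hz => hf z ?_⟩
  rcases lt_or_ge z.im (d + e) with h | h
  · exact Or.inl ⟨hz.1, ⟨hz.2.1, h⟩⟩
  · exact Or.inr ⟨hz.1, ⟨lt_of_lt_of_le (by linarith) h, hz.2.2⟩⟩

theorem goodRect_local (hQ : IsFrameClass Q) (x y : ℝ) :
    ∃ e > 0, GoodRect Q (x - e) (x + e) (y - e) (y + e) := by
  obtain ⟨f, hf⟩ := hQ.exists_local (x + y * I)
  obtain ⟨e, he, h⟩ := Metric.eventually_nhds_iff.1 hf
  refine ⟨e / 4, by positivity, f, e / 4, by positivity, fun z hz => h ?_⟩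
  simp only [mem_reProdIm, mem_Ioo] at hz
  rw [dist_eq_norm]
  refine (norm_le_abs_re_add_abs_im _).trans_lt ?_
  have h1 : |(z - (x + y * I)).re| < e / 2 := by
    simp only [sub_re, add_re, ofReal_re, mul_re, I_re, I_im, ofReal_im]
    rw [abs_lt]; constructor <;> linarith [hz.1.1, hz.1.2]
  have h2 : |(z - (x + y * I)).im| < e / 2 := by
    simp only [sub_im, add_im, ofReal_re, mul_im, I_re, I_im, ofReal_im]
    rw [abs_lt]; constructor <;> linarith [hz.2.1, hz.2.2]
  linarith

theorem goodRect_of_le (hQ : IsFrameClass Q) {a b c d : ℝ} (hab : a ≤ b) (hcd : c ≤ d) :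
    GoodRect Q a b c d := by
  -- The interval induction is run twice: vertically it yields a thin full-height rectangle around
  -- each abscissa, and then these are joined horizontally.
  have key : ∀ x : ℝ, ∃ e > 0, GoodRect Q (x - e) (x + e) c d := fun x => by
    refine relation_of_local_of_glue (Q := fun c d => ∃ e > 0, GoodRect Q (x - e) (x + e) c d)
      ?_ ?_ hcd
    · rintro c d d' hcd hdd' ⟨e₁, he₁, h₁⟩ ⟨e₂, he₂, h₂⟩
      have hl := min_le_left e₁ e₂
      have hr := min_le_right e₁ e₂
      have hm : 0 < min e₁ e₂ := by positivity
      exact ⟨min e₁ e₂, hm, hQ.glue_vertical (by linarith) hcd hdd'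
        (h₁.mono (by linarith) (by linarith) le_rfl le_rfl)
        (h₂.mono (by linarith) (by linarith) le_rfl le_rfl)⟩
    · intro y
      obtain ⟨e, he, h⟩ := hQ.goodRect_local x y
      exact ⟨e, he, fun a b ha _ hb => ⟨e, he, h.mono le_rfl le_rfl ha.le hb.le⟩⟩
  refine relation_of_local_of_glue (Q := fun a b => GoodRect Q a b c d) ?_ ?_ hab
  · exact fun a b b' hab hbb' => hQ.glue_horizontal hab hbb' hcd
  · intro x
    obtain ⟨e, he, h⟩ := key x
    exact ⟨e, he, fun a b ha _ hb => h.mono ha.le hb.le le_rfl le_rfl⟩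

theorem exists_on_ball (hQ : IsFrameClass Q) {r : ℝ} (hr : 0 ≤ r) :
    ∃ f, ∀ z ∈ Metric.ball (0 : ℂ) r, Q z f := by
  obtain ⟨f, e, he, h⟩ := hQ.goodRect_of_le (a := -r) (b := r) (c := -r) (d := r) (by linarith)
    (by linarith)
  refine ⟨f, fun z hz => h z ?_⟩
  rw [mem_ball_zero_iff] at hz
  have h1 := abs_le.1 (abs_re_le_norm z)
  have h2 := abs_le.1 (abs_im_le_norm z)
  simp only [mem_reProdIm, mem_Ioo]
  refine ⟨⟨?_, ?_⟩, ⟨?_, ?_⟩⟩ <;> linarith [h1.1, h1.2, h2.1, h2.2]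

end IsFrameClass

end Rectangles

/-! ### Holomorphic and meromorphic functions on the Riemann sphere -/

namespace RiemannSphere

theorem chartAt_coe (z : ℂ) : chartAt ℂ (z : OnePoint ℂ) = affineChart := rfl

theorem chartAt_infty : chartAt ℂ (∞ : OnePoint ℂ) = inftyChart := rfl

theorem inftyChart_symm_apply (z : ℂ) : inftyChart.symm z = inv (z : OnePoint ℂ) := by
  simp [inftyChart, affineChart_symm_apply, invHomeo]

theorem inftyChart_infty : inftyChart ∞ = 0 := by
  simp [inftyChart, invHomeo, affineChart_coe]

theorem inftyChart_coe {z : ℂ} (hz : z ≠ 0) : inftyChart (z : OnePoint ℂ) = z⁻¹ := by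
  simp [inftyChart, invHomeo, inv_coe hz, affineChart_coe]

theorem affineChart_target : affineChart.target = Set.univ := by
  simp [affineChart]

theorem chartAt_target (a : OnePoint ℂ) : (chartAt ℂ a).target = Set.univ := by
  induction a using OnePoint.rec with
  | infty => simp [chartAt_infty, inftyChart, affineChart_target]
  | coe z => exact affineChart_target

theorem chart_symm_mem_source (a : OnePoint ℂ) (w : ℂ) :
    (chartAt ℂ a).symm w ∈ (chartAt ℂ a).source :=
  (chartAt ℂ a).map_target (by simp [chartAt_target])

theorem chart_apply_symm (a : OnePoint ℂ) (w : ℂ) :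
    chartAt ℂ a ((chartAt ℂ a).symm w) = w :=
  (chartAt ℂ a).right_inv (by simp [chartAt_target])

theorem chart_symm_self (a : OnePoint ℂ) : (chartAt ℂ a).symm (chartAt ℂ a a) = a :=
  (chartAt ℂ a).left_inv (mem_chart_source ℂ a)

theorem chart_symm_injective (a : OnePoint ℂ) : Function.Injective (chartAt ℂ a).symm :=
  Function.LeftInverse.injective (chart_apply_symm a)

theorem map_chart_symm_nhds (a : OnePoint ℂ) (w : ℂ) :
    map (chartAt ℂ a).symm (𝓝 w) = 𝓝 ((chartAt ℂ a).symm w) :=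
  (chartAt ℂ a).symm.map_nhds_eq (by simp [chartAt_target])

theorem map_chart_symm_nhdsNE (a : OnePoint ℂ) (w : ℂ) :
    map (chartAt ℂ a).symm (𝓝[≠] w) = 𝓝[≠] ((chartAt ℂ a).symm w) := by
  ext s
  rw [mem_map, mem_nhdsWithin_iff_eventually, mem_nhdsWithin_iff_eventually,
    ← map_chart_symm_nhds, eventually_map]
  simp [(chart_symm_injective a).eq_iff]

theorem eventually_chart_symm_nhdsNE {a : OnePoint ℂ} {P : OnePoint ℂ → Prop} :
    (∀ᶠ w in 𝓝[≠] (chartAt ℂ a a), P ((chartAt ℂ a).symm w)) ↔ ∀ᶠ y in 𝓝[≠] a, P y := by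
  rw [← eventually_map (P := P), map_chart_symm_nhdsNE, chart_symm_self]

end RiemannSphere

open RiemannSphere

/-- The function `f` is holomorphic near `a`. -/
def Hol {F : Type*} [NormedAddCommGroup F] [NormedSpace ℂ F] (f : OnePoint ℂ → F)
    (a : OnePoint ℂ) : Prop :=
  ContMDiffAt 𝓘(ℂ) 𝓘(ℂ, F) ω f a

section Hol

variable {F : Type*} [NormedAddCommGroup F] [NormedSpace ℂ F] {a : OnePoint ℂ}

theorem hol_chart_symm_iff [CompleteSpace F] {f : OnePoint ℂ → F} (a : OnePoint ℂ) (w : ℂ) :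
    Hol f ((chartAt ℂ a).symm w) ↔ AnalyticAt ℂ (fun z => f ((chartAt ℂ a).symm z)) w := by
  rw [Hol, contMDiffAt_iff_source_of_mem_source (x := a) (chart_symm_mem_source a w)]
  simp only [extChartAt, modelWithCornersSelf_partialEquiv, PartialEquiv.trans_refl,
    OpenPartialHomeomorph.toFun_eq_coe, OpenPartialHomeomorph.coe_toPartialEquiv_symm,
    modelWithCornersSelf_coe, Set.range_id, contMDiffWithinAt_univ, contMDiffAt_iff_contDiffAt,
    OpenPartialHomeomorph.extend, chart_apply_symm, Function.comp_def]
  exact ⟨fun h => h.analyticAt, fun h => h.contDiffAt⟩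

theorem hol_iff [CompleteSpace F] {f : OnePoint ℂ → F} :
    Hol f a ↔ AnalyticAt ℂ (fun z => f ((chartAt ℂ a).symm z)) (chartAt ℂ a a) := by
  rw [← hol_chart_symm_iff, chart_symm_self]

theorem hol_coe_iff [CompleteSpace F] {f : OnePoint ℂ → F} {z : ℂ} :
    Hol f (z : OnePoint ℂ) ↔ AnalyticAt ℂ (fun w : ℂ => f (w : OnePoint ℂ)) z :=
  hol_chart_symm_iff ((0 : ℂ) : OnePoint ℂ) z

theorem hol_inv_coe_iff [CompleteSpace F] {f : OnePoint ℂ → F} {z : ℂ} :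
    Hol f (inv (z : OnePoint ℂ)) ↔ AnalyticAt ℂ (fun w : ℂ => f (inv (w : OnePoint ℂ))) z := by
  have := hol_chart_symm_iff (f := f) ∞ z
  simpa only [chartAt_infty, inftyChart_symm_apply] using this

theorem Hol.eventually [CompleteSpace F] {f : OnePoint ℂ → F} (h : Hol f a) :
    ∀ᶠ b in 𝓝 a, Hol f b :=
  (contMDiffAt_iff_contMDiffAt_nhds (by simp)).1 h

theorem Hol.continuousAt {f : OnePoint ℂ → F} (h : Hol f a) : ContinuousAt f a :=
  ContMDiffAt.continuousAt h

theorem Hol.congr {f g : OnePoint ℂ → F} (h : Hol f a) (hfg : f =ᶠ[𝓝 a] g) : Hol g a :=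
  ContMDiffAt.congr_of_eventuallyEq h hfg.symm

theorem Hol.eventually_ne {f : OnePoint ℂ → ℂ} (h : Hol f a) (h0 : f a ≠ 0) :
    ∀ᶠ b in 𝓝 a, f b ≠ 0 :=
  h.continuousAt.eventually_ne h0

theorem hol_const (c : F) : Hol (fun _ => c) a := contMDiffAt_const

theorem Hol.mul {f g : OnePoint ℂ → ℂ} (hf : Hol f a) (hg : Hol g a) :
    Hol (fun y => f y * g y) a := by
  rw [hol_iff] at *
  exact hf.fun_mul hg

theorem Hol.inv {f : OnePoint ℂ → ℂ} (hf : Hol f a) (h0 : f a ≠ 0) :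
    Hol (fun y => (f y)⁻¹) a := by
  rw [hol_iff] at *
  exact hf.fun_inv (by rwa [chart_symm_self])

theorem Hol.div {f g : OnePoint ℂ → ℂ} (hf : Hol f a) (hg : Hol g a) (h0 : g a ≠ 0) :
    Hol (fun y => f y / g y) a := by
  simp only [div_eq_mul_inv]
  exact hf.mul (hg.inv h0)

theorem Hol.sum {ι : Type*} {s : Finset ι} {f : ι → OnePoint ℂ → F} [CompleteSpace F]
    (h : ∀ i ∈ s, Hol (f i) a) : Hol (fun y => ∑ i ∈ s, f i y) a := by
  simp only [hol_iff] at *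
  exact Finset.analyticAt_fun_sum s h

theorem Hol.prod {ι : Type*} {s : Finset ι} {f : ι → OnePoint ℂ → ℂ}
    (h : ∀ i ∈ s, Hol (f i) a) : Hol (fun y => ∏ i ∈ s, f i y) a := by
  simp only [hol_iff] at *
  exact Finset.analyticAt_fun_prod s h

theorem hol_pi_iff {ι : Type*} [Fintype ι] {f : OnePoint ℂ → ι → ℂ} :
    Hol f a ↔ ∀ i, Hol (fun y => f y i) a := by
  simp only [hol_iff]
  exact analyticAt_pi_iff

theorem Hol.det {ι : Type*} [Fintype ι] [DecidableEq ι] {A : OnePoint ℂ → Matrix ι ι ℂ}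
    (h : ∀ i j, Hol (fun y => A y i j) a) : Hol (fun y => (A y).det) a := by
  simp only [Matrix.det_apply']
  exact Hol.sum fun σ _ => (hol_const _).mul (Hol.prod fun i _ => h _ _)

end Hol

/-! ### Calculus of orders of meromorphic functions. -/

namespace HasOrderAt

variable {f g : OnePoint ℂ → ℂ} {a : OnePoint ℂ} {m n : ℤ}

theorem congr (h : HasOrderAt f a m) (hfg : f =ᶠ[𝓝[≠] a] g) : HasOrderAt g a m := by
  have h' : f ∘ (chartAt ℂ a).symm =ᶠ[𝓝[≠] (chartAt ℂ a a)] g ∘ (chartAt ℂ a).symm :=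
    eventually_chart_symm_nhdsNE.2 hfg
  exact ⟨h.1.congr h', by rw [← meromorphicOrderAt_congr h', h.2]⟩

theorem mul (hf : HasOrderAt f a m) (hg : HasOrderAt g a n) :
    HasOrderAt (fun y => f y * g y) a (m + n) :=
  ⟨hf.1.mul hg.1, by
    rw [show (fun y => f y * g y) ∘ (chartAt ℂ a).symm =
      (f ∘ (chartAt ℂ a).symm) * (g ∘ (chartAt ℂ a).symm) from rfl,
      meromorphicOrderAt_mul hf.1 hg.1, hf.2, hg.2]; rfl⟩

theorem inv (hf : HasOrderAt f a m) : HasOrderAt (fun y => (f y)⁻¹) a (-m) :=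
  ⟨hf.1.inv, by
    rw [show (fun y => (f y)⁻¹) ∘ (chartAt ℂ a).symm = (f ∘ (chartAt ℂ a).symm)⁻¹ from rfl,
      meromorphicOrderAt_inv, hf.2]; rfl⟩

theorem div (hf : HasOrderAt f a m) (hg : HasOrderAt g a n) :
    HasOrderAt (fun y => f y / g y) a (m - n) := by
  simp only [div_eq_mul_inv, sub_eq_add_neg]
  exact hf.mul hg.inv

theorem of_hol (hf : Hol f a) (h0 : f a ≠ 0) : HasOrderAt f a 0 := by
  rw [hol_iff] at hf
  refine ⟨hf.meromorphicAt, ?_⟩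
  have := hf.meromorphicNFAt.meromorphicOrderAt_eq_zero_iff.2
    (by rwa [chart_symm_self])
  exact this

theorem pow (hf : HasOrderAt f a m) (k : ℕ) : HasOrderAt (fun y => f y ^ k) a (k * m) := by
  induction k with
  | zero => simpa using of_hol (hol_const (1 : ℂ) (a := a)) one_ne_zero
  | succ k ih =>
    have := ih.mul hf
    simp only [pow_succ]
    convert this using 1
    push_cast
    ring

theorem zpow (hf : HasOrderAt f a m) (k : ℤ) : HasOrderAt (fun y => f y ^ k) a (k * m) := by
  refine ⟨hf.1.zpow k, ?_⟩
  rw [show (fun y => f y ^ k) ∘ (chartAt ℂ a).symm = (f ∘ (chartAt ℂ a).symm) ^ k from rfl,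
    meromorphicOrderAt_zpow hf.1, hf.2]
  rfl

theorem prod {ι : Type*} {s : Finset ι} {F : ι → OnePoint ℂ → ℂ} {k : ι → ℤ}
    (h : ∀ i ∈ s, HasOrderAt (F i) a (k i)) :
    HasOrderAt (fun y => ∏ i ∈ s, F i y) a (∑ i ∈ s, k i) := by
  classical
  induction s using Finset.induction_on with
  | empty => simpa using of_hol (hol_const (1 : ℂ) (a := a)) one_ne_zero
  | insert i s hi ih =>
    simp only [Finset.prod_insert hi, Finset.sum_insert hi]
    exact (h i (by simp)).mul (ih fun j hj => h j (by simp [hj]))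

theorem unique (hf : HasOrderAt f a m) (hf' : HasOrderAt f a n) : m = n := by
  have := hf.2.symm.trans hf'.2
  exact_mod_cast this

theorem eventually_ne (hf : HasOrderAt f a m) : ∀ᶠ y in 𝓝[≠] a, f y ≠ 0 := by
  rw [← eventually_chart_symm_nhdsNE]
  exact (meromorphicOrderAt_ne_top_iff_eventually_ne_zero hf.1).1 (by rw [hf.2]; simp)

theorem coe_iff {z : ℂ} : HasOrderAt f (z : OnePoint ℂ) m ↔
    MeromorphicAt (fun w : ℂ => f (w : OnePoint ℂ)) z ∧
      meromorphicOrderAt (fun w : ℂ => f (w : OnePoint ℂ)) z = m := by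
  rw [HasOrderAt, chartAt_coe, affineChart_coe]
  rfl

theorem infty_iff : HasOrderAt f ∞ m ↔
    MeromorphicAt (fun w : ℂ => f (RiemannSphere.inv (w : OnePoint ℂ))) 0 ∧
      meromorphicOrderAt (fun w : ℂ => f (RiemannSphere.inv (w : OnePoint ℂ))) 0 = m := by
  rw [HasOrderAt, chartAt_infty, inftyChart_infty]
  have : f ∘ inftyChart.symm = fun w : ℂ => f (RiemannSphere.inv (w : OnePoint ℂ)) := by
    ext w
    simp [inftyChart_symm_apply]
  rw [this]

/-- The germ of a holomorphic function that does not vanish on a punctured neighbourhood has a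
nonnegative order. -/
theorem exists_of_hol (hf : Hol f a) (h0 : ∀ᶠ y in 𝓝[≠] a, f y ≠ 0) :
    ∃ k : ℤ, 0 ≤ k ∧ HasOrderAt f a k := by
  rw [hol_iff] at hf
  have h1 := hf.meromorphicAt
  have h2 : meromorphicOrderAt (fun z => f ((chartAt ℂ a).symm z)) (chartAt ℂ a a) ≠ ⊤ :=
    (meromorphicOrderAt_ne_top_iff_eventually_ne_zero h1).2 (eventually_chart_symm_nhdsNE.2 h0)
  obtain ⟨k, hk⟩ := WithTop.ne_top_iff_exists.1 h2
  refine ⟨k, ?_, h1, hk.symm⟩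
  have := hf.meromorphicOrderAt_nonneg
  rw [← hk] at this
  exact_mod_cast this

end HasOrderAt

/-- An entire function without zeros whose order at infinity is nonnegative is constant, so that
its order at infinity vanishes. -/
theorem order_eq_zero_of_entire {Φ : ℂ → ℂ} (hΦ : Differentiable ℂ Φ) (h0 : ∀ z, Φ z ≠ 0) {N : ℤ}
    (hN : 0 ≤ N) (hm : MeromorphicAt (fun t => Φ t⁻¹) 0)
    (ho : meromorphicOrderAt (fun t => Φ t⁻¹) 0 = N) : N = 0 := by
  obtain ⟨c, hc⟩ := tendsto_nhds_of_meromorphicOrderAt_nonneg hm (by rw [ho]; exact_mod_cast hN)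
  have hc' : Tendsto Φ (cocompact ℂ) (𝓝 c) := by
    have := hc.comp (tendsto_inv₀_cobounded' (α := ℂ))
    rw [Metric.cobounded_eq_cocompact] at this
    refine this.congr fun z => ?_
    simp
  have hconst := fun z => hΦ.apply_eq_of_tendsto_cocompact z hc'
  have hc0 : c ≠ 0 := by rw [← hconst 0]; exact h0 0
  have := (tendsto_ne_zero_iff_meromorphicOrderAt_eq_zero hm).1 ⟨c, hc0, hc⟩
  rw [ho] at this
  exact_mod_cast this

/-- The coordinate `z - w` as a meromorphic function on the Riemann sphere. -/
noncomputable def linearCoord (w : ℂ) (y : OnePoint ℂ) : ℂ := y.elim 0 fun z => z - w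

theorem hasOrderAt_linearCoord_coe (w z : ℂ) :
    HasOrderAt (linearCoord w) (z : OnePoint ℂ) (if z = w then 1 else 0) := by
  split_ifs with h
  · subst h
    refine HasOrderAt.coe_iff.2 ⟨?_, ?_⟩
    · exact (by fun_prop : AnalyticAt ℂ (fun x : ℂ => x - z) z).meromorphicAt
    · exact meromorphicOrderAt_id_sub_const
  · refine HasOrderAt.of_hol (hol_coe_iff.2 ?_) (sub_ne_zero.2 h)
    exact (by fun_prop : AnalyticAt ℂ (fun x : ℂ => x - w) z)

theorem hasOrderAt_inv_coord_infty :
    HasOrderAt (fun y => (linearCoord 0 y)⁻¹) ∞ 1 := by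
  have : (fun t : ℂ => (linearCoord 0 (RiemannSphere.inv (t : OnePoint ℂ)))⁻¹) =
      fun t => t - 0 := by
    ext t
    by_cases ht : t = 0
    · subst ht; simp [linearCoord]
    · simp [inv_coe ht, linearCoord]
  rw [HasOrderAt.infty_iff, this]
  exact ⟨(by fun_prop : AnalyticAt ℂ (fun x : ℂ => x - 0) 0).meromorphicAt,
    meromorphicOrderAt_id_sub_const⟩

theorem hasOrderAt_linearCoord_infty (w : ℂ) : HasOrderAt (linearCoord w) ∞ (-1) := by
  have h1 : HasOrderAt (fun y => 1 - w * (linearCoord 0 y)⁻¹) ∞ 0 := by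
    refine HasOrderAt.of_hol ?_ (by simp [linearCoord])
    rw [show (∞ : OnePoint ℂ) = RiemannSphere.inv ((0 : ℂ) : OnePoint ℂ) by simp,
      hol_inv_coe_iff]
    have : (fun t : ℂ => 1 - w * (linearCoord 0 (RiemannSphere.inv (t : OnePoint ℂ)))⁻¹) =
        fun t => 1 - w * t := by
      ext t
      by_cases ht : t = 0
      · subst ht; simp [linearCoord]
      · simp [inv_coe ht, linearCoord]
    rw [this]
    fun_prop
  have h2 := hasOrderAt_inv_coord_infty.inv.mul h1
  refine (by simpa using h2 : HasOrderAt _ ∞ (-1)).congr ?_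
  have h3 : ∀ᶠ y in 𝓝[≠] (∞ : OnePoint ℂ), y ≠ ((0 : ℂ) : OnePoint ℂ) ∧ y ≠ (∞ : OnePoint ℂ) :=
    (eventually_nhdsWithin_of_eventually_nhds (isOpen_ne.mem_nhds (by simp))).and
      eventually_mem_nhdsWithin
  filter_upwards [h3] with y hy
  induction y using OnePoint.rec with
  | infty => simp at hy
  | coe z =>
    have hz : z ≠ 0 := by simpa using hy.1
    simp [linearCoord]
    field_simp

theorem sum_order_of_finite_part_eq_zero {f : OnePoint ℂ → ℂ} {N : ℤ} (hN : 0 ≤ N)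
    (h : ∀ z : ℂ, HasOrderAt f (z : OnePoint ℂ) 0) (hinf : HasOrderAt f ∞ N) : N = 0 := by
  set F : ℂ → ℂ := fun z => f (z : OnePoint ℂ)
  have hm : ∀ z, MeromorphicAt F z := fun z => (HasOrderAt.coe_iff.1 (h z)).1
  have ho : ∀ z, meromorphicOrderAt F z = 0 := fun z => by
    exact_mod_cast (HasOrderAt.coe_iff.1 (h z)).2
  -- An order only sees punctured neighbourhoods, so the values of `F` may be wrong at some points.
  -- `Φ` replaces every value by that of the normal form at the point; order zero everywhere then
  -- makes it entire and without zeros.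
  set Φ : ℂ → ℂ := fun z => toMeromorphicNFAt F z z
  have hΦan : ∀ z, AnalyticAt ℂ F z → Φ z = F z := fun z hz => by
    simp only [Φ]
    rw [toMeromorphicNFAt_eq_self.2 hz.meromorphicNFAt]
  have hΦeq : ∀ z, Φ =ᶠ[𝓝 z] toMeromorphicNFAt F z := fun z => by
    have h1 := (hm z).eventually_analyticAt
    have h2 := (hm z).eq_nhdsNE_toMeromorphicNFAt
    have h3 : ∀ᶠ w in 𝓝[≠] z, Φ w = toMeromorphicNFAt F z w := by
      filter_upwards [h1, h2] with w hw1 hw2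
      rw [hΦan w hw1, hw2]
    rw [eventually_nhdsWithin_iff] at h3
    filter_upwards [h3] with w hw
    by_cases hwz : w = z
    · subst hwz; rfl
    · exact hw hwz
  have hΦ : Differentiable ℂ Φ := fun z => by
    have := (hm z).meromorphicOrderAt_nonneg_iff_analyticAt_toMeromorphicNFAt.1 (ho z).ge
    exact (this.congr (hΦeq z).symm).differentiableAt
  have hΦ0 : ∀ z, Φ z ≠ 0 := fun z =>
    (hm z).meromorphicOrderAt_eq_zero_iff_toMeromorphicNFAt_ne_zero.1 (ho z)
  obtain ⟨hi1, hi2⟩ := HasOrderAt.infty_iff.1 hinf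
  have hcongr : (fun w : ℂ => f (RiemannSphere.inv (w : OnePoint ℂ))) =ᶠ[𝓝[≠] 0]
      fun t => Φ t⁻¹ := by
    filter_upwards [hi1.eventually_analyticAt, self_mem_nhdsWithin] with t ht ht0
    have ht0' : t ≠ 0 := ht0
    have hF : AnalyticAt ℂ F t⁻¹ := by
      have hg : Hol f (RiemannSphere.inv (t : OnePoint ℂ)) := hol_inv_coe_iff.2 ht
      rw [inv_coe ht0'] at hg
      exact hol_coe_iff.1 hg
    rw [hΦan _ hF, inv_coe ht0']
  refine order_eq_zero_of_entire hΦ hΦ0 hN (hi1.congr hcongr) ?_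
  rw [← meromorphicOrderAt_congr hcongr, hi2]

/-- The divisor of a meromorphic function on the Riemann sphere has degree zero. -/
theorem sum_order_eq_zero {f : OnePoint ℂ → ℂ} {m : OnePoint ℂ →₀ ℤ}
    (h : ∀ a, HasOrderAt f a (m a)) : (m.sum fun _ k => k) = 0 := by
  classical
  set T : Finset ℂ := m.support.preimage (↑) OnePoint.coe_injective.injOn
  have hsum : (m.sum fun _ k => k) = m ∞ + ∑ w ∈ T, m (w : OnePoint ℂ) := by
    have hsub : m.support ⊆ insert (∞ : OnePoint ℂ) (T.map ⟨((↑) : ℂ → OnePoint ℂ), OnePoint.coe_injective⟩) := by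
      intro y hy
      induction y using OnePoint.rec with
      | infty => simp
      | coe z => simpa [T] using hy
    rw [Finsupp.sum_of_support_subset m hsub _ (by simp), Finset.sum_insert (by simp),
      Finset.sum_map]
    rfl
  -- Multiplication by `R` moves all finite zeros and poles to `∞`, where the order becomes the
  -- degree of the whole divisor.
  set R : OnePoint ℂ → ℂ := fun y => ∏ w ∈ T, linearCoord w y ^ (-m (w : OnePoint ℂ))
  have hcoe : ∀ z : ℂ, HasOrderAt (fun y => f y * R y) (z : OnePoint ℂ) 0 := fun z => by
    have := (h z).mul (HasOrderAt.prod (s := T) fun w _ =>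
      (hasOrderAt_linearCoord_coe w z).zpow (-m (w : OnePoint ℂ)))
    convert this using 1
    simp only [mul_ite, mul_one, mul_zero, Finset.sum_ite_eq]
    split_ifs with hz
    · ring
    · have : m (z : OnePoint ℂ) = 0 := by simpa [T] using hz
      simp [this]
  have hinf : HasOrderAt (fun y => f y * R y) ∞ (m.sum fun _ k => k) := by
    have := (h ∞).mul (HasOrderAt.prod (s := T) fun w _ =>
      (hasOrderAt_linearCoord_infty w).zpow (-m (w : OnePoint ℂ)))
    convert this using 1
    rw [hsum]
    simp
  -- The case of a pole at `∞` reduces to that of a zero by passing to the inverse function.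
  rcases le_total 0 (m.sum fun _ k => k) with hN | hN
  · exact sum_order_of_finite_part_eq_zero hN hcoe hinf
  · have := sum_order_of_finite_part_eq_zero (neg_nonneg.2 hN)
      (fun z => by simpa using (hcoe z).inv) hinf.inv
    simpa using this

/-! ### Meromorphic sections of line bundles on the Riemann sphere -/

section Annulus

open Complex Set

theorem norm_inv_mem_annulus {z : ℂ} (h1 : 1 / 2 < ‖z‖) : ‖z⁻¹‖ < 2 := by
  rw [norm_inv, inv_lt_comm₀ (by linarith) (by norm_num)]
  linarith

/-- The Laurent decomposition of a holomorphic function on an annulus. -/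
theorem laurent_decomposition {u : ℂ → ℂ}
    (hu : ∀ z : ℂ, 1 / 3 < ‖z‖ → ‖z‖ < 3 → DifferentiableAt ℂ u z) :
    ∃ u₁ κ : ℂ → ℂ, DifferentiableOn ℂ u₁ (Metric.ball 0 2) ∧
      DifferentiableOn ℂ κ (Metric.ball 0 2) ∧
      ∀ z : ℂ, 1 / 2 < ‖z‖ → ‖z‖ < 2 → u z = u₁ z + z⁻¹ * κ z⁻¹ := by
  have hpi : (2 * Real.pi * I : ℂ) ≠ 0 := by simp [Real.pi_ne_zero, I_ne_zero]
  have hcont : ∀ R : ℝ, 1 / 3 < R → R < 3 → ContinuousOn u (Metric.sphere 0 R) :=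
    fun R h1 h2 z hz => by
      rw [mem_sphere_zero_iff_norm] at hz
      exact (hu z (by rwa [hz]) (by rwa [hz])).continuousAt.continuousWithinAt
  have hO : IsOpen {z : ℂ | 1 / 3 < ‖z‖ ∧ ‖z‖ < 3} :=
    (isOpen_lt continuous_const continuous_norm).inter (isOpen_lt continuous_norm continuous_const)
  have hcm : Continuous fun θ => circleMap 0 (1 / 2) θ := continuous_circleMap 0 (1 / 2)
  have hne : ∀ θ, circleMap 0 (1 / 2) θ ≠ 0 := fun θ => circleMap_ne_center (by norm_num)
  -- The Cauchy integrals over the circles of radius 2 and 1/2. The inner one is rewritten in the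
  -- coordinate `t = z⁻¹` by means of `ζ / (ζ - z) = -z⁻¹ / (ζ⁻¹ - z⁻¹)`, which produces the factor
  -- `z⁻¹` in front of `κ`.
  refine ⟨fun w => (2 * Real.pi * I : ℂ)⁻¹ • ∮ z in C(0, 2), (z - w)⁻¹ • u z,
    fun t => (2 * Real.pi * I : ℂ)⁻¹ * ∫ θ in (0 : ℝ)..2 * Real.pi,
      (I * u (circleMap 0 (1 / 2) θ)) / ((circleMap 0 (1 / 2) θ)⁻¹ - t), ?_, ?_, ?_⟩
  · have := hasFPowerSeriesOn_cauchy_integral (f := u) (c := 0) (R := 2)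
      ((hcont 2 (by norm_num) (by norm_num)).circleIntegrable (by norm_num)) (by norm_num)
    have h2 := this.differentiableOn
    have hball : Metric.eball (0 : ℂ) ((2 : NNReal) : ENNReal) = Metric.ball 0 2 := by
      rw [Metric.eball_coe]; rfl
    rwa [hball] at h2
  · intro t ht
    rw [mem_ball_zero_iff] at ht
    refine (DifferentiableAt.const_mul ?_ _).differentiableWithinAt
    refine differentiableAt_intervalIntegral_div_sub (by positivity) ?_ ?_ ?_
    · refine (continuousOn_const.mul ((hcont (1 / 2) (by norm_num) (by norm_num)).comp
        hcm.continuousOn fun θ _ => circleMap_mem_sphere _ (by norm_num) _))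
    · exact (hcm.inv₀ hne).continuousOn
    · intro θ _ h
      rw [← h, norm_inv, norm_circleMap_zero] at ht
      norm_num at ht
  · intro z hz1 hz2
    have hz0 : z ≠ 0 := fun h => by norm_num [h] at hz1
    have hzO : z ∈ {z : ℂ | 1 / 3 < ‖z‖ ∧ ‖z‖ < 3} := ⟨by linarith, by linarith⟩
    have hds : DifferentiableOn ℂ (dslope u z) {z : ℂ | 1 / 3 < ‖z‖ ∧ ‖z‖ < 3} :=
      (differentiableOn_dslope (hO.mem_nhds hzO)).2
        fun w hw => (hu w hw.1 hw.2).differentiableWithinAt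
    have hsubO : Metric.closedBall (0 : ℂ) 2 \ Metric.ball 0 (1 / 2) ⊆
        {z : ℂ | 1 / 3 < ‖z‖ ∧ ‖z‖ < 3} := fun w hw => by
      rw [Set.mem_sdiff, mem_closedBall_zero_iff, mem_ball_zero_iff, not_lt] at hw
      exact ⟨by linarith [hw.2], by linarith [hw.1]⟩
    have hcauchy := circleIntegral_eq_of_differentiable_on_annulus_off_countable (c := 0)
      (r := 1 / 2) (R := 2) (f := dslope u z) (by norm_num) (by norm_num) countable_empty
      (hds.continuousOn.mono hsubO) (fun w hw => by
        have hw' := hw.1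
        rw [Set.mem_sdiff, mem_ball_zero_iff, mem_closedBall_zero_iff, not_le] at hw'
        exact hds.differentiableAt (hO.mem_nhds ⟨by linarith [hw'.2], by linarith [hw'.1]⟩))
    have hsplit : ∀ R : ℝ, 1 / 3 < R → R < 3 → R ≠ ‖z‖ →
        (∮ w in C(0, R), dslope u z w) =
          (∮ w in C(0, R), (w - z)⁻¹ • u w) - u z * ∮ w in C(0, R), (w - z)⁻¹ := by
      intro R hR1 hR2 hRz
      have hR0 : 0 ≤ R := by linarith
      have hwz : ∀ w ∈ Metric.sphere (0 : ℂ) R, w - z ≠ 0 := fun w hw h => by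
        rw [mem_sphere_zero_iff_norm] at hw
        exact hRz (by rw [← hw, sub_eq_zero.1 h])
      have hinv : ContinuousOn (fun w : ℂ => (w - z)⁻¹) (Metric.sphere 0 R) :=
        (continuousOn_id.sub continuousOn_const).inv₀ hwz
      rw [← circleIntegral.integral_const_mul, ← circleIntegral.integral_sub]
      · refine circleIntegral.integral_congr hR0 fun w hw => ?_
        have hne : w ≠ z := sub_ne_zero.1 (hwz w hw)
        simp only [dslope_of_ne _ hne, slope_def_field, smul_eq_mul]
        ring
      · exact (hinv.smul (hcont R hR1 hR2)).circleIntegrable hR0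
      · exact (continuousOn_const.mul hinv).circleIntegrable hR0
    rw [hsplit 2 (by norm_num) (by norm_num) (by linarith),
      hsplit (1 / 2) (by norm_num) (by norm_num) (by linarith),
      circleIntegral.integral_sub_inv_of_mem_ball (by simpa using hz2)] at hcauchy
    have hzero : (∮ w in C((0 : ℂ), 1 / 2), (w - z)⁻¹) = 0 := by
      refine circleIntegral_eq_zero_of_differentiable_on_off_countable (by norm_num)
        countable_empty ?_ ?_
      · refine (continuousOn_id.sub continuousOn_const).inv₀ fun w hw h => ?_
        rw [mem_closedBall_zero_iff] at hw
        have : w = z := sub_eq_zero.1 h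
        rw [this] at hw
        linarith
      · intro w hw
        have hw' : ‖w‖ < 1 / 2 := by simpa using hw.1
        refine (differentiableAt_id.sub_const z).inv fun h => ?_
        have : w = z := sub_eq_zero.1 h
        rw [this] at hw'
        linarith
    rw [hzero] at hcauchy
    have hinner : (∮ w in C((0 : ℂ), 1 / 2), (w - z)⁻¹ • u w) =
        -(z⁻¹ * ∫ θ in (0 : ℝ)..2 * Real.pi,
          (I * u (circleMap 0 (1 / 2) θ)) / ((circleMap 0 (1 / 2) θ)⁻¹ - z⁻¹)) := by
      rw [circleIntegral, ← intervalIntegral.integral_const_mul, ← intervalIntegral.integral_neg]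
      refine intervalIntegral.integral_congr fun θ _ => ?_
      have h1 := hne θ
      have h2 : circleMap 0 (1 / 2) θ - z ≠ 0 := fun h => by
        rw [← sub_eq_zero.1 h, norm_circleMap_zero] at hz1
        norm_num at hz1
      have h3 : z - circleMap 0 (1 / 2) θ ≠ 0 := fun h => h2 (by linear_combination -h)
      have h4 : (circleMap 0 (1 / 2) θ)⁻¹ - z⁻¹ = (z - circleMap 0 (1 / 2) θ) /
          (z * circleMap 0 (1 / 2) θ) := by
        field_simp
      simp only [deriv_circleMap, smul_eq_mul]
      rw [h4]
      field_simp
      ring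
    rw [hinner] at hcauchy
    simp only [smul_eq_mul] at hcauchy ⊢
    field_simp at hcauchy ⊢
    linear_combination -hcauchy

/-- A nowhere vanishing holomorphic function on an annulus is the product of a power of the
coordinate, a function that extends to the disc inside and one that extends to the outside. -/
theorem exists_mul_split_annulus {G : ℂ → ℂ}
    (hG : ∀ z : ℂ, 1 / 3 < ‖z‖ → ‖z‖ < 3 → AnalyticAt ℂ G z)
    (hG0 : ∀ z : ℂ, 1 / 3 < ‖z‖ → ‖z‖ < 3 → G z ≠ 0) :
    ∃ (n : ℤ) (A B : ℂ → ℂ), DifferentiableOn ℂ A (Metric.ball 0 2) ∧ (∀ z, A z ≠ 0) ∧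
      DifferentiableOn ℂ B (Metric.ball 0 2) ∧ (∀ z, B z ≠ 0) ∧
      ∀ z : ℂ, 1 / 2 < ‖z‖ → ‖z‖ < 2 → G z = z ^ n * A z * B z⁻¹ := by
  have hball : IsOpen (Metric.ball (0 : ℂ) 2) := Metric.isOpen_ball
  obtain ⟨u₁, κ, hu₁, hκ, hu⟩ := laurent_decomposition (u := fun z => deriv G z / G z)
    fun z h1 h2 => (hG z h1 h2).deriv.differentiableAt.div (hG z h1 h2).differentiableAt
      (hG0 z h1 h2)
  -- Without its residue term `κ 0 / z`, the outer part of `G' / G` is the derivative of `h₂ z⁻¹`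
  -- for a primitive `h₂` of this function.
  have hκ' : DifferentiableOn ℂ (fun t => -dslope κ 0 t) (Metric.ball 0 2) :=
    ((differentiableOn_dslope (Metric.ball_mem_nhds _ (by norm_num))).2 hκ).neg
  obtain ⟨h₁, hh₁⟩ := (convex_ball (0 : ℂ) 2).exists_forall_hasDerivWithinAt hu₁
  obtain ⟨h₂, hh₂⟩ := (convex_ball (0 : ℂ) 2).exists_forall_hasDerivWithinAt hκ'
  have hd₁ : ∀ z ∈ Metric.ball (0 : ℂ) 2, HasDerivAt h₁ (u₁ z) z := fun z hz =>
    (hh₁ z hz).hasDerivAt (hball.mem_nhds hz)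
  have hd₂ : ∀ z ∈ Metric.ball (0 : ℂ) 2, HasDerivAt h₂ (-dslope κ 0 z) z := fun z hz =>
    (hh₂ z hz).hasDerivAt (hball.mem_nhds hz)
  set k := κ 0
  set φ : ℂ → ℂ := fun z => G z * exp (-h₁ z - h₂ z⁻¹)
  have hφ : ∀ z : ℂ, 1 / 2 < ‖z‖ → ‖z‖ < 2 → HasDerivAt φ (k / z * φ z) z := fun z hz1 hz2 => by
    have hz0 : z ≠ 0 := fun h => by norm_num [h] at hz1
    have e1 := hd₁ z (by simpa using hz2)
    have e2 := (hd₂ z⁻¹ (by simpa using norm_inv_mem_annulus hz1)).comp z (hasDerivAt_inv hz0)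
    have e3 := (hG z (by linarith) (by linarith)).differentiableAt.hasDerivAt
    refine (e3.mul ((e1.neg.sub e2).cexp)).congr_deriv ?_
    have hG0' := hG0 z (by linarith) (by linarith)
    have hu' := hu z hz1 hz2
    rw [div_eq_iff hG0'] at hu'
    have hds : dslope κ 0 z⁻¹ = (κ z⁻¹ - k) * z := by
      rw [dslope_of_ne _ (inv_ne_zero hz0), slope_def_field]
      simp [k]
    rw [hds, hu']
    simp only [φ, Pi.sub_apply, Pi.neg_apply, Function.comp_apply]
    field_simp
    ring
  -- The exponential maps the convex strip `S` onto the annulus, and there `z ^ k` becomes the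
  -- single-valued function `exp (k * s)`.
  set S : Set ℂ := Ioo (Real.log (1 / 2)) (Real.log 2) ×ℂ univ
  have hSo : IsOpen S := isOpen_Ioo.reProdIm isOpen_univ
  have hSc : Convex ℝ S := convex_reProdIm (convex_Ioo _ _) convex_univ
  have hSn : ∀ s ∈ S, 1 / 2 < ‖exp s‖ ∧ ‖exp s‖ < 2 := fun s hs => by
    rw [mem_reProdIm] at hs
    rw [norm_exp]
    exact ⟨(Real.log_lt_iff_lt_exp (by norm_num)).1 hs.1.1,
      (Real.lt_log_iff_exp_lt (by norm_num)).1 hs.1.2⟩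
  have hΨ : ∀ s ∈ S, HasDerivAt (fun s => φ (exp s) * exp (-(k * s))) 0 s := fun s hs => by
    obtain ⟨hs1, hs2⟩ := hSn s hs
    have e1 := (hφ (exp s) hs1 hs2).comp s (hasDerivAt_exp s)
    have e2 : HasDerivAt (fun s => exp (-(k * s))) (exp (-(k * s)) * -(k * 1)) s :=
      ((hasDerivAt_id s).const_mul k).neg.cexp
    refine (e1.mul e2).congr_deriv ?_
    have := exp_ne_zero s
    simp only [Function.comp]
    field_simp
    ring
  have h0S : (0 : ℂ) ∈ S := by
    rw [mem_reProdIm]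
    simp only [zero_re, mem_Ioo, mem_univ, and_true]
    exact ⟨Real.log_neg (by norm_num) (by norm_num), Real.log_pos (by norm_num)⟩
  have hconst : ∀ s ∈ S, φ (exp s) * exp (-(k * s)) = φ 1 := fun s hs => by
    have := hSo.is_const_of_deriv_eq_zero hSc.isPreconnected
      (fun w hw => (hΨ w hw).differentiableAt.differentiableWithinAt)
      (fun w hw => (hΨ w hw).deriv) hs h0S
    simpa using this
  have hφ1 : φ 1 ≠ 0 := mul_ne_zero (hG0 1 (by norm_num) (by norm_num)) (exp_ne_zero _)
  -- The points `0` and `2πi` of the strip have the same image, so `exp (-2πi k) = 1`: the residue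
  -- `k` is a winding number.
  obtain ⟨n, hn⟩ : ∃ n : ℤ, k = n := by
    have hmem : (2 * Real.pi * I : ℂ) ∈ S := by
      rw [mem_reProdIm] at h0S ⊢
      simpa using h0S
    have := hconst _ hmem
    rw [exp_two_pi_mul_I, mul_eq_left₀ hφ1, exp_eq_one_iff] at this
    obtain ⟨n, hn⟩ := this
    refine ⟨-n, ?_⟩
    have hpi : (2 * Real.pi * I : ℂ) ≠ 0 := by simp [Real.pi_ne_zero, I_ne_zero]
    push_cast
    refine mul_right_cancel₀ hpi ?_
    linear_combination -hn
  refine ⟨n, fun z => φ 1 * exp (h₁ z), fun z => exp (h₂ z),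
    fun z hz => ((hd₁ z hz).differentiableAt.cexp.const_mul _).differentiableWithinAt,
    fun z => mul_ne_zero hφ1 (exp_ne_zero _),
    fun z hz => (hd₂ z hz).differentiableAt.cexp.differentiableWithinAt,
    fun z => exp_ne_zero _, fun z hz1 hz2 => ?_⟩
  have hz0 : z ≠ 0 := fun h => by norm_num [h] at hz1
  have hs : log z ∈ S := by
    rw [mem_reProdIm, log_re]
    exact ⟨⟨Real.log_lt_log (by norm_num) hz1, Real.log_lt_log (by linarith) hz2⟩, mem_univ _⟩
  have := hconst _ hs
  rw [exp_log hz0, hn, exp_neg, exp_int_mul, exp_log hz0] at this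
  have hzn : z ^ n ≠ 0 := zpow_ne_zero n hz0
  rw [mul_inv_eq_iff_eq_mul₀ hzn] at this
  have h3 : G z = φ z * (exp (h₁ z) * exp (h₂ z⁻¹)) := by
    simp only [φ]
    rw [mul_assoc, ← exp_add, ← exp_add]
    ring_nf
    simp
  rw [h3, this]
  ring

end Annulus

/-! ### Gluing frames on the two discs to a global meromorphic section. -/

section LineBundle

/-- The frames, in the coordinate centred at `p`, of the line bundle given by the transition
functions `g a y / g b y`. -/
theorem isFrameClass_of_transition {g : OnePoint ℂ → OnePoint ℂ → ℂ} (h0 : ∀ a, g a a ≠ 0)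
    (h : ∀ a, ∀ᶠ b in 𝓝 a, g a b ≠ 0 ∧ Hol (fun y => g a y / g b y) b) (p : OnePoint ℂ) :
    IsFrameClass fun z f => AnalyticAt ℂ
      (fun w => f w * g ((chartAt ℂ p).symm z) ((chartAt ℂ p).symm w)) z ∧ f z ≠ 0 where
  exists_local z := by
    refine ⟨fun w => (g ((chartAt ℂ p).symm z) ((chartAt ℂ p).symm w))⁻¹, ?_⟩
    have := h ((chartAt ℂ p).symm z)
    rw [← map_chart_symm_nhds, eventually_map] at this
    filter_upwards [this] with w hw
    refine ⟨?_, inv_ne_zero hw.1⟩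
    have := hw.2.inv (div_ne_zero hw.1 (h0 _))
    rw [hol_chart_symm_iff] at this
    refine this.congr (Eventually.of_forall fun w' => ?_)
    simp [div_eq_mul_inv, mul_comm]
  div {w f₁ f₂} h₁ h₂ := by
    have hg := h0 ((chartAt ℂ p).symm w)
    refine ⟨(h₁.1.fun_div h₂.1 (mul_ne_zero h₂.2 hg)).congr ?_, div_ne_zero h₁.2 h₂.2⟩
    have := (h ((chartAt ℂ p).symm w)).mono fun b hb => hb.1
    rw [← map_chart_symm_nhds, eventually_map] at this
    filter_upwards [this] with w' hw'
    rw [mul_div_mul_right _ _ hw']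
  mul {w f k} hf hk hk0 := by
    refine ⟨(hk.fun_mul hf.1).congr (Eventually.of_forall fun w' => ?_), mul_ne_zero hk0 hf.2⟩
    simp [mul_assoc]
  congr {w f₁ f₂} hf hff := by
    refine ⟨hf.1.congr ?_, by rw [← hff.self_of_nhds]; exact hf.2⟩
    filter_upwards [hff] with w' hw'
    rw [hw']

theorem analyticAt_inv_coord_of_ne {f : ℂ → ℂ} {z : ℂ} (hz : z ≠ 0) (hf : AnalyticAt ℂ f z⁻¹) :
    AnalyticAt ℂ (fun w => f w⁻¹) z :=
  AnalyticAt.fun_comp (g := f) (f := fun w => w⁻¹) hf (analyticAt_inv hz)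

/-- A line bundle on the Riemann sphere, given by the transition functions `g a y / g b y`, has a
nonzero meromorphic section. -/
theorem exists_meromorphic_section {g : OnePoint ℂ → OnePoint ℂ → ℂ} (h0 : ∀ a, g a a ≠ 0)
    (h : ∀ a, ∀ᶠ b in 𝓝 a, g a b ≠ 0 ∧ Hol (fun y => g a y / g b y) b) :
    ∃ (c : OnePoint ℂ → ℂ) (m : OnePoint ℂ →₀ ℤ),
      ∀ a, HasOrderAt (fun y => c y * g a y) a (m a) := by
  classical
  obtain ⟨f₁, hf₁⟩ := (isFrameClass_of_transition h0 h ((0 : ℂ) : OnePoint ℂ)).exists_on_ball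
    (r := 3) (by norm_num)
  obtain ⟨f₂, hf₂⟩ := (isFrameClass_of_transition h0 h ∞).exists_on_ball (r := 3) (by norm_num)
  simp only [chartAt_coe, affineChart_symm_apply] at hf₁
  simp only [chartAt_infty, inftyChart_symm_apply] at hf₂
  have hf₂' : ∀ z : ℂ, 1 / 3 < ‖z‖ →
      AnalyticAt ℂ (fun w : ℂ => f₂ w⁻¹ * g (z : OnePoint ℂ) (w : OnePoint ℂ)) z ∧
        f₂ z⁻¹ ≠ 0 := fun z hz => by
    have hz0 : z ≠ 0 := fun h => by norm_num [h] at hz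
    obtain ⟨h1, h2⟩ := hf₂ z⁻¹ (by
      rw [mem_ball_zero_iff, norm_inv, inv_lt_comm₀ (by linarith) (by norm_num)]
      linarith)
    refine ⟨?_, h2⟩
    rw [inv_coe (inv_ne_zero hz0), _root_.inv_inv] at h1
    refine (analyticAt_inv_coord_of_ne hz0 h1).congr ?_
    filter_upwards [isOpen_ne.mem_nhds hz0] with w hw
    rw [inv_coe (inv_ne_zero hw), _root_.inv_inv]
  have hgne : ∀ z : ℂ, ∀ᶠ w : ℂ in 𝓝 z, g (z : OnePoint ℂ) (w : OnePoint ℂ) ≠ 0 := fun z => by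
    have := (h (z : OnePoint ℂ)).mono fun b hb => hb.1
    rwa [OnePoint.nhds_coe_eq, eventually_map] at this
  obtain ⟨n, A, B, hA, hA0, hB, hB0, hAB⟩ := exists_mul_split_annulus
    (G := fun z => f₁ z / f₂ z⁻¹) (fun z h1 h2 => by
      have e1 := hf₁ z (by simpa using h2)
      have e2 := hf₂' z h1
      refine (e1.1.fun_div e2.1 (mul_ne_zero e2.2 (h0 _))).congr ?_
      filter_upwards [hgne z] with w hw
      rw [mul_div_mul_right _ _ hw])
    (fun z h1 h2 => div_ne_zero (hf₁ z (by simpa using h2)).2 (hf₂' z h1).2)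
  -- The two formulas agree on the annulus because `f₁ z / f₂ z⁻¹ = z ^ n * A z * B z⁻¹`. Only the
  -- factor `z ^ n` contributes to the divisor, with order `-n` at `∞`; the value `0` assigned at
  -- `∞` is invisible to the order.
  set c : OnePoint ℂ → ℂ := fun y => y.elim 0 fun z =>
    if ‖z‖ < 2 then f₁ z / A z else z ^ n * B z⁻¹ * f₂ z⁻¹
  have hc1 : ∀ z : ℂ, ‖z‖ < 2 → c z = f₁ z / A z := fun z hz => by simp [c, hz]
  have hc2 : ∀ z : ℂ, 1 / 2 < ‖z‖ → c z = z ^ n * B z⁻¹ * f₂ z⁻¹ := fun z hz => by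
    by_cases hz2 : ‖z‖ < 2
    · rw [hc1 z hz2, div_eq_iff (hA0 z)]
      have h1 := hAB z hz hz2
      rw [div_eq_iff (hf₂' z (by linarith)).2] at h1
      rw [h1]
      ring
    · simp [c, hz2]
  have hB' : ∀ z : ℂ, 1 / 2 < ‖z‖ → AnalyticAt ℂ (fun w => B w⁻¹) z := fun z hz => by
    have hz0 : z ≠ 0 := fun h => by norm_num [h] at hz
    exact analyticAt_inv_coord_of_ne hz0 (hB.analyticAt
      (Metric.isOpen_ball.mem_nhds (by simpa using norm_inv_mem_annulus hz)))
  refine ⟨c, Finsupp.single ∞ (-n), fun a => ?_⟩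
  induction a using OnePoint.rec with
  | coe z =>
    rw [Finsupp.single_eq_of_ne (by simp)]
    by_cases hz : ‖z‖ < 2
    · have e1 := hf₁ z (by rw [mem_ball_zero_iff]; linarith)
      refine HasOrderAt.of_hol (hol_coe_iff.2 ?_)
        (mul_ne_zero (by rw [hc1 z hz]; exact div_ne_zero e1.2 (hA0 z)) (h0 _))
      refine (e1.1.fun_div (hA.analyticAt (Metric.isOpen_ball.mem_nhds (by simpa using hz)))
        (hA0 z)).congr ?_
      filter_upwards [(isOpen_lt continuous_norm continuous_const).mem_nhds hz] with w hw
      rw [hc1 w hw]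
      ring
    · have hz1 : 1 / 2 < ‖z‖ := by linarith
      have hz0 : z ≠ 0 := fun h => by norm_num [h] at hz1
      have e2 := hf₂' z (by linarith)
      refine HasOrderAt.of_hol (hol_coe_iff.2 ?_) (mul_ne_zero (by
        rw [hc2 z hz1]
        exact mul_ne_zero (mul_ne_zero (zpow_ne_zero _ hz0) (hB0 _)) e2.2) (h0 _))
      refine (((analyticAt_id.fun_zpow hz0 (n := n)).fun_mul (hB' z hz1)).fun_mul e2.1).congr ?_
      filter_upwards [(isOpen_lt continuous_const continuous_norm).mem_nhds hz1] with w hw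
      rw [hc2 w hw]
      simp only [id]
      ring
  | infty =>
    rw [Finsupp.single_eq_same]
    have e2 := hf₂ 0 (by simp)
    rw [inv_zero] at e2
    have hhol : HasOrderAt (fun y => B (inftyChart y) * (f₂ (inftyChart y) * g ∞ y)) ∞ 0 := by
      refine HasOrderAt.of_hol ?_ (by
        rw [inftyChart_infty]; exact mul_ne_zero (hB0 _) (mul_ne_zero e2.2 (h0 _)))
      rw [hol_iff, chartAt_infty, inftyChart_infty]
      have hright : ∀ t : ℂ, inftyChart (inv (t : OnePoint ℂ)) = t := fun t => by
        rw [← inftyChart_symm_apply]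
        exact chart_apply_symm ∞ t
      simp only [inftyChart_symm_apply, hright]
      exact (hB.analyticAt (Metric.isOpen_ball.mem_nhds (by simp))).fun_mul e2.1
    have hprod := ((hasOrderAt_linearCoord_infty 0).zpow n).mul hhol
    have hprod' : HasOrderAt (fun y => linearCoord 0 y ^ n *
        (B (inftyChart y) * (f₂ (inftyChart y) * g ∞ y))) ∞ (-n) := by simpa using hprod
    refine hprod'.congr ?_
    have hev : ∀ᶠ y : OnePoint ℂ in 𝓝[≠] ∞, ∃ z : ℂ, y = (z : OnePoint ℂ) ∧ 1 / 2 < ‖z‖ := by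
      rw [OnePoint.nhdsNE_infty_eq, eventually_map, coclosedCompact_eq_cocompact]
      filter_upwards [(isCompact_closedBall (0 : ℂ) (1 / 2)).compl_mem_cocompact] with z hz
      exact ⟨z, rfl, by simpa using hz⟩
    filter_upwards [hev] with y hy
    obtain ⟨z, rfl, hz⟩ := hy
    have hz0 : z ≠ 0 := fun h => by norm_num [h] at hz
    rw [hc2 z hz, inftyChart_coe hz0]
    simp only [linearCoord, OnePoint.elim_some, sub_zero]
    ring

end LineBundle

/-! ### Local frames and the existence of degrees -/

namespace HolVectorBundle

variable {n : ℕ} (E : HolVectorBundle n)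

/-- The open set over which the preferred trivialization at `a` is defined. -/
def base (a : OnePoint ℂ) : Set (OnePoint ℂ) := (trivializationAt (Fin n → ℂ) E.Fib a).baseSet

/-- The coordinates of a vector in the preferred trivialization at `a`. -/
noncomputable def coord (a y : OnePoint ℂ) : E.Fib y →ₗ[ℂ] (Fin n → ℂ) :=
  (trivializationAt (Fin n → ℂ) E.Fib a).linearMapAt ℂ y

/-- The vector with given coordinates in the preferred trivialization at `a`. -/
noncomputable def lift (a y : OnePoint ℂ) : (Fin n → ℂ) →ₗ[ℂ] E.Fib y :=
  (trivializationAt (Fin n → ℂ) E.Fib a).symmₗ ℂ y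

theorem base_mem_nhds (a : OnePoint ℂ) : E.base a ∈ 𝓝 a :=
  (trivializationAt (Fin n → ℂ) E.Fib a).open_baseSet.mem_nhds
    (FiberBundle.mem_baseSet_trivializationAt' a)

theorem mem_base_self (a : OnePoint ℂ) : a ∈ E.base a := mem_of_mem_nhds (E.base_mem_nhds a)

variable {E}

theorem coord_lift {a y : OnePoint ℂ} (hy : y ∈ E.base a) (v : Fin n → ℂ) :
    E.coord a y (E.lift a y v) = v :=
  (trivializationAt (Fin n → ℂ) E.Fib a).linearMapAt_symmₗ hy v

theorem lift_coord {a y : OnePoint ℂ} (hy : y ∈ E.base a) (v : E.Fib y) :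
    E.lift a y (E.coord a y v) = v :=
  (trivializationAt (Fin n → ℂ) E.Fib a).symmₗ_linearMapAt hy v

/-- The coordinates as a linear equivalence. -/
noncomputable def coordEquiv {a y : OnePoint ℂ} (hy : y ∈ E.base a) :
    E.Fib y ≃ₗ[ℂ] (Fin n → ℂ) :=
  LinearEquiv.ofLinearMap (E.coord a y) (E.lift a y) (LinearMap.ext (coord_lift hy))
    (LinearMap.ext (lift_coord hy))

instance (y : OnePoint ℂ) : FiniteDimensional ℂ (E.Fib y) :=
  (coordEquiv (E.mem_base_self y)).symm.finiteDimensional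

theorem finrank_fib (y : OnePoint ℂ) : finrank ℂ (E.Fib y) = n := by
  rw [(coordEquiv (E.mem_base_self y)).finrank_eq, finrank_fin_fun]

theorem holAt_iff {a b : OnePoint ℂ} (hb : b ∈ E.base a) {s : ∀ x, E.Fib x} :
    E.HolAt s b ↔ Hol (fun y => E.coord a y (s y)) b := by
  rw [HolAt, (trivializationAt (Fin n → ℂ) E.Fib a).contMDiffAt_section_iff hb]
  refine Filter.EventuallyEq.contMDiffAt_iff ?_
  filter_upwards [(trivializationAt (Fin n → ℂ) E.Fib a).open_baseSet.mem_nhds hb] with y hy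
  rw [coord, Trivialization.coe_linearMapAt_of_mem _ hy]

theorem holAt_lift {a b : OnePoint ℂ} (hb : b ∈ E.base a) {f : OnePoint ℂ → Fin n → ℂ}
    (hf : Hol f b) : E.HolAt (fun y => E.lift a y (f y)) b := by
  rw [holAt_iff hb]
  refine hf.congr ?_
  filter_upwards [(trivializationAt (Fin n → ℂ) E.Fib a).open_baseSet.mem_nhds hb] with y hy
  rw [coord_lift hy]

theorem HolAt.eventually {a : OnePoint ℂ} {s : ∀ x, E.Fib x} (hs : E.HolAt s a) :
    ∀ᶠ b in 𝓝 a, E.HolAt s b := by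
  rw [holAt_iff (E.mem_base_self a)] at hs
  filter_upwards [hs.eventually, E.base_mem_nhds a] with b hb hb'
  rwa [holAt_iff hb']

theorem IsFrameAt.eventually {N : ∀ x, Submodule ℂ (E.Fib x)} {r : ℕ} {s : Fin r → ∀ x, E.Fib x}
    {a : OnePoint ℂ} (hs : E.IsFrameAt N s a) : ∀ᶠ b in 𝓝 a, E.IsFrameAt N s b := by
  filter_upwards [eventually_all.2 fun i => (hs.1 i).eventually, hs.2.eventually_nhds] with b h1 h2
  exact ⟨h1, h2⟩

end HolVectorBundle

/-- Two bases of the same subspace: all alternating forms of top degree change by the same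
nonzero factor. -/
theorem exists_alternating_ratio {M : Type*} [AddCommGroup M] [Module ℂ M] {r : ℕ}
    {s s' : Fin r → M} (hs : LinearIndependent ℂ s) (hs' : LinearIndependent ℂ s')
    (h : Submodule.span ℂ (Set.range s') = Submodule.span ℂ (Set.range s)) :
    ∃ D : ℂ, D ≠ 0 ∧ ∀ w : M [⋀^Fin r]→ₗ[ℂ] ℂ, w s' = D * w s := by
  set b := Basis.span hs
  have hmem : ∀ i, s' i ∈ Submodule.span ℂ (Set.range s) := fun i => by
    rw [← h]
    exact Submodule.subset_span ⟨i, rfl⟩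
  set t : Fin r → Submodule.span ℂ (Set.range s) := fun i => ⟨s' i, hmem i⟩
  have ht : LinearIndependent ℂ t := by
    refine LinearIndependent.of_comp (Submodule.subtype _) ?_
    exact hs'
  have htop : ⊤ ≤ Submodule.span ℂ (Set.range t) := by
    have : FiniteDimensional ℂ (Submodule.span ℂ (Set.range s)) := b.finiteDimensional_of_finite
    have hcard := ht.span_eq_top_of_card_eq_finrank' (by rw [finrank_eq_card_basis b])
    exact hcard.ge
  refine ⟨b.det t, ((Basis.is_basis_iff_det b).1 ⟨ht, top_le_iff.1 htop⟩).ne_zero, fun w => ?_⟩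
  have h1 := (w.compLinearMap (Submodule.subtype _)).eq_smul_basis_det b
  have h2 := congrArg (fun f => f t) h1
  simp only [AlternatingMap.compLinearMap_apply, AlternatingMap.smul_apply, smul_eq_mul] at h2
  have h3 : (fun i => (Submodule.span ℂ (Set.range s)).subtype (b i)) = s := by
    ext i
    simp [b, Basis.span_apply]
  rw [h3] at h2
  rw [mul_comm]
  exact h2

namespace HolVectorBundle

variable {n : ℕ} {E : HolVectorBundle n}

/-- In coordinates, a left inverse of the frame at `a` followed by the determinant is a form with
constant coefficients. Evaluating it turns a local frame into a holomorphic function, hence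
transition determinants into quotients of functions. -/
theorem IsFrameAt.exists_form {N : ∀ x, Submodule ℂ (E.Fib x)} {r : ℕ}
    {s : Fin r → ∀ x, E.Fib x} {a : OnePoint ℂ} (hs : E.IsFrameAt N s a) :
    ∃ η : ∀ y, E.Fib y [⋀^Fin r]→ₗ[ℂ] ℂ, η a (fun i => s i a) ≠ 0 ∧
      ∀ t : Fin r → ∀ x, E.Fib x, (∀ i, E.HolAt (t i) a) →
        Hol (fun y => η y (fun i => t i y)) a := by
  have hli : LinearIndependent ℂ fun i => E.coord a a (s i a) :=
    hs.2.self_of_nhds.1.map' _ (LinearMap.ker_eq_bot.2 (coordEquiv (E.mem_base_self a)).injective)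
  obtain ⟨L, hL⟩ := LinearMap.exists_leftInverse_of_injective
    (Fintype.linearCombination ℂ fun i => E.coord a a (s i a))
    (LinearMap.ker_eq_bot.2 hli.fintypeLinearCombination_injective)
  have hL' : ∀ i, L (E.coord a a (s i a)) = Pi.single i 1 := fun i => by
    have := LinearMap.congr_fun hL (Pi.single i 1)
    simpa [Fintype.linearCombination_apply_single] using this
  refine ⟨fun y => (Pi.basisFun ℂ (Fin r)).det.compLinearMap (L ∘ₗ E.coord a y), ?_, ?_⟩
  · have : (fun i => (L ∘ₗ E.coord a a) (s i a)) = Pi.basisFun ℂ (Fin r) := by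
      ext i : 1
      rw [LinearMap.comp_apply, hL', Pi.basisFun_apply]
    simp only [AlternatingMap.compLinearMap_apply]
    rw [this, Basis.det_self]
    exact one_ne_zero
  · intro t ht
    simp only [AlternatingMap.compLinearMap_apply, Basis.det_apply]
    refine Hol.det fun i j => ?_
    have h1 := (holAt_iff (E.mem_base_self a)).1 (ht j)
    simp only [Basis.toMatrix_apply, Pi.basisFun_repr, LinearMap.comp_apply, hol_iff] at h1 ⊢
    have h2 : AnalyticAt ℂ (LinearMap.toContinuousLinearMap ((LinearMap.proj i) ∘ₗ L))
        (E.coord a ((chartAt ℂ a).symm (chartAt ℂ a a)) (t j ((chartAt ℂ a).symm (chartAt ℂ a a)))) :=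
      ContinuousLinearMap.analyticAt _ _
    exact AnalyticAt.fun_comp (f := fun z => E.coord a ((chartAt ℂ a).symm z)
      (t j ((chartAt ℂ a).symm z))) h2 h1

/-- Every holomorphic subbundle has a degree. -/
theorem IsSubbundle.exists_hasDegree {N : ∀ x, Submodule ℂ (E.Fib x)} {r : ℕ}
    (hN : E.IsSubbundle N r) : ∃ d, E.HasDegree N r d := by
  choose S hS using hN
  choose η hη0 hη using fun a => (hS a).exists_form
  -- At each `y` the frame chosen at `b` is evaluated on the form chosen at `y`. This form cancels
  -- in `g a y / g b y`, which is near `b` the determinant of the change of frame.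
  set g : OnePoint ℂ → OnePoint ℂ → ℂ := fun b y => η y y (fun i => S b i y)
  have hratio : ∀ {a : OnePoint ℂ} {s s' : Fin r → ∀ x, E.Fib x}, E.IsFrameAt N s a →
      E.IsFrameAt N s' a → ∃ D : ℂ, D ≠ 0 ∧ ∀ w : E.Fib a [⋀^Fin r]→ₗ[ℂ] ℂ,
        w (fun i => s' i a) = D * w (fun i => s i a) := fun hs hs' =>
    exists_alternating_ratio hs.2.self_of_nhds.1 hs'.2.self_of_nhds.1
      (hs'.2.self_of_nhds.2.trans hs.2.self_of_nhds.2.symm)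
  have hform : ∀ {a : OnePoint ℂ} {s : Fin r → ∀ x, E.Fib x}, E.IsFrameAt N s a →
      η a a (fun i => s i a) ≠ 0 := fun {a s} hs => by
    obtain ⟨D, hD, h⟩ := hratio (hS a) hs
    rw [h]
    exact mul_ne_zero hD (hη0 a)
  have hquot : ∀ {a : OnePoint ℂ} {s s' : Fin r → ∀ x, E.Fib x}, E.IsFrameAt N s a →
      E.IsFrameAt N s' a → ∀ᶠ y in 𝓝 a, ∀ w : E.Fib y [⋀^Fin r]→ₗ[ℂ] ℂ,
        w (fun i => s' i y) =
          η a y (fun i => s' i y) / η a y (fun i => s i y) * w (fun i => s i y) :=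
    fun {a s s'} hs hs' => by
      filter_upwards [hs.eventually, hs'.eventually,
        (hη a s hs.1).eventually_ne (hform hs)] with y h1 h2 h3 w
      obtain ⟨D, hD, h⟩ := hratio h1 h2
      rw [h, h, mul_div_assoc, div_self h3, mul_one]
  obtain ⟨c, m, hcm⟩ := exists_meromorphic_section (g := g) (fun a => hη0 a) fun a => by
    filter_upwards [(hS a).eventually] with b hb
    refine ⟨hform hb, ?_⟩
    refine ((hη b _ hb.1).div (hη b _ (hS b).1) (hη0 b)).congr ?_
    filter_upwards [hquot (hS b) hb, (hS b).eventually] with y hy hy'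
    simp only [g]
    rw [hy (η y y), mul_div_assoc, div_self (hform hy'), mul_one]
  refine ⟨_, fun y => c y • η y y, m, fun a s hs => ?_, rfl⟩
  have h1 := (hcm a).mul (HasOrderAt.of_hol ((hη a _ hs.1).div (hη a _ (hS a).1) (hη0 a))
    (div_ne_zero (hform hs) (hη0 a)))
  rw [add_zero] at h1
  refine h1.congr (eventually_nhdsWithin_of_eventually_nhds ?_)
  filter_upwards [hquot (hS a) hs] with y hy
  simp only [AlternatingMap.smul_apply, smul_eq_mul, g]
  rw [hy (η y y)]
  ring

/-- `degree` is a chosen value, so existence is enough to specify it; the comparisons below hold for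
every integer satisfying `HasDegree`. -/
theorem IsSubbundle.hasDegree {N : ∀ x, Submodule ℂ (E.Fib x)} {r : ℕ}
    (hN : E.IsSubbundle N r) : E.HasDegree N r (E.degree N r) :=
  Classical.epsilon_spec hN.exists_hasDegree

end HolVectorBundle

/-! ### The normal form of a matrix of holomorphic functions -/

/-- The range is a submodule of a free module and has a basis of multiples `d i` of members of a
basis of the target. It is free, so lifts of its basis together with a basis of the kernel form a
basis of the source. `P` and `Q` are the changes of basis. -/
theorem Matrix.exists_smith_normal_form {R : Type*} [CommRing R] [IsDomain R]
    [IsPrincipalIdealRing R] {p q : ℕ} (A : Matrix (Fin p) (Fin q) R) :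
    ∃ (r t : ℕ) (σ : Fin r ⊕ Fin t ≃ Fin q) (f : Fin r ↪ Fin p) (P P' : Matrix (Fin q) (Fin q) R)
      (Q Q' : Matrix (Fin p) (Fin p) R) (d : Fin r → R), P' * P = 1 ∧ Q' * Q = 1 ∧
      (∀ i, d i ≠ 0) ∧ (∀ i k, (A * P) k (σ (Sum.inl i)) = d i * Q k (f i)) ∧
      ∀ j k, (A * P) k (σ (Sum.inr j)) = 0 := by
  classical
  obtain ⟨r, bM, bN, f, d, snf⟩ :=
    (LinearMap.range A.toLin').smithNormalForm (Pi.basisFun R (Fin p))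
  set K := LinearMap.ker A.toLin'
  set bK := Module.finBasis R K
  set bQ := bN.map A.toLin'.quotKerEquivRange.symm
  set v' := bK.sumQuot bQ
  -- Image indices come first. The index sets of two bases of `R ^ q` are equinumerous, which
  -- identifies the sum with `Fin q`.
  set τ := (v'.reindex (Equiv.sumComm _ _)).indexEquiv (Pi.basisFun R (Fin q))
  set v := v'.reindex ((Equiv.sumComm _ _).trans τ)
  have hinl : ∀ i, A.toLin' (v (τ (Sum.inl i))) = (bN i : Fin p → R) := fun i => by
    have h1 : v (τ (Sum.inl i)) = v' (Sum.inr i) := by simp [v]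
    have h2 : K.mkQ (v' (Sum.inr i)) = bQ i := Basis.sumQuot_inr bK bQ i
    have h3 := congrArg (fun x => (A.toLin'.quotKerEquivRange x : Fin p → R)) h2
    simpa [bQ, h1, K] using h3
  have hinr : ∀ j, A.toLin' (v (τ (Sum.inr j))) = 0 := fun j => by
    have h1 : v (τ (Sum.inr j)) = v' (Sum.inl j) := by simp [v]
    rw [h1, Basis.sumQuot_inl]
    exact (bK j).2
  have hmul : ∀ i k, (A * (Pi.basisFun R (Fin q)).toMatrix v) k i = A.toLin' (v i) k :=
    fun i k => by
      simp [Matrix.mul_apply, Matrix.toLin'_apply, Matrix.mulVec, dotProduct, Basis.toMatrix_apply]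
  refine ⟨r, _, τ, f, (Pi.basisFun R (Fin q)).toMatrix v, v.toMatrix (Pi.basisFun R (Fin q)),
    (Pi.basisFun R (Fin p)).toMatrix bM, bM.toMatrix (Pi.basisFun R (Fin p)), d,
    Basis.toMatrix_mul_toMatrix_flip _ _, Basis.toMatrix_mul_toMatrix_flip _ _, fun i hi => ?_,
    fun i k => ?_, fun j k => ?_⟩
  · have h1 := snf i
    rw [hi, zero_smul] at h1
    exact bN.ne_zero i (Subtype.ext h1)
  · rw [hmul, hinl, snf]
    simp [Basis.toMatrix_apply]
  · rw [hmul, hinr]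
    rfl

/-- The ring of germs of holomorphic functions at a point of the plane. -/
def analyticGerm (z₀ : ℂ) : Subring (Germ (𝓝 z₀) ℂ) where
  carrier := {φ | ∃ f : ℂ → ℂ, AnalyticAt ℂ f z₀ ∧ (f : Germ (𝓝 z₀) ℂ) = φ}
  mul_mem' := by
    rintro _ _ ⟨f, hf, rfl⟩ ⟨g, hg, rfl⟩
    exact ⟨f * g, hf.mul hg, rfl⟩
  one_mem' := ⟨1, analyticAt_const, rfl⟩
  add_mem' := by
    rintro _ _ ⟨f, hf, rfl⟩ ⟨g, hg, rfl⟩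
    exact ⟨f + g, hf.add hg, rfl⟩
  zero_mem' := ⟨0, analyticAt_const, rfl⟩
  neg_mem' := by
    rintro _ ⟨f, hf, rfl⟩
    exact ⟨-f, hf.neg, rfl⟩

/-! ### The holomorphic germs at a point form a principal ideal domain. -/

namespace analyticGerm

variable {z₀ : ℂ}

/-- The germ of an analytic function. -/
noncomputable def mk (f : ℂ → ℂ) (hf : AnalyticAt ℂ f z₀) : analyticGerm z₀ := ⟨f, f, hf, rfl⟩

theorem exists_mk (x : analyticGerm z₀) : ∃ f, ∃ hf : AnalyticAt ℂ f z₀, mk f hf = x := by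
  obtain ⟨_, f, hf, rfl⟩ := x
  exact ⟨f, hf, rfl⟩

theorem mk_eq_iff {f g : ℂ → ℂ} {hf : AnalyticAt ℂ f z₀} {hg : AnalyticAt ℂ g z₀} :
    mk f hf = mk g hg ↔ f =ᶠ[𝓝 z₀] g := by
  rw [← Germ.coe_eq, Subtype.ext_iff]
  rfl

theorem mk_eq_zero_iff {f : ℂ → ℂ} {hf : AnalyticAt ℂ f z₀} :
    mk f hf = 0 ↔ ∀ᶠ z in 𝓝 z₀, f z = 0 :=
  mk_eq_iff (hg := analyticAt_const (v := (0 : ℂ)))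

theorem mk_ne_zero_iff {f : ℂ → ℂ} {hf : AnalyticAt ℂ f z₀} :
    mk f hf ≠ 0 ↔ ∀ᶠ z in 𝓝[≠] z₀, f z ≠ 0 := by
  rw [Ne, mk_eq_zero_iff]
  constructor
  · intro h
    exact hf.eventually_eq_zero_or_eventually_ne_zero.resolve_left h
  · intro h h'
    obtain ⟨z, hz1, hz2⟩ := (h.and (h'.filter_mono nhdsWithin_le_nhds)).exists
    exact hz1 hz2

instance : IsDomain (analyticGerm z₀) := by
  have : NoZeroDivisors (analyticGerm z₀) := ⟨fun {x y} hxy => by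
    obtain ⟨f, hf, rfl⟩ := exists_mk x
    obtain ⟨g, hg, rfl⟩ := exists_mk y
    by_contra! h
    have h1 := mk_ne_zero_iff.1 h.1
    have h2 := mk_ne_zero_iff.1 h.2
    have h3 : ∀ᶠ z in 𝓝 z₀, (f * g) z = 0 := (mk_eq_zero_iff (hf := hf.mul hg)).1 hxy
    obtain ⟨z, hz⟩ := (h1.and (h2.and (h3.filter_mono nhdsWithin_le_nhds))).exists
    exact mul_ne_zero hz.1 hz.2.1 hz.2.2⟩
  exact NoZeroDivisors.to_isDomain _

/-- The order of vanishing splits off a power of the coordinate, and a germ with nonzero value is a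
unit. -/
theorem exists_eq_pow_mul {x : analyticGerm z₀} (hx : x ≠ 0) :
    ∃ n : ℕ, Associated (mk (z₀ := z₀) (fun z => z - z₀) (by fun_prop) ^ n) x := by
  obtain ⟨f, hf, rfl⟩ := exists_mk x
  obtain ⟨n, g, hg, hg0, hfg⟩ := hf.exists_eventuallyEq_pow_smul_nonzero_iff.2
    fun h => hx (mk_eq_zero_iff.2 h)
  have hgi := hg.fun_inv hg0
  have hu : mk g hg * mk (fun z => (g z)⁻¹) hgi = 1 := by
    refine (mk_eq_iff (hf := hg.fun_mul hgi) (hg := analyticAt_const (v := (1 : ℂ)))).2 ?_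
    filter_upwards [hg.continuousAt.eventually_ne hg0] with z hz
    exact mul_inv_cancel₀ hz
  refine ⟨n, Units.mk (mk g hg) (mk _ hgi) hu (by rw [mul_comm, hu]), ?_⟩
  refine (mk_eq_iff (hf := ((by fun_prop : AnalyticAt ℂ (fun z : ℂ => z - z₀) z₀).pow n).mul hg)
    (hg := hf)).2 ?_
  filter_upwards [hfg] with z hz
  simp [hz]

/-- A nonzero ideal is generated by the least power of the coordinate that it contains. -/
instance : IsPrincipalIdealRing (analyticGerm z₀) where
  principal I := by
    classical
    set ϖ := mk (z₀ := z₀) (fun z => z - z₀) (by fun_prop)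
    by_cases hI : ∃ n, ϖ ^ n ∈ I
    · refine ⟨ϖ ^ Nat.find hI, le_antisymm (fun x hx => ?_) ?_⟩
      · by_cases hx0 : x = 0
        · rw [hx0]; exact Submodule.zero_mem _
        · obtain ⟨m, hm⟩ := exists_eq_pow_mul hx0
          have hmem : ϖ ^ m ∈ I := I.mem_of_dvd hm.dvd' hx
          exact Ideal.mem_span_singleton.2 ((pow_dvd_pow ϖ (Nat.find_min' hI hmem)).trans hm.dvd)
      · exact (Ideal.span_singleton_le_iff_mem I).2 (Nat.find_spec hI)
    · refine ⟨0, ?_⟩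
      rw [Submodule.span_zero_singleton, eq_bot_iff]
      intro x hx
      by_contra hx0
      obtain ⟨m, hm⟩ := exists_eq_pow_mul hx0
      exact hI ⟨m, I.mem_of_dvd hm.dvd' hx⟩

/-- A representative of a germ. -/
noncomputable def rep (x : analyticGerm z₀) : ℂ → ℂ := (exists_mk x).choose

theorem analyticAt_rep (x : analyticGerm z₀) : AnalyticAt ℂ (rep x) z₀ :=
  (exists_mk x).choose_spec.choose

theorem coe_rep (x : analyticGerm z₀) : Germ.coeRingHom (𝓝 z₀) (rep x) = (x : Germ (𝓝 z₀) ℂ) :=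
  congrArg Subtype.val (exists_mk x).choose_spec.choose_spec

theorem rep_mk {f : ℂ → ℂ} (hf : AnalyticAt ℂ f z₀) : rep (mk f hf) =ᶠ[𝓝 z₀] f :=
  mk_eq_iff.1 (exists_mk (mk f hf)).choose_spec.choose_spec

theorem rep_mul_eventuallyEq {l m n : ℕ} {A : Matrix (Fin l) (Fin m) (analyticGerm z₀)}
    {B : Matrix (Fin m) (Fin n) (analyticGerm z₀)} (i : Fin l) (j : Fin n) :
    (fun z => ((A.map fun x => rep x z) * (B.map fun x => rep x z)) i j) =ᶠ[𝓝 z₀]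
      rep ((A * B) i j) := by
  rw [← Germ.coe_eq]
  have h1 : Germ.coeRingHom (𝓝 z₀)
      (fun z => ((A.map fun x => rep x z) * (B.map fun x => rep x z)) i j) =
      Germ.coeRingHom (𝓝 z₀) (∑ k, rep (A i k) * rep (B k j)) := by
    congr 1
    ext z
    simp [Matrix.mul_apply]
  have h2 := coe_rep ((A * B) i j)
  change Germ.coeRingHom (𝓝 z₀) _ = Germ.coeRingHom (𝓝 z₀) _
  rw [h1, h2, map_sum, Matrix.mul_apply]
  simp only [map_mul, coe_rep]
  push_cast
  rfl

theorem rep_congr {x : analyticGerm z₀} {f : ℂ → ℂ} (hf : AnalyticAt ℂ f z₀) (h : x = mk f hf) :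
    rep x =ᶠ[𝓝 z₀] f := by
  rw [h]
  exact rep_mk hf

end analyticGerm

open analyticGerm in
/-- The normal form of a matrix of holomorphic functions near a point: in suitable holomorphic
bases it is diagonal. -/
theorem exists_analytic_normal_form {p q : ℕ} {z₀ : ℂ} {A : ℂ → Matrix (Fin p) (Fin q) ℂ}
    (hA : ∀ i j, AnalyticAt ℂ (fun z => A z i j) z₀) :
    ∃ (r t : ℕ) (σ : Fin r ⊕ Fin t ≃ Fin q) (f : Fin r ↪ Fin p)
      (P P' : ℂ → Matrix (Fin q) (Fin q) ℂ) (Q Q' : ℂ → Matrix (Fin p) (Fin p) ℂ)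
      (d : Fin r → ℂ → ℂ),
      (∀ i j, AnalyticAt ℂ (fun z => P z i j) z₀) ∧ (∀ i j, AnalyticAt ℂ (fun z => Q z i j) z₀) ∧
      (∀ i, AnalyticAt ℂ (d i) z₀) ∧ (∀ᶠ z in 𝓝 z₀, P' z * P z = 1) ∧
      (∀ᶠ z in 𝓝 z₀, Q' z * Q z = 1) ∧ (∀ i, ∀ᶠ z in 𝓝[≠] z₀, d i z ≠ 0) ∧
      (∀ᶠ z in 𝓝 z₀, ∀ i k, (A z * P z) k (σ (Sum.inl i)) = d i z * Q z k (f i)) ∧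
      ∀ᶠ z in 𝓝 z₀, ∀ j k, (A z * P z) k (σ (Sum.inr j)) = 0 := by
  classical
  set A' : Matrix (Fin p) (Fin q) (analyticGerm z₀) := fun i j => mk _ (hA i j)
  have hA' : ∀ᶠ z in 𝓝 z₀, (A'.map fun x => rep x z) = A z := by
    have := eventually_all.2 fun i => eventually_all.2 fun j => rep_mk (hA i j)
    filter_upwards [this] with z hz
    ext i j
    exact hz i j
  -- Identities between germs hold for the chosen representatives only on a neighbourhood of `z₀`.
  have hone : ∀ {l : ℕ} {B B' : Matrix (Fin l) (Fin l) (analyticGerm z₀)}, B' * B = 1 →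
      ∀ᶠ z in 𝓝 z₀, (B'.map fun x => rep x z) * (B.map fun x => rep x z) = 1 := by
    intro l B B' h
    have h1 := eventually_all.2 fun i => eventually_all.2 fun j =>
      (rep_mul_eventuallyEq (A := B') (B := B) i j).trans
        (rep_congr (x := (B' * B) i j) (f := fun _ => if i = j then 1 else 0) analyticAt_const (by
          rw [h, Matrix.one_apply]
          split_ifs <;> rfl))
    filter_upwards [h1] with z hz
    ext i j
    rw [hz i j, Matrix.one_apply]
  obtain ⟨r, t, σ, f, P, P', Q, Q', d, hP, hQ, hd, hinl, hinr⟩ := A'.exists_smith_normal_form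
  refine ⟨r, t, σ, f, fun z => P.map fun x => rep x z, fun z => P'.map fun x => rep x z,
    fun z => Q.map fun x => rep x z, fun z => Q'.map fun x => rep x z, fun i => rep (d i),
    fun i j => analyticAt_rep _, fun i j => analyticAt_rep _, fun i => analyticAt_rep _,
    hone hP, hone hQ, fun i => ?_, ?_, ?_⟩
  · refine (mk_ne_zero_iff (hf := analyticAt_rep (d i))).1 ?_
    intro h
    exact hd i ((exists_mk (d i)).choose_spec.choose_spec.symm.trans h)
  · have h1 := eventually_all.2 fun i => eventually_all.2 fun k =>
      (rep_mul_eventuallyEq (A := A') (B := P) k (σ (Sum.inl i))).trans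
        (rep_congr (f := fun z => rep (d i) z * rep (Q k (f i)) z)
          ((analyticAt_rep _).fun_mul (analyticAt_rep _)) (by
            rw [hinl]
            conv_lhs => rw [← (exists_mk (d i)).choose_spec.choose_spec,
              ← (exists_mk (Q k (f i))).choose_spec.choose_spec]
            rfl))
    filter_upwards [h1, hA'] with z hz hz' i k
    rw [← hz', hz i k]
    rfl
  · have h1 := eventually_all.2 fun j => eventually_all.2 fun k =>
      (rep_mul_eventuallyEq (A := A') (B := P) k (σ (Sum.inr j))).trans
        (rep_congr (f := fun z => 0) analyticAt_const (by rw [hinr]; rfl))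
    filter_upwards [h1, hA'] with z hz hz' j k
    rw [← hz', hz j k]

/-! ### Weights of parabolic structures -/

namespace ParabolicStructure

variable {M : Type*} [AddCommGroup M] [Module ℂ M]

theorem finrank_comap_subtype (N F : Submodule ℂ M) :
    finrank ℂ (F.comap N.subtype) = finrank ℂ (N ⊓ F : Submodule ℂ M) := by
  rw [← Submodule.finrank_map_subtype_eq N (F.comap N.subtype), Submodule.map_comap_subtype]

theorem HasType.exists_eq_of_mult_pos {P : ParabolicStructure M} {n : ℕ} {α : Fin n → ℝ}
    (h : P.HasType α) {c : ℝ} (hc : 0 < P.mult c) :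
    ∃ i, α i = c := by
  rw [h.2, Finset.card_pos] at hc
  obtain ⟨i, hi⟩ := hc
  exact ⟨i, by simpa using hi⟩

variable [FiniteDimensional ℂ M] (P : ParabolicStructure M)

/-- The dimensions to the right of `c` are bounded integers; where they attain their maximum, the
directed union has become stationary. -/
theorem exists_filGT_eq (c : ℝ) : ∃ b₀ > c, ∀ b, c < b → b ≤ b₀ → P.filGT c = P.fil b := by
  classical
  obtain ⟨b₀, hb₀, hmax⟩ : ∃ b₀ > c, ∀ b > c, finrank ℂ (P.fil b) ≤ finrank ℂ (P.fil b₀) := by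
    set S : Set ℕ := (fun b => finrank ℂ (P.fil b)) '' Set.Ioi c
    have hne : S.Nonempty := ⟨_, c + 1, by simp, rfl⟩
    have hbdd : BddAbove S := ⟨finrank ℂ M, by
      rintro _ ⟨b, -, rfl⟩
      exact Submodule.finrank_le _⟩
    obtain ⟨b₀, hb₀, h⟩ := Nat.sSup_mem hne hbdd
    refine ⟨b₀, hb₀, fun b hb => ?_⟩
    have h' : finrank ℂ (P.fil b₀) = sSup S := h
    rw [h']
    exact le_csSup hbdd ⟨b, hb, rfl⟩
  refine ⟨b₀, hb₀, fun b hb hbb₀ => le_antisymm (iSup_le fun b' => ?_)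
    (le_iSup (fun b : Set.Ioi c => P.fil b) ⟨b, hb⟩)⟩
  have key : ∀ b' > c, b' ≤ b₀ → P.fil b₀ = P.fil b' := fun b' hb' hle =>
    Submodule.eq_of_le_of_finrank_le (P.antitone hle) (hmax b' hb')
  rw [← key b hb hbb₀]
  rcases le_total (b' : ℝ) b₀ with h | h
  · exact (key b' b'.2 h).ge
  · exact P.antitone h

/-- The weights of a parabolic structure. -/
theorem exists_weights : ∃ τ : Fin (finrank ℂ M) → ℝ,
    (∀ c, finrank ℂ (P.fil c) = (Finset.univ.filter fun i => c ≤ τ i).card) ∧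
    (∀ c, finrank ℂ (P.filGT c) = (Finset.univ.filter fun i => c < τ i).card) ∧
    ∀ c, P.mult c = (Finset.univ.filter fun i => τ i = c).card := by
  classical
  -- The suprema of these sets are the weights in decreasing order; left continuity of the
  -- filtration makes each supremum a member of its set.
  set T : Fin (finrank ℂ M) → Set ℝ := fun i => {c | (i : ℕ) < finrank ℂ (P.fil c)}
  have hbdd : ∀ i, BddAbove (T i) := fun i => ⟨1, fun c hc => by
    by_contra! h
    have h1 : P.fil c ≤ P.fil 1 := P.antitone h.le
    rw [P.fil_one, le_bot_iff] at h1
    have hc' : (i : ℕ) < finrank ℂ (P.fil c) := hc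
    rw [h1, finrank_bot] at hc'
    exact Nat.not_lt_zero _ hc'⟩
  have hne : ∀ i, (T i).Nonempty := fun i => ⟨0, by
    change (i : ℕ) < finrank ℂ (P.fil 0)
    rw [P.fil_zero, finrank_top]
    exact i.2⟩
  have hanti : ∀ {c c' : ℝ}, c ≤ c' → finrank ℂ (P.fil c') ≤ finrank ℂ (P.fil c) := fun h =>
    Submodule.finrank_mono (P.antitone h)
  have hlt : ∀ i c, c < sSup (T i) → (i : ℕ) < finrank ℂ (P.fil c) := fun i c hc => by
    obtain ⟨c', hc', h⟩ := exists_lt_of_lt_csSup (hne i) hc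
    exact lt_of_lt_of_le hc' (hanti h.le)
  have hle : ∀ i c, c ≤ sSup (T i) ↔ (i : ℕ) < finrank ℂ (P.fil c) := fun i c => by
    refine ⟨fun h => ?_, fun h => le_csSup (hbdd i) h⟩
    obtain ⟨e, he, hfe⟩ := P.left_cont c
    rw [← hfe]
    exact hlt i _ (by linarith)
  have hgt : ∀ i c, c < sSup (T i) ↔ (i : ℕ) < finrank ℂ (P.filGT c) := fun i c => by
    obtain ⟨b₀, hb₀, hb⟩ := P.exists_filGT_eq c
    constructor
    · intro h
      rw [hb (min b₀ (sSup (T i))) (lt_min hb₀ h) (min_le_left _ _), ← hle]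
      exact min_le_right _ _
    · intro h
      rw [hb b₀ hb₀ le_rfl, ← hle] at h
      exact hb₀.trans_le h
  have hcard : ∀ N : Submodule ℂ M, (Finset.univ.filter fun i : Fin (finrank ℂ M) =>
      (i : ℕ) < finrank ℂ N).card = finrank ℂ N := fun N => by
    rw [Fin.card_filter_val_lt]
    exact min_eq_right (Submodule.finrank_le N)
  have h1 : ∀ c, finrank ℂ (P.fil c) = (Finset.univ.filter fun i => c ≤ sSup (T i)).card :=
    fun c => by simp only [hle, hcard]
  have h2 : ∀ c, finrank ℂ (P.filGT c) = (Finset.univ.filter fun i => c < sSup (T i)).card :=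
    fun c => by simp only [hgt, hcard]
  refine ⟨fun i => sSup (T i), h1, h2, fun c => ?_⟩
  rw [mult, h1, h2]
  have h3 : (Finset.univ.filter fun i => c ≤ sSup (T i)) =
      (Finset.univ.filter fun i => sSup (T i) = c) ∪
        Finset.univ.filter fun i => c < sSup (T i) := by
    ext i
    simp only [Finset.mem_filter, Finset.mem_univ, true_and, Finset.mem_union, le_iff_eq_or_lt,
      eq_comm (a := c)]
  rw [h3, Finset.card_union_of_disjoint, Nat.add_sub_cancel]
  rw [Finset.disjoint_filter]
  intro i _ h
  exact h.le.not_gt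

/-- With `G ⊆ F` the two steps of the filtration around `c`, the quotient `(N ∩ F) / (N ∩ G)` embeds
into `F / G`. -/
theorem mult_induced_le (N : Submodule ℂ M) (c : ℝ) : (P.induced N).mult c ≤ P.mult c := by
  obtain ⟨b₁, hb₁, h₁⟩ := P.exists_filGT_eq c
  obtain ⟨b₂, hb₂, h₂⟩ := (P.induced N).exists_filGT_eq c
  have hb : c < min b₁ b₂ := lt_min hb₁ hb₂
  rw [mult, mult, h₁ _ hb (min_le_left _ _), h₂ _ hb (min_le_right _ _)]
  change finrank ℂ ((P.fil c).comap N.subtype) - finrank ℂ ((P.fil _).comap N.subtype) ≤ _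
  rw [finrank_comap_subtype, finrank_comap_subtype]
  set F := P.fil c
  set G := P.fil (min b₁ b₂)
  have hGF : G ≤ F := P.antitone hb.le
  have h3 := Submodule.finrank_sup_add_finrank_inf_eq (N ⊓ F) G
  have h4 : N ⊓ F ⊓ G = N ⊓ G := by rw [inf_assoc, inf_eq_right.2 hGF]
  have h5 : finrank ℂ (N ⊓ F ⊔ G : Submodule ℂ M) ≤ finrank ℂ F :=
    Submodule.finrank_mono (sup_le inf_le_right hGF)
  rw [h4] at h3
  omega

variable {P} {n : ℕ} {α : Fin n → ℝ}

theorem HasType.fil_eq_top (h : P.HasType α) {c : ℝ} (hc : ∀ i, c ≤ α i) : P.fil c = ⊤ := by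
  obtain ⟨τ, h1, -, h3⟩ := P.exists_weights
  refine Submodule.eq_top_of_finrank_eq ?_
  rw [h1, Finset.filter_true_of_mem, Finset.card_univ, Fintype.card_fin]
  intro i _
  obtain ⟨j, hj⟩ := h.exists_eq_of_mult_pos (c := τ i) (by
    rw [h3]; exact Finset.card_pos.2 ⟨i, by simp⟩)
  rw [← hj]
  exact hc j

theorem HasType.filGT_eq_bot (h : P.HasType α) {c : ℝ} (hc : ∀ i, α i ≤ c) : P.filGT c = ⊥ := by
  obtain ⟨τ, -, h2, h3⟩ := P.exists_weights
  refine Submodule.finrank_eq_zero.1 ?_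
  rw [h2, Finset.card_eq_zero, Finset.filter_eq_empty_iff]
  intro i _
  obtain ⟨j, hj⟩ := h.exists_eq_of_mult_pos (c := τ i) (by
    rw [h3]; exact Finset.card_pos.2 ⟨i, by simp⟩)
  rw [← hj, not_lt]
  exact hc j

/-- The weight and the dimension as sums over the jumps of an ambient structure. -/
theorem HasType.weight_eq_sum {L M' : Type*} [AddCommGroup L] [Module ℂ L]
    {P : ParabolicStructure L} [AddCommGroup M'] [Module ℂ M'] [FiniteDimensional ℂ M'] {P' : ParabolicStructure M'} (h : P.HasType α)
    (hle : ∀ c, P'.mult c ≤ P.mult c) :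
    P'.weight = ∑ c ∈ Finset.univ.image α, (P'.mult c : ℝ) * c ∧
      (finrank ℂ M' : ℝ) = ∑ c ∈ Finset.univ.image α, (P'.mult c : ℝ) := by
  classical
  have hsupp : ∀ c, P'.mult c ≠ 0 → c ∈ Finset.univ.image α := fun c hc => by
    obtain ⟨i, hi⟩ := h.exists_eq_of_mult_pos
      (lt_of_lt_of_le (Nat.pos_of_ne_zero hc) (hle c))
    exact Finset.mem_image.2 ⟨i, Finset.mem_univ i, hi⟩
  constructor
  · refine finsum_eq_sum_of_support_subset _ fun c hc => ?_
    refine hsupp c fun h0 => ?_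
    simp [h0] at hc
  · obtain ⟨τ, -, -, h3⟩ := P'.exists_weights
    have := Finset.card_eq_sum_card_fiberwise (f := τ) (s := Finset.univ)
      (t := Finset.univ.image α) (fun i _ => hsupp _ (by
        rw [h3]; exact (Finset.card_pos.2 ⟨i, by simp⟩).ne'))
    rw [Finset.card_univ, Fintype.card_fin] at this
    rw [this]
    push_cast
    exact Finset.sum_congr rfl fun c _ => by rw [h3]

/-- Every weight of the induced structure is a weight of the ambient one, and there are `finrank N`
of them. -/
theorem HasType.le_weight_induced (h : P.HasType α) {c : ℝ} (hc : ∀ i, c ≤ α i)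
    (N : Submodule ℂ M) : c * finrank ℂ N ≤ (P.induced N).weight := by
  obtain ⟨h1, h2⟩ := h.weight_eq_sum (P.mult_induced_le N)
  rw [h1, h2, Finset.mul_sum]
  refine Finset.sum_le_sum fun x hx => ?_
  obtain ⟨i, -, rfl⟩ := Finset.mem_image.1 hx
  rw [mul_comm]
  exact mul_le_mul_of_nonneg_left (hc i) (Nat.cast_nonneg _)

/-- The weights not used by `N` have nonnegative multiplicities `P.mult c - (P.induced N).mult c`
with total `finrank M - finrank N`. -/
theorem HasType.weight_sub_weight_induced_le (h : P.HasType α) {c : ℝ} (hc : ∀ i, α i ≤ c)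
    (N : Submodule ℂ M) :
    P.weight - (P.induced N).weight ≤ c * (finrank ℂ M - finrank ℂ N) := by
  obtain ⟨h1, h2⟩ := h.weight_eq_sum (P.mult_induced_le N)
  obtain ⟨h3, h4⟩ := h.weight_eq_sum (P' := P) fun _ => le_rfl
  rw [h1, h2, h3, h4, ← Finset.sum_sub_distrib, ← Finset.sum_sub_distrib, Finset.mul_sum]
  refine Finset.sum_le_sum fun x hx => ?_
  obtain ⟨i, -, rfl⟩ := Finset.mem_image.1 hx
  rw [← sub_mul, mul_comm]
  refine mul_le_mul_of_nonneg_right (hc i) (sub_nonneg.2 ?_)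
  exact_mod_cast P.mult_induced_le N _

end ParabolicStructure

/-! ### Vector fields on the Riemann sphere -/

namespace RiemannSphere

instance : IsManifold 𝓘(ℂ) 1 (OnePoint ℂ) := IsManifold.of_le (n := ω) le_top

/-- The coordinate of a tangent vector at `y` in the chart at `a`. -/
noncomputable def tangentCoord (a y : OnePoint ℂ) : TangentSpace 𝓘(ℂ) y →ₗ[ℂ] ℂ :=
  (trivializationAt ℂ (TangentSpace 𝓘(ℂ)) a).linearMapAt ℂ y

/-- The coordinate vector field of the chart at `a`. -/
noncomputable def coordField (a y : OnePoint ℂ) : TangentSpace 𝓘(ℂ) y :=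
  (trivializationAt ℂ (TangentSpace 𝓘(ℂ)) a).symmₗ ℂ y (1 : ℂ)

theorem tangentCoord_smul_coordField {a y : OnePoint ℂ} (hy : y ∈ (chartAt ℂ a).source)
    (X : TangentSpace 𝓘(ℂ) y) : tangentCoord a y X • coordField a y = X := by
  rw [coordField, ← map_smul, smul_eq_mul, mul_one]
  exact (trivializationAt ℂ (TangentSpace 𝓘(ℂ)) a).symmₗ_linearMapAt hy X

theorem tangentCoord_coordField {a y : OnePoint ℂ} (hy : y ∈ (chartAt ℂ a).source) :
    tangentCoord a y (coordField a y) = 1 :=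
  (trivializationAt ℂ (TangentSpace 𝓘(ℂ)) a).linearMapAt_symmₗ hy 1

theorem holVectorFieldAt_smul_coordField {a : OnePoint ℂ} {f : OnePoint ℂ → ℂ} (hf : Hol f a) :
    HolVectorFieldAt (fun y => f y • coordField a y) a := by
  refine (contMDiffAt_section (F := ℂ) (E := TangentSpace 𝓘(ℂ)) (IB := 𝓘(ℂ)) a).2 ?_
  refine ContMDiffAt.congr_of_eventuallyEq hf ?_
  filter_upwards [(chartAt ℂ a).open_source.mem_nhds (mem_chart_source ℂ a)] with y hy
  have h1 : tangentCoord a y (f y • coordField a y) = f y := by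
    rw [map_smul, tangentCoord_coordField hy, smul_eq_mul, mul_one]
  rw [tangentCoord, Trivialization.coe_linearMapAt_of_mem _ hy] at h1
  exact h1

/-- The vector field `∂ / ∂z`, which has a double zero at infinity. -/
noncomputable def translationField (y : OnePoint ℂ) : TangentSpace 𝓘(ℂ) y :=
  y.elim (0 : ℂ) fun _ => (1 : ℂ)

theorem tangentCoord_apply {a y : OnePoint ℂ} (hy : y ∈ (chartAt ℂ a).source)
    (X : TangentSpace 𝓘(ℂ) y) :
    tangentCoord a y X = fderiv ℂ (fun z => chartAt ℂ a ((chartAt ℂ y).symm z)) (chartAt ℂ y y) X := by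
  rw [tangentCoord, Trivialization.coe_linearMapAt_of_mem _ hy]
  simp only [TangentBundle.trivializationAt_apply]
  simp only [mfld_simps, fderivWithin_univ]
  rfl

theorem tangentCoord_coe_translationField (z w : ℂ) :
    tangentCoord (z : OnePoint ℂ) w (translationField w) = 1 := by
  rw [tangentCoord_apply (by simp [chartAt_coe, affineChart_source])]
  simp only [chartAt_coe, affineChart_symm_apply, affineChart_coe]
  rw [fderiv_fun_id]
  rfl

theorem tangentCoord_infty_translationField {w : ℂ} (hw : w ≠ 0) :
    tangentCoord ∞ (w : OnePoint ℂ) (translationField w) = -(w⁻¹) ^ 2 := by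
  rw [tangentCoord_apply (by simpa [chartAt_infty, inftyChart_source] using hw)]
  simp only [chartAt_coe, affineChart_symm_apply, affineChart_coe, chartAt_infty]
  have h1 : (fun z : ℂ => inftyChart (z : OnePoint ℂ)) =ᶠ[𝓝 w] fun z => z⁻¹ := by
    filter_upwards [isOpen_ne.mem_nhds hw] with z hz
    exact inftyChart_coe hz
  rw [h1.fderiv_eq]
  have h2 := (hasDerivAt_inv hw).hasFDerivAt.fderiv
  rw [h2]
  change (ContinuousLinearMap.toSpanSingleton ℂ (-(w ^ 2)⁻¹)) (1 : ℂ) = _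
  simp

/-- The divisor of this vector field is twice the point `∞`; this is how `deg K = -2` enters. -/
theorem hasOrderAt_translationField (a : OnePoint ℂ) :
    HasOrderAt (fun y => tangentCoord a y (translationField y)) a
      (Finsupp.single (∞ : OnePoint ℂ) (2 : ℤ) a) := by
  induction a using OnePoint.rec with
  | coe z =>
    rw [Finsupp.single_eq_of_ne (by simp)]
    refine (HasOrderAt.of_hol (hol_const (1 : ℂ)) one_ne_zero).congr
      (eventually_nhdsWithin_of_eventually_nhds ?_)
    rw [OnePoint.nhds_coe_eq, eventually_map]
    exact Eventually.of_forall fun w => (tangentCoord_coe_translationField z w).symm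
  | infty =>
    rw [Finsupp.single_eq_same]
    have h1 := (HasOrderAt.of_hol (hol_const (-1 : ℂ) (a := ∞)) (by simp)).mul
      (hasOrderAt_inv_coord_infty.pow 2)
    norm_num at h1
    refine h1.congr ?_
    have hev : ∀ᶠ y : OnePoint ℂ in 𝓝[≠] ∞, ∃ z : ℂ, y = (z : OnePoint ℂ) ∧ z ≠ 0 := by
      rw [OnePoint.nhdsNE_infty_eq, eventually_map, coclosedCompact_eq_cocompact]
      filter_upwards [(isCompact_singleton (x := (0 : ℂ))).compl_mem_cocompact] with z hz
      exact ⟨z, rfl, hz⟩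
    filter_upwards [hev] with y hy
    obtain ⟨z, rfl, hz⟩ := hy
    rw [tangentCoord_infty_translationField hz]
    simp [linearCoord]

end RiemannSphere

/-! ### The local normal form of a Higgs field -/

namespace ParabolicBundle

variable {s : ℕ} {x : Fin s → OnePoint ℂ} {q p : ℕ} {E : ParabolicBundle x q}
  {F : ParabolicBundle x p}

namespace HiggsHom

theorem eventually_notMem_range (a : OnePoint ℂ) : ∀ᶠ y in 𝓝[≠] a, y ∉ Set.range x := by
  have h : (Set.range x \ {a})ᶜ ∈ 𝓝 a :=
    ((Set.finite_range x).subset Set.sdiff_subset).isClosed.isOpen_compl.mem_nhds (by simp)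
  filter_upwards [mem_nhdsWithin_of_mem_nhds h, self_mem_nhdsWithin] with y hy hya hyx
  exact hy ⟨hyx, hya⟩

/-- If the weights force the residues to vanish, then the contraction with a coordinate vector
field extends holomorphically over the punctures. -/
theorem exists_extension (θ : HiggsHom E F)
    (hres : ∀ j, ∃ c, (E.par j).fil c = ⊤ ∧ (F.par j).filGT c = ⊥) {a : OnePoint ℂ}
    {u : ∀ y, E.Fib y} (hu : E.HolAt u a) :
    ∃ v, F.HolAt v a ∧
      ∀ᶠ y in 𝓝 a, y ∉ Set.range x → v y = θ.toFun y (coordField a y) (u y) := by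
  by_cases ha : a ∈ Set.range x
  · obtain ⟨j, rfl⟩ := ha
    set a := x j
    obtain ⟨c, hc1, hc2⟩ := hres j
    -- Contraction with the vanishing field `T • ∂` extends over the puncture, and the weights force
    -- its value there into `⊥`. Being zero at `a`, the extension can be divided by `T`, which
    -- `dslope` does in coordinates.
    set T : OnePoint ℂ → ℂ := fun y => chartAt ℂ a y - chartAt ℂ a a
    have hT : Hol T a := by
      rw [hol_iff]
      simp only [T, chart_apply_symm]
      fun_prop
    obtain ⟨v, hv1, hv2, hv3⟩ := θ.parabolic j (fun y => T y • coordField a y)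
      (holVectorFieldAt_smul_coordField hT) (by simp [T, a]) u hu
    have hva : v a = 0 := by
      have := hv3 c (by rw [hc1]; trivial)
      rwa [hc2, Submodule.mem_bot] at this
    set f : ℂ → Fin p → ℂ := fun z => F.coord a ((chartAt ℂ a).symm z) (v ((chartAt ℂ a).symm z))
    have hf : AnalyticAt ℂ f (chartAt ℂ a a) :=
      hol_iff.1 ((HolVectorBundle.holAt_iff (F.mem_base_self a)).1 hv1)
    have hf0 : f (chartAt ℂ a a) = 0 := by
      have key : ∀ b, b = a → F.coord a b (v b) = 0 := by
        rintro b rfl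
        rw [hva, map_zero]
      exact key _ (chart_symm_self a)
    have hds : AnalyticAt ℂ (dslope f (chartAt ℂ a a)) (chartAt ℂ a a) := by
      obtain ⟨P, hP⟩ := hf
      exact ⟨_, hP.has_fpower_series_dslope_fslope⟩
    refine ⟨fun y => F.lift a y (dslope f (chartAt ℂ a a) (chartAt ℂ a y)),
      HolVectorBundle.holAt_lift (F.mem_base_self a) ?_, ?_⟩
    · rw [hol_iff]
      simpa only [chart_apply_symm] using hds
    · rw [eventually_nhdsWithin_iff] at hv2
      filter_upwards [hv2, F.base_mem_nhds a,
        (chartAt ℂ a).open_source.mem_nhds (mem_chart_source ℂ a)] with y hy hyb hys hyx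
      have hya : y ≠ a := fun h => hyx ⟨j, h.symm⟩
      have hne : chartAt ℂ a y ≠ chartAt ℂ a a := fun h =>
        hya ((chartAt ℂ a).injOn hys (mem_chart_source ℂ a) h)
      have hfy : f (chartAt ℂ a y) = F.coord a y (v y) := by
        simp only [f]
        rw [(chartAt ℂ a).left_inv hys]
      rw [dslope_of_ne _ hne, slope_def_module, hf0, sub_zero, hfy, map_smul,
        HolVectorBundle.lift_coord hyb, hy hya, map_smul, LinearMap.smul_apply, smul_smul,
        inv_mul_cancel₀ (sub_ne_zero.2 hne), one_smul]
  · refine ⟨fun y => θ.toFun y (coordField a y) (u y), ?_, Eventually.of_forall fun y _ => rfl⟩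
    have := θ.holomorphic a ha _ (holVectorFieldAt_smul_coordField (hol_const (1 : ℂ))) u hu
    simpa only [one_smul] using this

/-- Near `a`, in the frame `v` the one-form `θ` is diagonal with image in the span of `u`. -/
structure NormalForm (θ : HiggsHom E F) (a : OnePoint ℂ) {r t : ℕ} (σ : Fin r ⊕ Fin t ≃ Fin q) where
  /-- The frame of the source. -/
  v : Fin q → ∀ y, E.Fib y
  /-- The frame of the saturation of the image. -/
  u : Fin r → ∀ y, F.Fib y
  /-- The diagonal entries. -/
  d : Fin r → OnePoint ℂ → ℂ
  frame : E.IsFrameAt E.full v a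
  hol_u : ∀ i, F.HolAt (u i) a
  indep_u : ∀ᶠ y in 𝓝 a, LinearIndependent ℂ fun i => u i y
  hol_d : ∀ i, Hol (d i) a
  d_ne : ∀ i, ∀ᶠ y in 𝓝[≠] a, d i y ≠ 0
  apply_inl : ∀ᶠ y in 𝓝 a, y ∉ Set.range x → ∀ X i,
    θ.toFun y X (v (σ (Sum.inl i)) y) = (tangentCoord a y X * d i y) • u i y
  apply_inr : ∀ᶠ y in 𝓝 a, y ∉ Set.range x → ∀ X j, θ.toFun y X (v (σ (Sum.inr j)) y) = 0

theorem _root_.HolVectorBundle.frame_of_mul_eq_one {n : ℕ} {E : HolVectorBundle n}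
    {a y : OnePoint ℂ} (hy : y ∈ E.base a) {P P' : Matrix (Fin n) (Fin n) ℂ} (h : P' * P = 1) :
    LinearIndependent ℂ (fun j => E.lift a y (fun i => P i j)) ∧
      Submodule.span ℂ (Set.range fun j => E.lift a y (fun i => P i j)) = ⊤ := by
  have h1 : LinearIndependent ℂ (fun j => E.lift a y (fun i => P i j)) := by
    have hP : LinearIndependent ℂ P.col :=
      Matrix.linearIndependent_cols_iff_isUnit.2 (IsUnit.of_mul_eq_one_right _ h)
    exact hP.map' (E.lift a y)
      (LinearMap.ker_eq_bot.2 (HolVectorBundle.coordEquiv hy).symm.injective)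
  refine ⟨h1, h1.span_eq_top_of_card_eq_finrank' ?_⟩
  rw [HolVectorBundle.finrank_fib, Fintype.card_fin]

/-- By `exists_extension` the matrix of θ contracted with the coordinate field is holomorphic even
at a puncture, so the analytic normal form applies. The selected columns of the invertible matrix
`Q` stay independent where diagonal entries vanish, so they frame the saturation of the image. -/
theorem exists_normalForm (θ : HiggsHom E F)
    (hres : ∀ j, ∃ c, (E.par j).fil c = ⊤ ∧ (F.par j).filGT c = ⊥) (a : OnePoint ℂ) :
    ∃ (r t : ℕ) (σ : Fin r ⊕ Fin t ≃ Fin q), Nonempty (θ.NormalForm a σ) := by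
  classical
  choose w hw1 hw2 using fun i : Fin q => θ.exists_extension hres (a := a)
    (u := fun y => E.lift a y (Pi.single i 1))
    (HolVectorBundle.holAt_lift (E.mem_base_self a) (hol_const _))
  set z₀ := chartAt ℂ a a
  set A : ℂ → Matrix (Fin p) (Fin q) ℂ := fun z k i =>
    F.coord a ((chartAt ℂ a).symm z) (w i ((chartAt ℂ a).symm z)) k
  have hA : ∀ k i, AnalyticAt ℂ (fun z => A z k i) z₀ := fun k i =>
    hol_iff.1 (hol_pi_iff.1 ((HolVectorBundle.holAt_iff (F.mem_base_self a)).1 (hw1 i)) k)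
  obtain ⟨r, t, σ, f, P, P', Q, Q', d, hP, hQ, hd, hPP, hQQ, hd0, hinl, hinr⟩ :=
    exists_analytic_normal_form hA
  have htend : Tendsto (chartAt ℂ a) (𝓝 a) (𝓝 z₀) :=
    (chartAt ℂ a).continuousAt (mem_chart_source ℂ a)
  have hsrc : ∀ᶠ y in 𝓝 a, y ∈ (chartAt ℂ a).source :=
    (chartAt ℂ a).open_source.mem_nhds (mem_chart_source ℂ a)
  have hθ : ∀ᶠ y in 𝓝 a, y ∉ Set.range x → ∀ X (c : Fin q → ℂ),
      θ.toFun y X (E.lift a y c) =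
        tangentCoord a y X • F.lift a y ((A (chartAt ℂ a y)).mulVec c) := by
    filter_upwards [eventually_all.2 hw2, hsrc, F.base_mem_nhds a] with y hy hys hyb hyx X c
    have hAy : ∀ i, F.lift a y (fun k => A (chartAt ℂ a y) k i) = w i y := fun i => by
      have : (fun k => A (chartAt ℂ a y) k i) = F.coord a y (w i y) := by
        simp only [A]
        rw [(chartAt ℂ a).left_inv hys]
      rw [this, HolVectorBundle.lift_coord hyb]
    have hc : c = ∑ i, c i • (Pi.single i (1 : ℂ) : Fin q → ℂ) := by
      ext k
      simp [Finset.sum_apply, Pi.single_apply]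
    have hmul : (A (chartAt ℂ a y)).mulVec c =
        ∑ i, c i • ((fun k => A (chartAt ℂ a y) k i) : Fin p → ℂ) := by
      ext k
      simp [Matrix.mulVec, dotProduct, Finset.sum_apply, mul_comm]
    rw [hmul, ← tangentCoord_smul_coordField hys X, map_smul, map_smul, LinearMap.smul_apply,
      tangentCoord_coordField hys, smul_eq_mul, mul_one]
    congr 1
    conv_lhs => rw [hc]
    simp only [map_smul, map_sum, hAy]
    refine Finset.sum_congr rfl fun i _ => ?_
    rw [hy i hyx]
  refine ⟨r, t, σ, ⟨{
    v := fun j y => E.lift a y (fun i => P (chartAt ℂ a y) i j)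
    u := fun j y => F.lift a y (fun i => Q (chartAt ℂ a y) i (f j))
    d := fun i y => d i (chartAt ℂ a y)
    frame := ⟨fun j => HolVectorBundle.holAt_lift (E.mem_base_self a) (hol_pi_iff.2 fun i => ?_), ?_⟩
    hol_u := fun j => HolVectorBundle.holAt_lift (F.mem_base_self a) (hol_pi_iff.2 fun i => ?_)
    indep_u := ?_
    hol_d := fun i => ?_
    d_ne := fun i => ?_
    apply_inl := ?_
    apply_inr := ?_ }⟩⟩
  · rw [hol_iff]
    simpa only [chart_apply_symm] using hP i j
  · filter_upwards [htend.eventually hPP, E.base_mem_nhds a] with y hy hyb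
    exact HolVectorBundle.frame_of_mul_eq_one hyb hy
  · rw [hol_iff]
    simpa only [chart_apply_symm] using hQ i (f j)
  · filter_upwards [htend.eventually hQQ, F.base_mem_nhds a] with y hy hyb
    exact (HolVectorBundle.frame_of_mul_eq_one hyb hy).1.comp f f.injective
  · rw [hol_iff]
    simpa only [chart_apply_symm] using hd i
  · rw [← eventually_chart_symm_nhdsNE]
    simpa only [chart_apply_symm] using hd0 i
  · filter_upwards [hθ, htend.eventually hinl] with y hy hyi hyx X i
    have h1 : (A (chartAt ℂ a y)).mulVec (fun k => P (chartAt ℂ a y) k (σ (Sum.inl i))) =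
        d i (chartAt ℂ a y) • fun k => Q (chartAt ℂ a y) k (f i) := by
      ext k
      exact hyi i k
    rw [hy hyx, h1, map_smul, smul_smul]
  · filter_upwards [hθ, htend.eventually hinr] with y hy hyi hyx X j
    have h1 : (A (chartAt ℂ a y)).mulVec (fun k => P (chartAt ℂ a y) k (σ (Sum.inr j))) = 0 := by
      ext k
      exact hyi j k
    rw [hy hyx, h1, map_zero, smul_zero]

/-- The adapted frame can be permuted. -/
def NormalForm.reindex {θ : HiggsHom E F} {a : OnePoint ℂ} {r t : ℕ}
    {σ : Fin r ⊕ Fin t ≃ Fin q} (D : θ.NormalForm a σ) (σ' : Fin r ⊕ Fin t ≃ Fin q) :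
    θ.NormalForm a σ' where
  v i := D.v (σ (σ'.symm i))
  u := D.u
  d := D.d
  frame := ⟨fun i => D.frame.1 _, by
    filter_upwards [D.frame.2] with y hy
    refine ⟨hy.1.comp _ (σ'.symm.trans σ).injective, ?_⟩
    rw [← hy.2, ← (σ'.symm.trans σ).surjective.range_comp (fun i => D.v i y)]
    rfl⟩
  hol_u := D.hol_u
  indep_u := D.indep_u
  hol_d := D.hol_d
  d_ne := D.d_ne
  apply_inl := by simpa using D.apply_inl
  apply_inr := by simpa using D.apply_inr

end HiggsHom

end ParabolicBundle

/-! ### Linear maps and alternating forms in adapted frames -/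

section LinearAlgebra

variable {V U : Type*} [AddCommGroup V] [Module ℂ V] [AddCommGroup U] [Module ℂ U]

theorem AlternatingMap.map_sum_smul {ι : Type*} [Fintype ι] [DecidableEq ι]
    (w : V [⋀^ι]→ₗ[ℂ] ℂ) (s : ι → V) (M : Matrix ι ι ℂ) :
    w (fun i => ∑ k, M k i • s k) = M.det * w s := by
  have h := congrArg (fun f => f fun i k => M k i)
    ((w.compLinearMap (Fintype.linearCombination ℂ s)).eq_smul_basis_det (Pi.basisFun ℂ ι))
  have hs : (fun i => Fintype.linearCombination ℂ s (Pi.basisFun ℂ ι i)) = s := by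
    ext i
    simp [Fintype.linearCombination_apply_single]
  have hdet : (Pi.basisFun ℂ ι).det (fun i k => M k i) = M.det := by
    rw [Pi.basisFun_det_apply]
    exact M.det_transpose
  simp only [AlternatingMap.smul_apply, hdet, smul_eq_mul] at h
  rw [AlternatingMap.compLinearMap_apply, AlternatingMap.compLinearMap_apply, hs] at h
  simp only [Fintype.linearCombination_apply] at h
  rw [h, mul_comm]

/-- The quotient of a volume form on the source of `T` by the product of volume forms on the kernel
and the image does not depend on the adapted frame. -/
theorem alternating_adapted_frame {r t q : ℕ} (T : V →ₗ[ℂ] U) (σ : Fin r ⊕ Fin t ≃ Fin q)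
    {v v' : Fin q → V} (hv : Submodule.span ℂ (Set.range v) = ⊤)
    (hT : ∀ j, T (v (σ (Sum.inr j))) = 0)
    (hv' : ∀ j, v' (σ (Sum.inr j)) ∈ Submodule.span ℂ (Set.range fun j => v (σ (Sum.inr j))))
    (wV : V [⋀^Fin q]→ₗ[ℂ] ℂ) (wK : V [⋀^Fin t]→ₗ[ℂ] ℂ) (wI : U [⋀^Fin r]→ₗ[ℂ] ℂ) :
    wV v' * (wK (fun j => v (σ (Sum.inr j))) * wI (fun i => T (v (σ (Sum.inl i))))) =
      wV v * (wK (fun j => v' (σ (Sum.inr j))) * wI (fun i => T (v' (σ (Sum.inl i))))) := by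
  have h1 : ∀ j, ∃ c : Fin t → ℂ, ∑ k, c k • v (σ (Sum.inr k)) = v' (σ (Sum.inr j)) := fun j =>
    (Submodule.mem_span_range_iff_exists_fun ℂ).1 (hv' j)
  have h2 : ∀ i : Fin r, ∃ c : Fin q → ℂ, ∑ k, c k • v k = v' (σ (Sum.inl i)) := fun i =>
    (Submodule.mem_span_range_iff_exists_fun ℂ).1 (by rw [hv]; trivial)
  choose B hB using h1
  choose A hA using h2
  have hA' : ∀ i, v' (σ (Sum.inl i)) = ∑ k, A i (σ (Sum.inl k)) • v (σ (Sum.inl k)) +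
      ∑ k, A i (σ (Sum.inr k)) • v (σ (Sum.inr k)) := fun i => by
    rw [← hA, ← σ.sum_comp, Fintype.sum_sum_type]
  -- The new kernel vectors only involve the old ones, so the change of frame is block triangular.
  -- Its determinant is the product of the determinants on the kernel and on the image, `T` being
  -- blind to kernel components.
  set M : Matrix (Fin r ⊕ Fin t) (Fin r ⊕ Fin t) ℂ :=
    Matrix.fromBlocks (Matrix.of fun k i => A i (σ (Sum.inl k))) 0
      (Matrix.of fun k i => A i (σ (Sum.inr k))) (Matrix.of fun k j => B j k)
  have hw : ∀ z : Fin q → V, wV z = wV.domDomCongr σ.symm (fun k => z (σ k)) := fun z => by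
    rw [AlternatingMap.domDomCongr_apply]
    congr 1
    ext k
    simp
  have e1 : (fun k => v' (σ k)) = fun i => ∑ k, M k i • v (σ k) := by
    ext i
    rcases i with i | j
    · simp [M, Fintype.sum_sum_type, hA']
    · simp [M, Fintype.sum_sum_type, hB]
  have e2 : (fun j => v' (σ (Sum.inr j))) =
      fun j => ∑ k, (Matrix.of fun k j => B j k) k j • v (σ (Sum.inr k)) := by
    ext j
    simp [hB]
  have e3 : (fun i => T (v' (σ (Sum.inl i)))) =
      fun i => ∑ k, (Matrix.of fun k i => A i (σ (Sum.inl k))) k i • T (v (σ (Sum.inl k))) := by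
    ext i
    simp [hA', hT]
  rw [hw v', e1, e2, e3, AlternatingMap.map_sum_smul, AlternatingMap.map_sum_smul wK,
    AlternatingMap.map_sum_smul wI, ← hw v, Matrix.det_fromBlocks_zero₁₂]
  ring

theorem LinearMap.range_le_of_adapted {r t q : ℕ} {T : V →ₗ[ℂ] U} {σ : Fin r ⊕ Fin t ≃ Fin q}
    {v : Fin q → V} (hv : Submodule.span ℂ (Set.range v) = ⊤) {u : Fin r → U} {c : Fin r → ℂ}
    (hl : ∀ i, T (v (σ (Sum.inl i))) = c i • u i) (hr : ∀ j, T (v (σ (Sum.inr j))) = 0) :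
    LinearMap.range T ≤ Submodule.span ℂ (Set.range u) := by
  rw [LinearMap.range_eq_map, ← hv, Submodule.map_span_le]
  rintro _ ⟨k, rfl⟩
  obtain ⟨k | k, rfl⟩ := σ.surjective k
  · rw [hl]
    exact Submodule.smul_mem _ _ (Submodule.subset_span ⟨k, rfl⟩)
  · rw [hr]
    exact Submodule.zero_mem _

theorem LinearMap.range_eq_of_adapted {r t q : ℕ} {T : V →ₗ[ℂ] U} {σ : Fin r ⊕ Fin t ≃ Fin q}
    {v : Fin q → V} (hv : Submodule.span ℂ (Set.range v) = ⊤) {u : Fin r → U} {c : Fin r → ℂ}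
    (hl : ∀ i, T (v (σ (Sum.inl i))) = c i • u i) (hr : ∀ j, T (v (σ (Sum.inr j))) = 0)
    (hc : ∀ i, c i ≠ 0) : LinearMap.range T = Submodule.span ℂ (Set.range u) := by
  refine (LinearMap.range_le_of_adapted hv hl hr).antisymm (Submodule.span_le.2 ?_)
  rintro _ ⟨i, rfl⟩
  exact ⟨(c i)⁻¹ • v (σ (Sum.inl i)), by rw [map_smul, hl, smul_smul, inv_mul_cancel₀ (hc i), one_smul]⟩

theorem LinearMap.ker_eq_of_adapted [FiniteDimensional ℂ V] {r t q : ℕ} {T : V →ₗ[ℂ] U} {σ : Fin r ⊕ Fin t ≃ Fin q}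
    {v : Fin q → V} (hvi : LinearIndependent ℂ v)
    (hv : Submodule.span ℂ (Set.range v) = ⊤) {u : Fin r → U} (hu : LinearIndependent ℂ u)
    {c : Fin r → ℂ}
    (hl : ∀ i, T (v (σ (Sum.inl i))) = c i • u i) (hr : ∀ j, T (v (σ (Sum.inr j))) = 0)
    (hc : ∀ i, c i ≠ 0) :
    LinearMap.ker T = Submodule.span ℂ (Set.range fun j => v (σ (Sum.inr j))) := by
  refine (Submodule.eq_of_le_of_finrank_eq (Submodule.span_le.2 ?_) ?_).symm
  · rintro _ ⟨j, rfl⟩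
    exact hr j
  · have h1 := T.finrank_range_add_finrank_ker
    rw [LinearMap.range_eq_of_adapted hv hl hr hc, finrank_span_eq_card hu] at h1
    have h2 : finrank ℂ V = q := by
      rw [← finrank_top, ← hv, finrank_span_eq_card hvi, Fintype.card_fin]
    have h3 := Fintype.card_congr σ
    simp only [Fintype.card_sum, Fintype.card_fin] at h1 h3
    have h4 : LinearIndependent ℂ fun j : Fin t => v (σ (Sum.inr j)) :=
      hvi.comp _ (σ.injective.comp Sum.inr_injective)
    rw [finrank_span_eq_card h4, Fintype.card_fin]
    omega

end LinearAlgebra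

/-! ### The kernel and the saturated image of a Higgs field -/

instance (a : OnePoint ℂ) : (𝓝[≠] a).NeBot := by
  rw [← chart_symm_self a, ← map_chart_symm_nhdsNE]
  infer_instance

theorem RiemannSphere.tangentCoord_coordField_ne_zero {a y : OnePoint ℂ}
    (hy : y ∈ (chartAt ℂ a).source) : tangentCoord a y (coordField y y) ≠ 0 := fun h0 => by
  have h1 := tangentCoord_smul_coordField hy (coordField y y)
  have h2 := tangentCoord_coordField (mem_chart_source ℂ y)
  rw [h0, zero_smul] at h1
  rw [← h1, map_zero] at h2
  exact zero_ne_one h2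

namespace ParabolicBundle

variable {s : ℕ} {x : Fin s → OnePoint ℂ} {q p : ℕ} {E : ParabolicBundle x q}
  {F : ParabolicBundle x p}

namespace HiggsHom

/-- The contraction of the one-form with a nonzero tangent vector at `y`. -/
noncomputable def fibMap (θ : HiggsHom E F) (y : OnePoint ℂ) : E.Fib y →ₗ[ℂ] F.Fib y :=
  θ.toFun y (coordField y y)

theorem toFun_eq_smul_fibMap (θ : HiggsHom E F) (y : OnePoint ℂ) (X : TangentSpace 𝓘(ℂ) y) :
    θ.toFun y X = tangentCoord y y X • θ.fibMap y := by
  rw [fibMap, ← map_smul, tangentCoord_smul_coordField (mem_chart_source ℂ y)]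

variable {θ : HiggsHom E F} {r t : ℕ} {σ : Fin r ⊕ Fin t ≃ Fin q} {a : OnePoint ℂ}

theorem NormalForm.range_fibMap_le (D : θ.NormalForm a σ) (ha : a ∉ Set.range x) :
    LinearMap.range (θ.fibMap a) ≤ Submodule.span ℂ (Set.range fun i => D.u i a) :=
  LinearMap.range_le_of_adapted D.frame.2.self_of_nhds.2
    (D.apply_inl.self_of_nhds ha _) (D.apply_inr.self_of_nhds ha _)

theorem NormalForm.span_le_ker_fibMap (D : θ.NormalForm a σ) (ha : a ∉ Set.range x) :
    Submodule.span ℂ (Set.range fun j => D.v (σ (Sum.inr j)) a) ≤ LinearMap.ker (θ.fibMap a) := by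
  rw [Submodule.span_le]
  rintro _ ⟨j, rfl⟩
  exact D.apply_inr.self_of_nhds ha _ j

/-- Away from the zeros of the diagonal entries and from the punctures, the adapted frame computes
the actual image and kernel. -/
theorem NormalForm.eventually_fibMap (D : θ.NormalForm a σ) :
    ∀ᶠ y in 𝓝[≠] a,
      LinearMap.range (θ.fibMap y) = Submodule.span ℂ (Set.range fun i => D.u i y) ∧
      LinearMap.ker (θ.fibMap y) =
        Submodule.span ℂ (Set.range fun j => D.v (σ (Sum.inr j)) y) := by
  have hsrc : ∀ᶠ y in 𝓝 a, y ∈ (chartAt ℂ a).source :=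
    (chartAt ℂ a).open_source.mem_nhds (mem_chart_source ℂ a)
  filter_upwards [eventually_all.2 D.d_ne, eventually_notMem_range (x := x) a,
    eventually_nhdsWithin_of_eventually_nhds (hsrc.and (D.frame.2.and (D.indep_u.and
      (D.apply_inl.and D.apply_inr))))] with y hd hyx hall
  obtain ⟨hy, hv, hu, hl, hr⟩ := hall
  have hc := tangentCoord_coordField_ne_zero hy
  have hl' := hl hyx (coordField y y)
  have hr' := hr hyx (coordField y y)
  have hc' : ∀ i, tangentCoord a y (coordField y y) * D.d i y ≠ 0 := fun i =>
    mul_ne_zero hc (hd i)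
  have hker := LinearMap.ker_eq_of_adapted (T := θ.fibMap y) (σ := σ)
    (v := fun i => D.v i y) hv.1 hv.2 (u := fun i => D.u i y) hu hl' hr' hc'
  exact ⟨LinearMap.range_eq_of_adapted (T := θ.fibMap y) hv.2 hl' hr' hc', hker⟩

theorem NormalForm.eventually_finrank (D : θ.NormalForm a σ) :
    ∀ᶠ y in 𝓝[≠] a, finrank ℂ (LinearMap.range (θ.fibMap y)) = r := by
  filter_upwards [D.eventually_fibMap, eventually_nhdsWithin_of_eventually_nhds D.indep_u]
    with y hy hu
  rw [hy.1, finrank_span_eq_card hu, Fintype.card_fin]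

/-- The number `r` of diagonal entries is the rank of θ at all points of a punctured neighbourhood
of `a`. If `y` is near `a`, the points close to `y` are also near `a`, so `r` is locally constant,
and the sphere is connected. -/
theorem exists_uniform_normalForm (θ : HiggsHom E F)
    (hres : ∀ j, ∃ c, (E.par j).fil c = ⊤ ∧ (F.par j).filGT c = ⊥) :
    ∃ (r t : ℕ) (σ : Fin r ⊕ Fin t ≃ Fin q), ∀ a, Nonempty (θ.NormalForm a σ) := by
  choose r t σ D using θ.exists_normalForm hres
  have hlc : IsLocallyConstant r := by
    rw [IsLocallyConstant.iff_eventually_eq]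
    intro a
    have h := (D a).some.eventually_finrank
    rw [eventually_nhdsWithin_iff] at h
    filter_upwards [h.eventually_nhds] with y hy
    by_cases hya : y = a
    · rw [hya]
    · have h1 : ∀ᶠ z in 𝓝[≠] y, finrank ℂ (LinearMap.range (θ.fibMap z)) = r a := by
        filter_upwards [eventually_nhdsWithin_of_eventually_nhds hy,
          eventually_nhdsWithin_of_eventually_nhds (isOpen_ne.mem_nhds hya)] with z hz hza
        exact hz hza
      obtain ⟨z, hz1, hz2⟩ := ((D y).some.eventually_finrank.and h1).exists
      exact hz1.symm.trans hz2
  refine ⟨r ∞, t ∞, σ ∞, fun a => ?_⟩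
  have hr : r a = r ∞ := hlc.apply_eq_of_isPreconnected isPreconnected_univ trivial trivial
  have key : ∀ {r₁ t₁ r₂ t₂ : ℕ} (σ₁ : Fin r₁ ⊕ Fin t₁ ≃ Fin q) (σ₂ : Fin r₂ ⊕ Fin t₂ ≃ Fin q),
      r₁ = r₂ → Nonempty (θ.NormalForm a σ₁) → Nonempty (θ.NormalForm a σ₂) := by
    rintro r₁ t₁ r₂ t₂ σ₁ σ₂ rfl ⟨D⟩
    have h1 := Fintype.card_congr σ₁
    have h2 := Fintype.card_congr σ₂
    simp only [Fintype.card_sum, Fintype.card_fin] at h1 h2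
    obtain rfl : t₁ = t₂ := by omega
    exact ⟨D.reindex σ₂⟩
  exact key _ _ hr (D a)

/-- The kernel of the one-form, extended over all points. -/
def kernelSub (D : ∀ a, θ.NormalForm a σ) (y : OnePoint ℂ) : Submodule ℂ (E.Fib y) :=
  Submodule.span ℂ (Set.range fun j => (D y).v (σ (Sum.inr j)) y)

/-- The saturation of the image of the one-form. -/
def imageSub (D : ∀ a, θ.NormalForm a σ) (y : OnePoint ℂ) : Submodule ℂ (F.Fib y) :=
  Submodule.span ℂ (Set.range fun i => (D y).u i y)

variable (D : ∀ a, θ.NormalForm a σ)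

theorem indep_kernel (D : θ.NormalForm a σ) :
    ∀ᶠ y in 𝓝 a, LinearIndependent ℂ fun j => D.v (σ (Sum.inr j)) y := by
  filter_upwards [D.frame.2] with y hy
  exact hy.1.comp _ (σ.injective.comp Sum.inr_injective)

/-- At `y` near `a`, the frame from `D a` spans the kernel of `fibMap y`, while the one from `D y`
spans a subspace of that kernel. Both have dimension `t`, so the pointwise choices fit together. -/
theorem isFrameAt_kernelSub (a : OnePoint ℂ) :
    E.IsFrameAt (kernelSub D) (fun j => (D a).v (σ (Sum.inr j))) a := by
  refine ⟨fun j => (D a).frame.1 _, (indep_kernel (D a)).and ?_⟩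
  have h1 := eventually_nhdsWithin_iff.1 ((D a).eventually_fibMap.and (eventually_notMem_range (x := x) a))
  filter_upwards [h1, indep_kernel (D a)] with y hy hi
  by_cases hya : y = a
  · subst hya; rfl
  · obtain ⟨⟨-, hk⟩, hyx⟩ := hy hya
    refine (Submodule.eq_of_le_of_finrank_eq
      (hk ▸ (D y).span_le_ker_fibMap hyx : kernelSub D y ≤ _) ?_).symm
    rw [kernelSub, finrank_span_eq_card hi, finrank_span_eq_card (indep_kernel (D y)).self_of_nhds]

/-- Dual to the kernel: the span from `D y` contains the image, which the frame from `D a` spans,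
and both have dimension `r`. -/
theorem isFrameAt_imageSub (a : OnePoint ℂ) :
    F.IsFrameAt (imageSub D) (D a).u a := by
  refine ⟨(D a).hol_u, (D a).indep_u.and ?_⟩
  have h1 := eventually_nhdsWithin_iff.1 ((D a).eventually_fibMap.and (eventually_notMem_range (x := x) a))
  filter_upwards [h1, (D a).indep_u] with y hy hi
  by_cases hya : y = a
  · subst hya; rfl
  · obtain ⟨⟨hk, -⟩, hyx⟩ := hy hya
    refine Submodule.eq_of_le_of_finrank_eq
      (hk ▸ (D y).range_fibMap_le hyx : _ ≤ imageSub D y) ?_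
    rw [imageSub, finrank_span_eq_card hi, finrank_span_eq_card (D y).indep_u.self_of_nhds]

theorem finrank_kernelSub (y : OnePoint ℂ) : finrank ℂ (kernelSub D y) = t := by
  rw [kernelSub, finrank_span_eq_card (indep_kernel (D y)).self_of_nhds, Fintype.card_fin]

theorem finrank_imageSub (y : OnePoint ℂ) : finrank ℂ (imageSub D y) = r := by
  rw [imageSub, finrank_span_eq_card (D y).indep_u.self_of_nhds, Fintype.card_fin]

theorem toFun_apply_of_mem_kernelSub {y : OnePoint ℂ} (hy : y ∉ Set.range x)
    (X : TangentSpace 𝓘(ℂ) y) {v : E.Fib y} (hv : v ∈ kernelSub D y) : θ.toFun y X v = 0 := by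
  have h : θ.fibMap y v = 0 := (D y).span_le_ker_fibMap hy hv
  rw [toFun_eq_smul_fibMap, LinearMap.smul_apply, h, smul_zero]

theorem toFun_apply_mem_imageSub {y : OnePoint ℂ} (hy : y ∉ Set.range x)
    (X : TangentSpace 𝓘(ℂ) y) (v : E.Fib y) : θ.toFun y X v ∈ imageSub D y := by
  rw [toFun_eq_smul_fibMap]
  exact Submodule.smul_mem _ _ ((D y).range_fibMap_le hy ⟨v, rfl⟩)

end HiggsHom

end ParabolicBundle

/-! ### The full and the zero subbundle. -/

namespace HolVectorBundle

variable {n : ℕ} (E : HolVectorBundle n)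

theorem isSubbundle_full : E.IsSubbundle E.full n := fun a =>
  ⟨fun j y => E.lift a y (fun i => (1 : Matrix (Fin n) (Fin n) ℂ) i j),
    fun _ => holAt_lift (E.mem_base_self a) (hol_const _), by
      filter_upwards [E.base_mem_nhds a] with y hy
      exact frame_of_mul_eq_one hy (mul_one _)⟩

theorem isFrameAt_bot (s : Fin 0 → ∀ y, E.Fib y) (a : OnePoint ℂ) :
    E.IsFrameAt (fun _ => ⊥) s a :=
  ⟨fun i => i.elim0, Eventually.of_forall fun y => ⟨linearIndependent_empty_type, by simp⟩⟩

theorem isSubbundle_bot : E.IsSubbundle (fun _ => ⊥) 0 := fun a =>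
  ⟨fun i => i.elim0, E.isFrameAt_bot _ a⟩

variable {E}

/-- In rank zero the only frame is empty, so the form is itself a meromorphic function on the
sphere. -/
theorem HasDegree.eq_zero_of_bot {d : ℤ} (h : E.HasDegree (fun _ => ⊥) 0 d) : d = 0 := by
  obtain ⟨w, m, hw, rfl⟩ := h
  rw [sum_order_eq_zero fun a => hw a (fun i => i.elim0) (E.isFrameAt_bot _ a), neg_zero]

end HolVectorBundle

/-! ### Relations between degrees -/

theorem HasOrderAt.eventually_zero {f : OnePoint ℂ → ℂ} {a : OnePoint ℂ} {m : ℤ}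
    (h : HasOrderAt f a m) : ∀ᶠ y in 𝓝[≠] a, HasOrderAt f y 0 := by
  have h1 := h.1.eventually_analyticAt
  have h2 := eventually_chart_symm_nhdsNE.2 h.eventually_ne
  rw [← eventually_chart_symm_nhdsNE]
  filter_upwards [h1, h2] with w hw1 hw2
  exact HasOrderAt.of_hol ((hol_chart_symm_iff a w).2 hw1) hw2

/-- An infinite support would accumulate somewhere on the compact sphere, but near any point all
other orders vanish. -/
theorem finite_support_order {f : OnePoint ℂ → ℂ} {n : OnePoint ℂ → ℤ}
    (h : ∀ a, HasOrderAt f a (n a)) : (Function.support n).Finite := by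
  by_contra hinf
  obtain ⟨a, ha⟩ := Set.Infinite.exists_accPt_principal hinf
  rw [accPt_iff_frequently_nhdsNE] at ha
  refine ha ?_
  filter_upwards [(h a).eventually_zero] with y hy
  simpa using (h y).unique hy

namespace ParabolicBundle

variable {s : ℕ} {x : Fin s → OnePoint ℂ} {q p : ℕ}

/-- Comparison of the degree of the source with the degrees of the kernel and the saturated image,
for a one-form whose contractions extend holomorphically over the punctures. -/
theorem HiggsHom.degree_le {E : ParabolicBundle x q} {F : ParabolicBundle x p}
    {θ : HiggsHom E F} {r t : ℕ} {σ : Fin r ⊕ Fin t ≃ Fin q} (D : ∀ a, θ.NormalForm a σ)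
    {dE dK dI : ℤ} (hE : E.HasDegree E.full q dE) (hK : E.HasDegree (kernelSub D) t dK)
    (hI : F.HasDegree (imageSub D) r dI) : dE ≤ dK + dI - 2 * r := by
  obtain ⟨wE, mE, hwE, rfl⟩ := hE
  obtain ⟨wK, mK, hwK, rfl⟩ := hK
  obtain ⟨wI, mI, hwI, rfl⟩ := hI
  choose k hk0 hk using fun a i => HasOrderAt.exists_of_hol ((D a).hol_d i) ((D a).d_ne i)
  -- The volume form of the source divided by those of the kernel and of the image along θ. It does
  -- not depend on the adapted frame, so `f y y` is one global meromorphic function, whose divisor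
  -- `c` has degree zero.
  set f : OnePoint ℂ → OnePoint ℂ → ℂ := fun a y => wE y (fun i => (D a).v i y) /
    (wK y (fun j => (D a).v (σ (Sum.inr j)) y) *
      wI y (fun i => θ.toFun y (translationField y) ((D a).v (σ (Sum.inl i)) y)))
  set c : OnePoint ℂ → ℤ := fun a =>
    mE a - (mK a + ((∑ i, (Finsupp.single (∞ : OnePoint ℂ) (2 : ℤ) a + k a i)) + mI a))
  have hnum : ∀ a, HasOrderAt (fun y => wE y (fun i => (D a).v i y)) a (mE a) := fun a =>
    hwE a _ (D a).frame
  have hden : ∀ a, HasOrderAt (fun y => wK y (fun j => (D a).v (σ (Sum.inr j)) y) *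
      wI y (fun i => θ.toFun y (translationField y) ((D a).v (σ (Sum.inl i)) y))) a
      (mK a + ((∑ i, (Finsupp.single (∞ : OnePoint ℂ) (2 : ℤ) a + k a i)) + mI a)) := fun a => by
    refine (hwK a _ (isFrameAt_kernelSub D a)).mul ?_
    refine ((HasOrderAt.prod (s := Finset.univ) fun i _ =>
      (hasOrderAt_translationField a).mul (hk a i)).mul (hwI a _ (isFrameAt_imageSub D a))).congr ?_
    filter_upwards [eventually_nhdsWithin_of_eventually_nhds (D a).apply_inl,
      eventually_notMem_range (x := x) a] with y hy hyx
    simp only [hy hyx]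
    rw [AlternatingMap.map_smul_univ, smul_eq_mul]
  have hf : ∀ a, HasOrderAt (fun y => f y y) a (c a) := fun a => by
    refine ((hnum a).div (hden a)).congr ?_
    filter_upwards [(hnum a).eventually_ne, (hden a).eventually_ne, eventually_notMem_range (x := x) a,
      eventually_nhdsWithin_of_eventually_nhds (D a).frame.2,
      eventually_nhdsWithin_of_eventually_nhds (D a).apply_inr,
      eventually_nhdsWithin_of_eventually_nhds (isFrameAt_kernelSub D a).2]
      with y h1 h2 hyx hv hr hK
    have hv' := (D y).frame.2.self_of_nhds
    have key := alternating_adapted_frame (θ.toFun y (translationField y)) σ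
      (v' := fun i => (D y).v i y) hv.2 (hr hyx _)
      (fun j => by
        rw [hK.2]
        exact Submodule.subset_span ⟨j, rfl⟩) (wE y) (wK y) (wI y)
    obtain ⟨C, hC, hC'⟩ := exists_alternating_ratio hv.1 hv'.1 (hv'.2.trans hv.2.symm)
    have h3 : wE y (fun i => (D y).v i y) ≠ 0 := by
      rw [hC']
      exact mul_ne_zero hC h1
    have h4 : wK y (fun j => (D y).v (σ (Sum.inr j)) y) *
        wI y (fun i => θ.toFun y (translationField y) ((D y).v (σ (Sum.inl i)) y)) ≠ 0 :=
      fun h0 => mul_ne_zero h3 h2 (by rw [key, h0, mul_zero])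
    simp only [f]
    rw [div_eq_div_iff h2 h4]
    exact key.symm
  set m : OnePoint ℂ →₀ ℤ := Finsupp.ofSupportFinite c (finite_support_order hf)
  have hm := sum_order_eq_zero (m := m) hf
  -- The divisor of the product of the diagonal entries, that is of the determinant of θ from the
  -- quotient by the kernel to the saturated image. It is effective since the entries are
  -- holomorphic.
  set κ : OnePoint ℂ →₀ ℤ := mE - mK - mI - Finsupp.single (∞ : OnePoint ℂ) (2 * r : ℤ) - m with hκ
  have hκ0 : 0 ≤ κ := fun a => by
    have h1 : κ a = ∑ i, k a i := by
      simp only [hκ, Finsupp.sub_apply, m, Finsupp.ofSupportFinite_coe, c, Finset.sum_add_distrib,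
        Finset.sum_const, Finset.card_univ, Fintype.card_fin, nsmul_eq_mul]
      by_cases ha : a = (∞ : OnePoint ℂ)
      · subst ha
        simp only [Finsupp.single_eq_same]
        ring
      · simp only [Finsupp.single_eq_of_ne ha]
        ring
    rw [h1]
    exact Finset.sum_nonneg fun i _ => hk0 a i
  have h1 : 0 ≤ Finsupp.degree κ := Finset.sum_nonneg fun a _ => hκ0 a
  rw [hκ, map_sub, map_sub, map_sub, map_sub, Finsupp.degree_single] at h1
  change Finsupp.degree m = 0 at hm
  change -Finsupp.degree mE ≤ -Finsupp.degree mK + -Finsupp.degree mI - 2 * r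
  linarith

/-- The dual of `det U ⊗ det V` has two meromorphic sections: the one given by `TrivialDet`, with
divisor `∑ k j • x j`, and the product of those computing the two degrees. Their quotient is a
meromorphic function, so the divisors have the same degree. -/
theorem parDegree_add_eq_zero {U : ParabolicBundle x p} {V : ParabolicBundle x q}
    (h : TrivialDet U V) : U.parDegree + V.parDegree = 0 := by
  obtain ⟨k, hk, w, hw⟩ := h
  obtain ⟨wU, mU, hwU, hdU⟩ := U.isSubbundle_full.hasDegree
  obtain ⟨wV, mV, hwV, hdV⟩ := V.isSubbundle_full.hasDegree
  choose u hu using U.isSubbundle_full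
  choose v hv using V.isSubbundle_full
  set m : OnePoint ℂ →₀ ℤ := ∑ j, Finsupp.single (x j) (k j) - (mU + mV)
  have hf : ∀ a, HasOrderAt (fun y => w y (fun i => u y i y) (fun i => v y i y) /
      (wU y (fun i => u y i y) * wV y (fun i => v y i y))) a (m a) := fun a => by
    have h1 := (hw a _ _ (hu a) (hv a)).div ((hwU a _ (hu a)).mul (hwV a _ (hv a)))
    rw [show m a = ∑ j, Finsupp.single (x j) (k j) a - (mU a + mV a) by
      simp [m]]
    refine h1.congr (eventually_nhdsWithin_of_eventually_nhds ?_)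
    filter_upwards [(hu a).2, (hv a).2] with y hy1 hy2
    have hu' := (hu y).2.self_of_nhds
    have hv' := (hv y).2.self_of_nhds
    obtain ⟨C, hC, hCu⟩ := exists_alternating_ratio hy1.1 hu'.1 (hu'.2.trans hy1.2.symm)
    obtain ⟨C', hC', hCv⟩ := exists_alternating_ratio hy2.1 hv'.1 (hv'.2.trans hy2.2.symm)
    set ev : (V.Fib y [⋀^Fin q]→ₗ[ℂ] ℂ) →ₗ[ℂ] ℂ :=
      { toFun := fun g => g fun i => v a i y
        map_add' := fun _ _ => rfl
        map_smul' := fun _ _ => rfl }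
    have h2 : w y (fun i => u y i y) (fun i => v a i y) =
        C * w y (fun i => u a i y) (fun i => v a i y) := hCu (ev.compAlternatingMap (w y))
    rw [hCu, hCv, hCv, h2]
    rw [show C' * (C * w y (fun i => u a i y) (fun i => v a i y)) =
        (C * C') * w y (fun i => u a i y) (fun i => v a i y) by ring,
      show C * wU y (fun i => u a i y) * (C' * wV y (fun i => v a i y)) =
        (C * C') * (wU y (fun i => u a i y) * wV y (fun i => v a i y)) by ring,
      mul_div_mul_left _ _ (mul_ne_zero hC hC')]
  have hm := sum_order_eq_zero hf
  change Finsupp.degree m = 0 at hm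
  change _ = -Finsupp.degree mU at hdU
  change _ = -Finsupp.degree mV at hdV
  simp only [m, map_sub, map_add, map_sum, Finsupp.degree_single] at hm
  have h1 : ((U.degree U.full p : ℤ) : ℝ) + (V.degree V.full q : ℤ) + ∑ j, (k j : ℝ) = 0 := by
    rw [hdU, hdV]
    exact_mod_cast (by linarith : -Finsupp.degree mU + -Finsupp.degree mV + ∑ j, k j = 0)
  simp only [hk, Finset.sum_add_distrib] at h1
  rw [parDegree, parDegree]
  linarith

end ParabolicBundle

/-! ### The degree estimate. -/

theorem propositionp {s p q : ℕ} (hp : 0 < p) (hq : 0 < q)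
    (x : Fin s → OnePoint ℂ) (hx : Function.Injective x)
    (α : Fin s → Fin p → ℝ) (β : Fin s → Fin q → ℝ) (hαβ : IsMultiweight α β)
    (h₁ : ∀ j, α j ⟨p - 1, Nat.sub_one_lt_of_lt hp⟩ < β j ⟨0, hq⟩)
    (ε : ℝ) (hε : ε = ∑ j, (β j ⟨q - 1, Nat.sub_one_lt_of_lt hq⟩ - α j ⟨0, hp⟩))
    (h₂ : ε < 2)
    (H : SUHiggsBundle x p q) (hH : H.HasType α β) (hss : H.Semistable)
    (hdeg : H.U.parDegree - H.V.parDegree < 2 - ε) :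
    ∀ y ∉ Set.range x, ∀ X : TangentSpace 𝓘(ℂ) y, H.δ.toFun y X = 0 := by
  have hβmin : ∀ j i, β j ⟨0, hq⟩ ≤ β j i := fun j i =>
    hαβ.monotone_right j (Fin.mk_le_of_le_val (Nat.zero_le _))
  have hβmax : ∀ j i, β j i ≤ β j ⟨q - 1, Nat.sub_one_lt_of_lt hq⟩ := fun j i =>
    hαβ.monotone_right j (Fin.le_def.2 (Nat.le_sub_one_of_lt i.2))
  have hαmin : ∀ j i, α j ⟨0, hp⟩ ≤ α j i := fun j i =>
    hαβ.monotone_left j (Fin.mk_le_of_le_val (Nat.zero_le _))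
  have hαmax : ∀ j i, α j i ≤ β j ⟨0, hq⟩ := fun j i =>
    (hαβ.monotone_left j (Fin.le_def.2 (Nat.le_sub_one_of_lt i.2))).trans (h₁ j).le
  -- The smallest weight of `V` is the level that annihilates the residue.
  obtain ⟨r, t, σ, hD⟩ := H.δ.exists_uniform_normalForm fun j =>
    ⟨β j ⟨0, hq⟩, (hH j).2.fil_eq_top (hβmin j), (hH j).1.filGT_eq_bot (hαmax j)⟩
  have D := fun a => (hD a).some
  have hrt : r + t = q := by simpa using Fintype.card_congr σ
  have hqt : (q : ℝ) - t = r := by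
    rw [sub_eq_iff_eq_add]
    exact_mod_cast hrt.symm
  have hK : H.V.IsSubbundle (ParabolicBundle.HiggsHom.kernelSub D) t := fun a =>
    ⟨_, ParabolicBundle.HiggsHom.isFrameAt_kernelSub D a⟩
  have hI : H.U.IsSubbundle (ParabolicBundle.HiggsHom.imageSub D) r := fun a =>
    ⟨_, ParabolicBundle.HiggsHom.isFrameAt_imageSub D a⟩
  have hle := ParabolicBundle.HiggsHom.degree_le D H.V.isSubbundle_full.hasDegree hK.hasDegree
    hI.hasDegree
  have hsK := hss (fun _ => ⊥) (ParabolicBundle.HiggsHom.kernelSub D) 0 t H.U.isSubbundle_bot hK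
    fun y hy X => ⟨fun u hu => by
      rw [Submodule.mem_bot] at hu
      rw [hu, map_zero]
      exact Submodule.zero_mem _, fun v hv =>
      ParabolicBundle.HiggsHom.toFun_apply_of_mem_kernelSub D hy X hv⟩
  have hsI := hss (ParabolicBundle.HiggsHom.imageSub D) H.V.full r q hI H.V.isSubbundle_full
    fun y hy X => ⟨fun _ _ => trivial, fun v _ =>
      ParabolicBundle.HiggsHom.toFun_apply_mem_imageSub D hy X v⟩
  have hdet := ParabolicBundle.parDegree_add_eq_zero H.trivialDet
  have hbot : H.U.degree (fun _ => ⊥) 0 = 0 := H.U.isSubbundle_bot.hasDegree.eq_zero_of_bot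
  have hw0 : 0 ≤ ∑ j, ((H.U.par j).induced (⊥ : Submodule ℂ (H.U.Fib (x j)))).weight :=
    Finset.sum_nonneg fun j _ => by
      have := (hH j).1.le_weight_induced (hαmin j) ⊥
      rwa [finrank_bot, Nat.cast_zero, mul_zero] at this
  have hwI : (∑ j, α j ⟨0, hp⟩) * r ≤ ∑ j, ((H.U.par j).induced
      (ParabolicBundle.HiggsHom.imageSub D (x j))).weight := by
    rw [Finset.sum_mul]
    refine Finset.sum_le_sum fun j _ => ?_
    have := (hH j).1.le_weight_induced (hαmin j) (ParabolicBundle.HiggsHom.imageSub D (x j))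
    rwa [ParabolicBundle.HiggsHom.finrank_imageSub] at this
  -- The structure induced on the top subspace lives on a different type; its weight is compared by
  -- the general estimate in codimension zero.
  have hwV : ∑ j, (H.V.par j).weight ≤ ∑ j, ((H.V.par j).induced (H.V.full (x j))).weight := by
    refine Finset.sum_le_sum fun j _ => ?_
    have := (hH j).2.weight_sub_weight_induced_le (hβmax j) (H.V.full (x j))
    rw [HolVectorBundle.full, finrank_top, sub_self, mul_zero, sub_nonpos] at this
    exact this
  have hwK : ∑ j, (H.V.par j).weight - ∑ j, ((H.V.par j).induced
      (ParabolicBundle.HiggsHom.kernelSub D (x j))).weight ≤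
        (∑ j, β j ⟨q - 1, Nat.sub_one_lt_of_lt hq⟩) * r := by
    rw [← Finset.sum_sub_distrib, Finset.sum_mul]
    refine Finset.sum_le_sum fun j _ => ?_
    have := (hH j).2.weight_sub_weight_induced_le (hβmax j)
      (ParabolicBundle.HiggsHom.kernelSub D (x j))
    rw [ParabolicBundle.HiggsHom.finrank_kernelSub, HolVectorBundle.finrank_fib, hqt] at this
    exact this
  have hle' : (H.V.degree H.V.full q : ℝ) ≤ H.V.degree (ParabolicBundle.HiggsHom.kernelSub D) t +
      H.U.degree (ParabolicBundle.HiggsHom.imageSub D) r - 2 * r := by exact_mod_cast hle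
  simp only [ParabolicBundle.parDegreeSub, hbot, Int.cast_zero, zero_add] at hsK hsI
  rw [Finset.sum_sub_distrib] at hε
  -- The sum of both semistability inequalities, with `deg N + deg I` bounded below by `deg V + 2r`
  -- and the weights of `N` and `I` by `hwK` and `hwI`.
  have hbound : 2 * H.V.parDegree ≤ -(r * (2 - ε)) := by
    rw [ParabolicBundle.parDegree, hε]
    linarith
  -- Otherwise `pardeg U - pardeg V = -2 pardeg V ≥ r (2 - ε) ≥ 2 - ε`, since `2 - ε > 0`.
  have hr : r = 0 := by
    by_contra hr
    have h1 : (1 : ℝ) ≤ r := by exact_mod_cast Nat.one_le_iff_ne_zero.2 hr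
    nlinarith
  subst hr
  intro y hy X
  have hker : ParabolicBundle.HiggsHom.kernelSub D y = ⊤ := by
    refine Submodule.eq_top_of_finrank_eq ?_
    rw [ParabolicBundle.HiggsHom.finrank_kernelSub, HolVectorBundle.finrank_fib]
    omega
  ext v
  exact ParabolicBundle.HiggsHom.toFun_apply_of_mem_kernelSub D hy X (hker ▸ Submodule.mem_top)
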